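/- **Theorem 2.** Fix $\tau\in(0,1)$, real numbers $q_0,q_1,q_2,q_3\ge 0$ and $M$. Put $\mathbf q=\max\{3q_1,q_1+q_2,q_3\}$, $\bar{\mathbf q}_0=2\lceil q_0\mathbf q/2\rceil$, $q^*=2^{(\bar{\mathbf q}_0+4)/2}$. There is a constant $C_0=C_0(\tau,q_0,q_1,q_2,q_3,M)>0$ such that the following holds for all integers $n\ge1$ and $p,d$ with $\tau\le p/n\le 1/\tau$. *Setting.* Let $\ell_1,\dots,\ell_n:\mathbb R\to\mathbb R$ and $R:\mathbb R^p\to\mathbb R$ be convex (and non-random), and for $A\in\mathbb R^{n\times p}$ with rows $A_1,\dots,A_n$ let $H_\ell(w,A)=\frac1n\sum_{i=1}^n\ell_i(A_i^\top w)+R(w)$. *Loss.* Let $\bar\rho\in(0,1]$, $L_{\ell_i}\ge1$, and $\mathcal M_\ell,\mathcal D_\ell:(0,\bar\rho)\to[0,\infty)$ with $\mathcal M_\ell\le1\le\mathcal D_\ell$ be such that $|\ell_i(x)|\le L_{\ell_i}(1+|x|^{q_0})$ for all $i$ and $x\in\mathbb R$, and such that for every $\rho\in(0,\bar\rho)$ and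 $i$ there is $\ell_{i;\rho}\in C^3(\mathbb R)$ with values in $[0,\infty)$, $\|\ell_{i;\rho}-\ell_i\|_\infty\le\mathcal M_\ell(\rho)$, and $|\partial^k\ell_{i;\rho}(x)|\le\mathcal D_\ell(\rho)\,(1+|\ell_{i;\rho}(x)|^{q_k})$ for $k=1,2,3$ and all $x$. *Covariates.* Let $X_1,\dots,X_n$ be i.i.d. random vectors in $\mathbb R^p$ with $E[X_i]=0$ and $E[X_iX_i^\top]=\Sigma/n$, where $\Sigma$ is positive definite, $\lambda_{\max}(\Sigma)\le M$ and $\big(E|\sqrt n\,X_{i,j}|^{q^*}\big)^{1/q^*}\le M$ for all $i,j$. Suppose that $X_i$ is $d$-block dependent: there is a partition of $\{1,\dots,p\}$ into cells $B_1,\dots,B_k$, $k\le p$, of size at most $d$, such that the subvectors $(X_{i,j})_{j\in B_1},\dots,(X_{i,j})_{j\in B_k}$ are independent. Let $G_1,\dots,G_n$ be i.i.d. $N(0,\Sigma/n)$, and let $\mathbf X,\mathbf G\in\mathbb R^{n\times p}$ be the matrices with rows $X_i$ and $G_i$. Let $\hat w_{\mathbf X}$, $\hat w_{\mathbf G}$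 be random vectors that almost surely minimize $H_\ell(\cdot,\mathbf X)$, respectively $H_\ell(\cdot,\mathbf G)$, over $\mathbb R^p$. *Rate.* Let $$\sigma_n=\frac{p\,d^{3+\bar{\mathbf q}_0/2}}{n^{5/2}}+\frac{p\,d^2}{n^{3/2}}+\frac{p\,d^{\bar{\mathbf q}_0+2}}{n^{(\bar{\mathbf q}_0+3)/2}},\qquad \omega_n=n^{-(q_0q_1+3)/2}\sigma_n,$$ $\mathcal M_R(L,\delta)=\sup\{|R(w)-R(w')|:w,w'\in[-L,L]^p,\ \|w-w'\|_\infty\le\delta\}$, $\mathrm{Av}=\frac1n\sum_{i=1}^nL_{\ell_i}^{\mathbf q}$, $\log_+x=\max\{1,\log x\}$, and $$r_R(L)=\inf_{0<\rho<\bar\rho}\Big\{\mathcal M_\ell(\rho)+\mathcal D_\ell(\rho)^3\inf_{0<\delta<\omega_n}\Big[\mathcal M_R(L,\delta)+\mathrm{Av}^{1/3}L^{(\bar{\mathbf q}_0+3)/3}\big(\log_+(L/\delta)\big)^{2/3}\sigma_n^{1/3}\Big]\Big\}.$$ *Claim.* Let $\mathcal S_n\subset\mathbb R^p$ be measurable,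 and let $z\in\mathbb R$, $\rho_0>0$, $L_n\ge1$ and $\varepsilon_n\in[0,1/4)$ satisfy (i) $\max\{\Pr(\|\hat w_{\mathbf G}\|_\infty>L_n),\ \Pr(\|\hat w_{\mathbf X}\|_\infty>L_n)\}\le\varepsilon_n$; (ii) $\max\{\Pr(\inf_{w\in\mathbb R^p}H_\ell(w,\mathbf G)\ge z+\rho_0),\ \Pr(\inf_{w\in\mathcal S_n}H_\ell(w,\mathbf G)\le z+2\rho_0)\}\le\varepsilon_n$. Then $$\Pr(\hat w_{\mathbf X}\in\mathcal S_n)\le4\varepsilon_n+C_0\max\{1,\rho_0^{-3}\}\,r_R(L_n).$$ -/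

import Mathlib

open MeasureTheory ProbabilityTheory Set
open scoped ENNReal

noncomputable section

namespace BlockUniversality

/-! ### Risk, regularizer modulus and minimal risk

Vectors live in `Fin p → ℝ`, whose norm is the sup norm. -/

/-- The empirical risk `H_ℓ(w, A) = n⁻¹ ∑ i, ℓ_i(A_iᵀ w) + R(w)`, where `A_i` is the `i`-th row
of the design matrix `A`. -/
def risk {n p : ℕ} (ℓ : Fin n → ℝ → ℝ) (R : (Fin p → ℝ) → ℝ) (w : Fin p → ℝ)
    (A : Matrix (Fin n) (Fin p) ℝ) : ℝ :=
  (1 / (n : ℝ)) * ∑ i, ℓ i ((A.mulVec w) i) + R w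

/-- `w` is a global minimizer of the empirical risk with design matrix `A`. -/
def IsRiskMinimizer {n p : ℕ} (ℓ : Fin n → ℝ → ℝ) (R : (Fin p → ℝ) → ℝ)
    (A : Matrix (Fin n) (Fin p) ℝ) (w : Fin p → ℝ) : Prop :=
  ∀ w' : Fin p → ℝ, risk ℓ R w A ≤ risk ℓ R w' A

/-- The minimum of the risk over `S`, as an infimum in `[-∞, ∞]` (so it is `+∞` for empty `S`). -/
def minRisk {n p : ℕ} (ℓ : Fin n → ℝ → ℝ) (R : (Fin p → ℝ) → ℝ) (S : Set (Fin p → ℝ))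
    (A : Matrix (Fin n) (Fin p) ℝ) : EReal :=
  ⨅ w ∈ S, ((risk ℓ R w A : ℝ) : EReal)

/-- The design matrix whose `i`-th row is `X i ω`. -/
def designMatrix {Ω : Type*} {n p : ℕ} (X : Fin n → Ω → Fin p → ℝ) (ω : Ω) :
    Matrix (Fin n) (Fin p) ℝ :=
  Matrix.of fun i => X i ω

/-- The modulus of continuity of `R` on the cube `[-L, L]^p` for the sup norm. -/
def regModulus {p : ℕ} (R : (Fin p → ℝ) → ℝ) (L δ : ℝ) : ℝ :=
  sSup {x : ℝ | ∃ w w' : Fin p → ℝ, ‖w‖ ≤ L ∧ ‖w'‖ ≤ L ∧ ‖w - w'‖ ≤ δ ∧ x = |R w - R w'|}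

/-! ### Exponents -/

/-- `𝐪 = max {3 q₁, q₁ + q₂, q₃}`. -/
def bigQ (q : Fin 4 → ℝ) : ℝ := max (3 * q 1) (max (q 1 + q 2) (q 3))

/-- `q̄₀ = 2 ⌈q₀ 𝐪 / 2⌉`. -/
def qBar (q : Fin 4 → ℝ) : ℕ := 2 * ⌈q 0 * bigQ q / 2⌉₊

/-- `q* = 2 ^ ((q̄₀ + 4) / 2)`; the division is exact since `q̄₀` is even. -/
def qStar (q : Fin 4 → ℝ) : ℕ := 2 ^ ((qBar q + 4) / 2)

/-! ### Assumptions on the loss and on the covariates -/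

/-- Polynomial growth of the losses `ℓ_i`, and existence of nonnegative `C³` approximations
`ℓ_{i;ρ}` at sup-distance at most `Mℓ ρ`, with derivatives of orders `1, 2, 3` self-bounded by
`Dℓ ρ`. -/
structure LossAssumption {n : ℕ} (q : Fin 4 → ℝ) (ρbar : ℝ) (Lℓ : Fin n → ℝ) (Dℓ Mℓ : ℝ → ℝ)
    (ℓ : Fin n → ℝ → ℝ) : Prop where
  rhoBar_mem : ρbar ∈ Ioc (0 : ℝ) 1
  one_le_L : ∀ i, 1 ≤ Lℓ i
  M_mem : ∀ ρ ∈ Ioo 0 ρbar, 0 ≤ Mℓ ρ ∧ Mℓ ρ ≤ 1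
  one_le_D : ∀ ρ ∈ Ioo 0 ρbar, 1 ≤ Dℓ ρ
  growth : ∀ i x, |ℓ i x| / (1 + |x| ^ q 0) ≤ Lℓ i
  smooth_approx : ∃ ℓs : Fin n → ℝ → ℝ → ℝ, ∀ ρ ∈ Ioo 0 ρbar, ∀ i,
    (∀ x, 0 ≤ ℓs i ρ x) ∧
    ContDiff ℝ 3 (ℓs i ρ) ∧
    (∀ x, |ℓs i ρ x - ℓ i x| ≤ Mℓ ρ) ∧
    ∀ k : Fin 4, k ≠ 0 → ∀ x,
      |iteratedDeriv (k : ℕ) (ℓs i ρ) x| / (1 + |ℓs i ρ x| ^ q k) ≤ Dℓ ρ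

/-- A random vector `V` in `ℝ^p` is `d`-block dependent: its coordinates can be partitioned into
`k ≤ p` cells of size at most `d` such that the subvectors of `V` indexed by the different cells
are independent. -/
def IsBlockDependent {Ω : Type*} [MeasurableSpace Ω] {p : ℕ} (μ : Measure Ω)
    (V : Ω → Fin p → ℝ) (d : ℕ) : Prop :=
  ∃ k ≤ p, ∃ B : Fin k → Finset (Fin p),
    (∀ a b, a ≠ b → Disjoint (B a) (B b)) ∧
    (∀ j, ∃ a, j ∈ B a) ∧
    (∀ a, (B a).card ≤ d) ∧
    iIndepFun (fun (a : Fin k) (ω : Ω) (j : B a) => V ω j) μ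

/-- Largest eigenvalue of a real symmetric matrix. -/
def lambdaMax {p : ℕ} (A : Matrix (Fin p) (Fin p) ℝ) : ℝ := sSup (spectrum ℝ A)

/-- The rows `X_1, …, X_n` are i.i.d., centred with `E[X_i X_iᵀ] = Σ / n`, and `d`-block dependent;
the entries of `√n X_i` have `L^{q*}`-norm at most `M`, and `λ_max(Σ) ≤ M`. -/
structure CovariateAssumption {Ω : Type*} [MeasurableSpace Ω] {n p : ℕ} (μ : Measure Ω)
    (X : Fin n → Ω → Fin p → ℝ) (Sig : Matrix (Fin p) (Fin p) ℝ) (q : Fin 4 → ℝ) (M : ℝ)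
    (d : ℕ) : Prop where
  measurable : ∀ i, Measurable (X i)
  indep : iIndepFun X μ
  identDistrib : ∀ i j, IdentDistrib (X i) (X j) μ μ
  posDef : Sig.PosDef
  mean : ∀ i j, ∫ ω, X i ω j ∂μ = 0
  second_moment : ∀ i j k, ∫ ω, X i ω j * X i ω k ∂μ = Sig j k / n
  moment_le : ∀ i j, eLpNorm (fun ω => Real.sqrt n * X i ω j) (qStar q : ℝ≥0∞) μ ≤ ENNReal.ofReal M
  lambdaMax_le : lambdaMax Sig ≤ M
  blockDependent : ∀ i, IsBlockDependent μ (X i) d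

/-- The rows `G_1, …, G_n` are i.i.d. with law `N(0, Σ / n)`. -/
structure IsGaussianDesign {Ω : Type*} [MeasurableSpace Ω] {n p : ℕ} (μ : Measure Ω)
    (G : Fin n → Ω → Fin p → ℝ) (Sig : Matrix (Fin p) (Fin p) ℝ) : Prop where
  measurable : ∀ i, Measurable (G i)
  indep : iIndepFun G μ
  law : ∀ i, μ.map (fun ω => WithLp.toLp 2 (G i ω)) =
    multivariateGaussian (0 : EuclideanSpace ℝ (Fin p)) ((1 / (n : ℝ)) • Sig)

/-! ### The rate -/

/-- `log₊ x = max {1, log x}`. -/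
def logPlus (x : ℝ) : ℝ := max 1 (Real.log x)

/-- The rate `σ_n`. -/
def sigmaRate (n p d : ℕ) (q : Fin 4 → ℝ) : ℝ :=
  (p : ℝ) * (d : ℝ) ^ (3 + (qBar q : ℝ) / 2) / (n : ℝ) ^ ((5 : ℝ) / 2)
    + (p : ℝ) * (d : ℝ) ^ 2 / (n : ℝ) ^ ((3 : ℝ) / 2)
    + (p : ℝ) * (d : ℝ) ^ (qBar q + 2) / (n : ℝ) ^ (((qBar q : ℝ) + 3) / 2)

/-- `ω_n = n ^ (-(q₀ q₁ + 3) / 2) σ_n`. -/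
def omegaRate (n p d : ℕ) (q : Fin 4 → ℝ) : ℝ :=
  (n : ℝ) ^ (-(q 0 * q 1 + 3) / 2) * sigmaRate n p d q

/-- The average `Av({L_{ℓ_i}^𝐪}) = n⁻¹ ∑ i, L_{ℓ_i} ^ 𝐪`. -/
def avgL {n : ℕ} (q : Fin 4 → ℝ) (Lℓ : Fin n → ℝ) : ℝ :=
  (1 / (n : ℝ)) * ∑ i, Lℓ i ^ bigQ q

/-- The universality rate `r_R(L)`. -/
def rate {n p : ℕ} (d : ℕ) (q : Fin 4 → ℝ) (ρbar : ℝ) (Lℓ : Fin n → ℝ) (Dℓ Mℓ : ℝ → ℝ)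
    (R : (Fin p → ℝ) → ℝ) (L : ℝ) : ℝ :=
  ⨅ ρ : Ioo (0 : ℝ) ρbar, (Mℓ ρ + Dℓ ρ ^ 3 *
    ⨅ δ : Ioo (0 : ℝ) (omegaRate n p d q), (regModulus R L δ +
      avgL q Lℓ ^ ((1 : ℝ) / 3) * L ^ (((qBar q : ℝ) + 3) / 3) *
        logPlus (L / δ) ^ ((2 : ℝ) / 3) * sigmaRate n p d q ^ ((1 : ℝ) / 3)))

end BlockUniversality

end

/-! The event `wX ∈ S` is detected through two minima. On the event that `‖wX‖ ≤ L` and `wX ∈ S`,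
either the risk of the design `X` has minimum at least `z + 3ρ₀/2`, or its minimum over `S`
intersected with the cube is at most that. For `G` the corresponding events are unlikely by
hypothesis, so it suffices to compare the laws of such minima under the two designs. The losses are
replaced by smooth ones, the minima by minima over `δ`-nets, and those by log-sum-exp soft minima at
inverse temperature `n s`. The errors are `Mℓ ρ`, the modulus of the regularizer plus a random
Lipschitz constant times `δ`, and the entropy `p log(L/δ) / (n s)`.
`measureReal_mem_le_of_comparison` performs this reduction.

Smooth functions of the soft minimum are compared by Lindeberg replacement on two levels: rows are
swapped one at a time, and within a row its independent blocks are swapped one at a time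
(`abs_integral_softRisk_sub_le`, `abs_integral_rowFun_sub_le`). In a second-order expansion in one
block the linear terms integrate to zero and the quadratic terms agree, because the two rows share
mean and covariance; a remainder cubic in the block is left.

The remainder is the delicate point (`abs_third_derivative_le`, `abs_softMin_taylor_le`). The third
derivative is a polynomial in Gibbs averages of derivatives of the moving loss, under weights that
contain that same loss. Chebyshev association merges products of averages into one average of `(1 +
ℓ)^𝐪`. The factor `exp(-s ℓ)` is decreasing in `ℓ`, so deleting it from the weights only increases
that average. The new weights do not involve the current row, so the row can be integrated inside
the average. What remains is a moment of order `qBar` of a linear functional of a hybrid row,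
controlled by a Rosenthal-type inequality (`integral_hybrid_pow_le`). Summing over blocks and rows
gives a multiple of `(1 + s)² D³ B₀`, where `B₀ = Av · L^(qBar+3) · σ_n`.

Finally `s` is chosen as `lg / η` with `lg = log₊(L/δ)` and `η³ = B₀ lg²`. This makes both the
entropy and the comparison error of order `η`, the cube-root term of the rate
(`measureReal_mem_le_of_smoothLoss`). -/

namespace BlockUniversality

/-! ### Gibbs averages: association, tilting, differentiation -/

section Gibbs

variable {ι : Type*} {N : Finset ι} {w f g : ι → ℝ}

/-- The average of `f` over `N` with respect to the normalized weights `w`. -/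
noncomputable def gibbsAvg (N : Finset ι) (w f : ι → ℝ) : ℝ := (∑ u ∈ N, w u * f u) / ∑ u ∈ N, w u

/-- Chebyshev's association inequality for weighted sums. -/
theorem sum_mul_sum_le_of_comonotone (hw : ∀ u ∈ N, 0 ≤ w u)
    (h : ∀ u ∈ N, ∀ v ∈ N, 0 ≤ (f u - f v) * (g u - g v)) :
    (∑ u ∈ N, w u * f u) * (∑ u ∈ N, w u * g u) ≤
      (∑ u ∈ N, w u) * ∑ u ∈ N, w u * (f u * g u) := by
  -- Symmetrization: the sum over ordered pairs is twice the difference of the two sides.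
  have key : 0 ≤ ∑ u ∈ N, ∑ v ∈ N, w u * w v * ((f u - f v) * (g u - g v)) :=
    Finset.sum_nonneg fun u hu => Finset.sum_nonneg fun v hv =>
      mul_nonneg (mul_nonneg (hw u hu) (hw v hv)) (h u hu v hv)
  have e : ∑ u ∈ N, ∑ v ∈ N, w u * w v * ((f u - f v) * (g u - g v)) =
      2 * ((∑ u ∈ N, w u) * ∑ u ∈ N, w u * (f u * g u)) -
        2 * ((∑ u ∈ N, w u * f u) * (∑ u ∈ N, w u * g u)) := by
    have h1 : ∑ u ∈ N, ∑ v ∈ N, w u * w v * ((f u - f v) * (g u - g v)) =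
      ∑ u ∈ N, ∑ v ∈ N, (w v * (w u * (f u * g u))) + ∑ u ∈ N, ∑ v ∈ N, (w u * (w v * (f v * g v)))
      - ∑ u ∈ N, ∑ v ∈ N, ((w u * f u) * (w v * g v))
      - ∑ u ∈ N, ∑ v ∈ N, ((w v * f v) * (w u * g u)) := by
      simp only [← Finset.sum_add_distrib, ← Finset.sum_sub_distrib]
      refine Finset.sum_congr rfl fun u _ => Finset.sum_congr rfl fun v _ => by ring
    rw [h1]
    rw [Finset.sum_comm, ← Finset.sum_mul_sum N N w, ← Finset.sum_mul_sum N N,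
      Finset.sum_comm (f := fun u v => (w v * f v) * (w u * g u)), ← Finset.sum_mul_sum]
    ring
  linarith

theorem gibbsAvg_mul_le (hw : ∀ u ∈ N, 0 ≤ w u) (hpos : 0 < ∑ u ∈ N, w u)
    (h : ∀ u ∈ N, ∀ v ∈ N, 0 ≤ (f u - f v) * (g u - g v)) :
    gibbsAvg N w f * gibbsAvg N w g ≤ gibbsAvg N w (fun u => f u * g u) := by
  unfold gibbsAvg
  rw [div_mul_div_comm, div_le_div_iff₀ (by positivity) hpos]
  nlinarith [sum_mul_sum_le_of_comonotone hw h]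

/-- Tilting the weights by a factor that decreases in `f` decreases the average of `f`. -/
theorem gibbsAvg_tilt_le {c e : ι → ℝ} (hc : ∀ u ∈ N, 0 ≤ c u)
    (hpos : 0 < ∑ u ∈ N, c u) (hpos' : 0 < ∑ u ∈ N, c u * e u)
    (h : ∀ u ∈ N, ∀ v ∈ N, (f u - f v) * (e u - e v) ≤ 0) :
    gibbsAvg N (fun u => c u * e u) f ≤ gibbsAvg N c f := by
  unfold gibbsAvg
  rw [div_le_div_iff₀ hpos' hpos]
  have := sum_mul_sum_le_of_comonotone (f := f) (g := fun u => - e u) hc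
    (fun u hu v hv => by have := h u hu v hv; nlinarith)
  have e1 : ∑ u ∈ N, c u * e u * f u = - ∑ u ∈ N, c u * (f u * -e u) := by
    rw [← Finset.sum_neg_distrib]; exact Finset.sum_congr rfl fun u _ => by ring
  have e2 : ∑ u ∈ N, c u * -e u = - ∑ u ∈ N, c u * e u := by
    rw [← Finset.sum_neg_distrib]; exact Finset.sum_congr rfl fun u _ => by ring
  rw [e1]; rw [e2] at this; nlinarith

theorem gibbsAvg_mono (hw : ∀ u ∈ N, 0 ≤ w u) (h : ∀ u ∈ N, f u ≤ g u) :
    gibbsAvg N w f ≤ gibbsAvg N w g := by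
  unfold gibbsAvg
  refine div_le_div_of_nonneg_right ?_ (Finset.sum_nonneg hw)
  exact Finset.sum_le_sum fun u hu => mul_le_mul_of_nonneg_left (h u hu) (hw u hu)

theorem gibbsAvg_nonneg (hw : ∀ u ∈ N, 0 ≤ w u) (h : ∀ u ∈ N, 0 ≤ f u) :
    0 ≤ gibbsAvg N w f :=
  div_nonneg (Finset.sum_nonneg fun u hu => mul_nonneg (hw u hu) (h u hu)) (Finset.sum_nonneg hw)

theorem gibbsAvg_const_mul (a : ℝ) :
    gibbsAvg N w (fun u => a * f u) = a * gibbsAvg N w f := by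
  unfold gibbsAvg
  rw [← mul_div_assoc, Finset.mul_sum]
  congr 1; exact Finset.sum_congr rfl fun u _ => by ring

theorem gibbsAvg_le_of_le {a : ℝ} (hw : ∀ u ∈ N, 0 ≤ w u) (hpos : 0 < ∑ u ∈ N, w u)
    (h : ∀ u ∈ N, f u ≤ a) : gibbsAvg N w f ≤ a := by
  unfold gibbsAvg
  rw [div_le_iff₀ hpos, Finset.mul_sum]
  exact Finset.sum_le_sum fun u hu => by
    rw [mul_comm]; exact mul_le_mul_of_nonneg_right (h u hu) (hw u hu)

theorem abs_gibbsAvg_le (hw : ∀ u ∈ N, 0 ≤ w u) (h : ∀ u ∈ N, |f u| ≤ g u) :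
    |gibbsAvg N w f| ≤ gibbsAvg N w g := by
  rw [abs_le]
  constructor
  · have : -gibbsAvg N w g = gibbsAvg N w (fun u => -1 * g u) := by rw [gibbsAvg_const_mul]; ring
    rw [this]
    exact gibbsAvg_mono hw fun u hu => by have := neg_abs_le (f u); have := h u hu; linarith
  · exact gibbsAvg_mono hw fun u hu => (le_abs_self _).trans (h u hu)

/-- Derivative of a Gibbs average whose weights satisfy `w' = -s a w`. -/
theorem hasDerivAt_gibbsAvg {w f : ι → ℝ → ℝ} {a f' : ι → ℝ} {s t : ℝ}
    (hpos : 0 < ∑ u ∈ N, w u t)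
    (hw : ∀ u ∈ N, HasDerivAt (w u) (-s * a u * w u t) t)
    (hf : ∀ u ∈ N, HasDerivAt (f u) (f' u) t) :
    HasDerivAt (fun t => gibbsAvg N (fun u => w u t) (fun u => f u t))
      (gibbsAvg N (fun u => w u t) f' -
        s * (gibbsAvg N (fun u => w u t) (fun u => a u * f u t) -
          gibbsAvg N (fun u => w u t) a * gibbsAvg N (fun u => w u t) (fun u => f u t))) t := by
  unfold gibbsAvg
  have h1 : HasDerivAt (fun t => ∑ u ∈ N, w u t * f u t)
      (∑ u ∈ N, (-s * a u * w u t * f u t + w u t * f' u)) t :=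
    HasDerivAt.fun_sum fun u hu => (hw u hu).mul (hf u hu)
  have h2 : HasDerivAt (fun t => ∑ u ∈ N, w u t) (∑ u ∈ N, -s * a u * w u t) t :=
    HasDerivAt.fun_sum fun u hu => hw u hu
  refine (h1.div h2 hpos.ne').congr_deriv ?_
  have e1 : ∑ u ∈ N, (-s * a u * w u t * f u t + w u t * f' u) =
      -s * ∑ u ∈ N, w u t * (a u * f u t) + ∑ u ∈ N, w u t * f' u := by
    rw [Finset.sum_add_distrib, Finset.mul_sum]
    congr 1; exact Finset.sum_congr rfl fun u _ => by ring
  have e2 : ∑ u ∈ N, -s * a u * w u t = -s * ∑ u ∈ N, w u t * a u := by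
    rw [Finset.mul_sum]; exact Finset.sum_congr rfl fun u _ => by ring
  rw [e1, e2]
  have := hpos.ne'
  field_simp
  ring

/-- A third-order Taylor bound along `[0, 1]`. -/
theorem abs_taylor_two_le {g g₁ g₂ g₃ : ℝ → ℝ} {K : ℝ}
    (h₀ : ∀ t, HasDerivAt g (g₁ t) t) (h₁ : ∀ t, HasDerivAt g₁ (g₂ t) t)
    (h₂ : ∀ t, HasDerivAt g₂ (g₃ t) t) (hK : ∀ t ∈ Icc (0 : ℝ) 1, |g₃ t| ≤ K) :
    |g 1 - g 0 - g₁ 0 - g₂ 0 / 2| ≤ K := by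
  have hK0 : 0 ≤ K := (abs_nonneg _).trans (hK 0 (by simp))
  -- On `[0, 1]` integrating the bound `K` gives `K` again. Three such steps reach the Taylor
  -- remainder, giving up the factor `1/6`.
  have mv : ∀ (F F' : ℝ → ℝ), (∀ t, HasDerivAt F (F' t) t) → (∀ t ∈ Icc (0 : ℝ) 1, |F' t| ≤ K) →
      ∀ t ∈ Icc (0 : ℝ) 1, |F t - F 0| ≤ K := by
    intro F F' hF hb t ht
    have := (convex_Icc (0 : ℝ) 1).norm_image_sub_le_of_norm_hasDerivWithin_le
      (f := F) (f' := F') (C := K) (fun x _ => (hF x).hasDerivWithinAt) (fun x hx => hb x hx)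
      (by simp : (0 : ℝ) ∈ Icc (0 : ℝ) 1) ht
    rw [Real.norm_eq_abs, Real.norm_eq_abs, sub_zero, abs_of_nonneg ht.1] at this
    nlinarith [ht.2]
  have s2 := mv g₂ g₃ h₂ hK
  have s1 := mv (fun t => g₁ t - g₂ 0 * t) (fun t => g₂ t - g₂ 0)
    (fun t => ((h₁ t).fun_sub ((hasDerivAt_id t).const_mul (g₂ 0))).congr_deriv (by ring)) s2
  have s0 := mv (fun t => g t - g₁ 0 * t - g₂ 0 * (t ^ 2 / 2)) (fun t => g₁ t - g₁ 0 - g₂ 0 * t)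
    (fun t => (((h₀ t).fun_sub ((hasDerivAt_id t).const_mul (g₁ 0))).fun_sub
        ((((hasDerivAt_id t).fun_pow 2).div_const 2).const_mul (g₂ 0))).congr_deriv (by simp))
    (fun t ht => by have := s1 t ht; simp at this; rwa [sub_right_comm] at this) 1 (by simp)
  convert s0 using 2
  simp; ring

end Gibbs

/-! ### Third-order expansion of a smooth function of a soft minimum -/

section SoftMin

variable {ι : Type*} {N : Finset ι}

/-- Products of the derivative bounds `2 v ^ a` are controlled by the average of `v ^ Q`. -/
theorem gibbsAvg_rpow_mul_le {w v : ι → ℝ} {a b : ℝ} (hw : ∀ u ∈ N, 0 ≤ w u)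
    (hpos : 0 < ∑ u ∈ N, w u) (hv : ∀ u ∈ N, 1 ≤ v u) (ha : 0 ≤ a) (hb : 0 ≤ b) :
    gibbsAvg N w (fun u => v u ^ a) * gibbsAvg N w (fun u => v u ^ b) ≤
      gibbsAvg N w (fun u => v u ^ (a + b)) := by
  refine (gibbsAvg_mul_le hw hpos fun u hu u' hu' => ?_).trans
    (gibbsAvg_mono hw fun u hu => ?_)
  · rcases le_total (v u) (v u') with h | h
    · exact mul_nonneg_of_nonpos_of_nonpos
        (sub_nonpos.2 (Real.rpow_le_rpow (by linarith [hv u hu]) h ha))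
        (sub_nonpos.2 (Real.rpow_le_rpow (by linarith [hv u hu]) h hb))
    · exact mul_nonneg
        (sub_nonneg.2 (Real.rpow_le_rpow (by linarith [hv u' hu']) h ha))
        (sub_nonneg.2 (Real.rpow_le_rpow (by linarith [hv u' hu']) h hb))
  · rw [Real.rpow_add (by linarith [hv u hu])]

set_option maxHeartbeats 1000000 in
/-- Bound for the third derivative of a smooth function of a soft minimum, in terms of the
Gibbs averages that occur in it. -/
theorem abs_third_derivative_le {w v f₁ f₂ f₃ : ι → ℝ} {q₁ q₂ q₃ Q s D Y n κ p₁ p₂ p₃ : ℝ}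
    (hw : ∀ u ∈ N, 0 ≤ w u) (hpos : 0 < ∑ u ∈ N, w u) (hv : ∀ u ∈ N, 1 ≤ v u)
    (hq₁ : 0 ≤ q₁) (hq₂ : 0 ≤ q₂) (h₁ : 3 * q₁ ≤ Q) (h₂ : q₁ + q₂ ≤ Q) (h₃ : q₃ ≤ Q)
    (hs : 0 ≤ s) (hD : 1 ≤ D) (hY : 0 ≤ Y) (hn : 1 ≤ n)
    (hp₁ : |p₁| ≤ κ) (hp₂ : |p₂| ≤ κ) (hp₃ : |p₃| ≤ κ)
    (hf₁ : ∀ u ∈ N, |f₁ u| ≤ D * Y * (2 * v u ^ q₁))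
    (hf₂ : ∀ u ∈ N, |f₂ u| ≤ D * Y ^ 2 * (2 * v u ^ q₂))
    (hf₃ : ∀ u ∈ N, |f₃ u| ≤ D * Y ^ 3 * (2 * v u ^ q₃))
    {A₁ A₂ A₃ A₁₁ A₁₂ A₁₁₁ : ℝ} (hA₁ : A₁ = gibbsAvg N w f₁) (hA₂ : A₂ = gibbsAvg N w f₂)
    (hA₃ : A₃ = gibbsAvg N w f₃) (hA₁₁ : A₁₁ = gibbsAvg N w (fun u => f₁ u * f₁ u))
    (hA₁₂ : A₁₂ = gibbsAvg N w (fun u => f₁ u * f₂ u))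
    (hA₁₁₁ : A₁₁₁ = gibbsAvg N w (fun u => f₁ u * (f₁ u * f₁ u))) :
    |p₃ / n ^ 3 * A₁ ^ 3 + 3 * (p₂ / n ^ 2) * A₁ * (A₂ - s * (A₁₁ - A₁ * A₁)) +
      p₁ / n * (A₃ - 3 * s * (A₁₂ - A₁ * A₂) +
        s ^ 2 * (A₁₁₁ - 3 * (A₁₁ * A₁) + 2 * A₁ ^ 3))| ≤
      48 * κ / n * (1 + s) ^ 2 * D ^ 3 * Y ^ 3 * gibbsAvg N w (fun u => v u ^ Q) := by
  have hv0 : ∀ u ∈ N, 0 ≤ v u := fun u hu => by linarith [hv u hu]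
  have nn : ∀ a : ℝ, 0 ≤ gibbsAvg N w (fun u => v u ^ a) := fun a =>
    gibbsAvg_nonneg hw fun u hu => Real.rpow_nonneg (hv0 u hu) a
  set E : ℝ → ℝ := fun a => gibbsAvg N w (fun u => v u ^ a) with hE
  have mulE : ∀ a b, 0 ≤ a → 0 ≤ b → E a * E b ≤ E (a + b) := fun a b ha hb =>
    gibbsAvg_rpow_mul_le hw hpos hv ha hb
  have monoE : ∀ a b, a ≤ b → E a ≤ E b := fun a b hab => gibbsAvg_mono hw fun u hu =>
    Real.rpow_le_rpow_of_exponent_le (hv u hu) hab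
  have hn0 : 0 < n := by linarith
  have hκ : 0 ≤ κ := (abs_nonneg _).trans hp₁
  have cm : ∀ (K a : ℝ) (f : ι → ℝ), (∀ u ∈ N, |f u| ≤ K * v u ^ a) → |gibbsAvg N w f| ≤ K * E a := by
    intro K a f h
    rw [hE, ← gibbsAvg_const_mul]
    exact abs_gibbsAvg_le hw h
  have b₁ : |A₁| ≤ (2 * D * Y) * E q₁ := by
    rw [hA₁]; exact cm _ _ _ fun u hu => (hf₁ u hu).trans_eq (by ring)
  have b₂ : |A₂| ≤ (2 * D * Y ^ 2) * E q₂ := by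
    rw [hA₂]; exact cm _ _ _ fun u hu => (hf₂ u hu).trans_eq (by ring)
  have b₃ : |A₃| ≤ (2 * D * Y ^ 3) * E q₃ := by
    rw [hA₃]; exact cm _ _ _ fun u hu => (hf₃ u hu).trans_eq (by ring)
  have ad : ∀ u ∈ N, ∀ a b : ℝ, v u ^ (a + b) = v u ^ a * v u ^ b := fun u hu a b =>
    Real.rpow_add (by linarith [hv u hu]) a b
  have b₁₁ : |A₁₁| ≤ (4 * D ^ 2 * Y ^ 2) * E (q₁ + q₁) := by
    rw [hA₁₁]; refine cm _ _ _ fun u hu => ?_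
    rw [abs_mul, ad u hu]
    exact (mul_le_mul (hf₁ u hu) (hf₁ u hu) (abs_nonneg _)
      ((abs_nonneg _).trans (hf₁ u hu))).trans_eq (by ring)
  have b₁₂ : |A₁₂| ≤ (4 * D ^ 2 * Y ^ 3) * E (q₁ + q₂) := by
    rw [hA₁₂]; refine cm _ _ _ fun u hu => ?_
    rw [abs_mul, ad u hu]
    exact (mul_le_mul (hf₁ u hu) (hf₂ u hu) (abs_nonneg _)
      ((abs_nonneg _).trans (hf₁ u hu))).trans_eq (by ring)
  have b₁₁₁ : |A₁₁₁| ≤ (8 * D ^ 3 * Y ^ 3) * E (q₁ + (q₁ + q₁)) := by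
    rw [hA₁₁₁]; refine cm _ _ _ fun u hu => ?_
    rw [abs_mul, abs_mul, ad u hu, ad u hu]
    have := mul_le_mul (hf₁ u hu) (hf₁ u hu) (abs_nonneg _)
      ((abs_nonneg _).trans (hf₁ u hu))
    exact (mul_le_mul (hf₁ u hu) this (by positivity)
      ((abs_nonneg _).trans (hf₁ u hu))).trans_eq (by ring)
  -- Association merges each product of averages into one exponent, which `v ≥ 1` then allows to be
  -- raised to `Q`. The conditions on `Q` cover precisely the exponents `3q₁`, `q₁ + q₂` and `q₃`
  -- that occur.
  have x₁₂ : E q₁ * E q₂ ≤ E Q := (mulE _ _ hq₁ hq₂).trans (monoE _ _ h₂)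
  have x₁₁ : E q₁ * E q₁ ≤ E (q₁ + q₁) := mulE _ _ hq₁ hq₁
  have x₁₁₁ : E q₁ * E (q₁ + q₁) ≤ E Q :=
    (mulE _ _ hq₁ (by linarith)).trans (monoE _ _ (by linarith))
  have x₃ : E q₁ ^ 3 ≤ E Q := by
    have := mul_le_mul_of_nonneg_left x₁₁ (nn q₁)
    calc E q₁ ^ 3 = E q₁ * (E q₁ * E q₁) := by ring
      _ ≤ _ := this.trans x₁₁₁
  have P : 0 ≤ D ^ 3 * Y ^ 3 := by positivity
  have EQ : 0 ≤ E Q := nn Q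
  have d1 : D ≤ D ^ 3 := le_self_pow₀ hD (by norm_num)
  have d2 : D ^ 2 ≤ D ^ 3 := pow_le_pow_right₀ hD (by norm_num)
  have Y3 : 0 ≤ Y ^ 3 := by positivity
  set W : ℝ := D ^ 3 * Y ^ 3 * E Q with hW
  have hW0 : 0 ≤ W := mul_nonneg P EQ
  have up : ∀ K e k : ℝ, 0 ≤ K → K ≤ D ^ 3 → 0 ≤ k → e ≤ E Q → k * K * Y ^ 3 * e ≤ k * W := by
    intro K e k hK hK' hk he
    calc k * K * Y ^ 3 * e ≤ k * K * Y ^ 3 * E Q := by gcongr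
      _ ≤ k * D ^ 3 * Y ^ 3 * E Q := by gcongr
      _ = k * W := by rw [hW]; ring
  -- the individual products
  have y1 : |A₁| ^ 3 ≤ 8 * W := by
    calc |A₁| ^ 3 ≤ ((2 * D * Y) * E q₁) ^ 3 := by gcongr
      _ = 8 * D ^ 3 * Y ^ 3 * (E q₁ ^ 3) := by ring
      _ ≤ 8 * W := up _ _ _ (by positivity) le_rfl (by norm_num) x₃
  have y2 : |A₁| * |A₂| ≤ 4 * W := by
    calc |A₁| * |A₂| ≤ ((2 * D * Y) * E q₁) * ((2 * D * Y ^ 2) * E q₂) :=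
          mul_le_mul b₁ b₂ (abs_nonneg _) ((abs_nonneg _).trans b₁)
      _ = 4 * D ^ 2 * Y ^ 3 * (E q₁ * E q₂) := by ring
      _ ≤ 4 * W := up _ _ _ (by positivity) d2 (by norm_num) x₁₂
  have y3 : |A₁₁| * |A₁| ≤ 8 * W := by
    calc |A₁₁| * |A₁| ≤ ((4 * D ^ 2 * Y ^ 2) * E (q₁ + q₁)) * ((2 * D * Y) * E q₁) :=
          mul_le_mul b₁₁ b₁ (abs_nonneg _) ((abs_nonneg _).trans b₁₁)
      _ = 8 * D ^ 3 * Y ^ 3 * (E q₁ * E (q₁ + q₁)) := by ring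
      _ ≤ 8 * W := up _ _ _ (by positivity) le_rfl (by norm_num) x₁₁₁
  have y4 : |A₃| ≤ 2 * W := b₃.trans (up _ _ _ (by positivity) d1 (by norm_num) (monoE _ _ h₃))
  have y5 : |A₁₂| ≤ 4 * W := b₁₂.trans (up _ _ _ (by positivity) d2 (by norm_num) (monoE _ _ h₂))
  have y6 : |A₁₁₁| ≤ 8 * W :=
    b₁₁₁.trans (up _ _ _ (by positivity) le_rfl (by norm_num) (monoE _ _ (by linarith)))
  have n2 : ∀ k : ℕ, k ≠ 0 → ∀ p : ℝ, |p| ≤ κ → |p / n ^ k| ≤ κ / n := by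
    intro k hk p hp
    rw [abs_div, abs_of_pos (by positivity : (0:ℝ) < n ^ k)]
    exact div_le_div₀ hκ hp hn0 (le_self_pow₀ hn hk)
  have t1 : |p₃ / n ^ 3 * A₁ ^ 3| ≤ κ / n * (8 * W) := by
    rw [abs_mul, abs_pow]
    exact mul_le_mul (n2 3 (by norm_num) _ hp₃) y1 (by positivity) (by positivity)
  have t2 : |3 * (p₂ / n ^ 2) * A₁ * (A₂ - s * (A₁₁ - A₁ * A₁))| ≤
      κ / n * (3 * (4 * W + s * (8 * W + 8 * W))) := by
    have : 3 * (p₂ / n ^ 2) * A₁ * (A₂ - s * (A₁₁ - A₁ * A₁)) =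
      (p₂ / n ^ 2) * (3 * (A₁ * A₂ - s * (A₁₁ * A₁ - A₁ ^ 3))) := by ring
    rw [this, abs_mul]
    refine mul_le_mul (n2 2 (by norm_num) _ hp₂) ?_ (by positivity) (by positivity)
    rw [abs_mul, abs_of_pos (by norm_num : (0:ℝ) < 3)]
    have i1 : |A₁ * A₂ - s * (A₁₁ * A₁ - A₁ ^ 3)| ≤ |A₁| * |A₂| + s * (|A₁₁| * |A₁| + |A₁| ^ 3) := by
      refine (abs_sub _ _).trans ?_
      rw [abs_mul, abs_mul, abs_of_nonneg hs, ← abs_mul A₁₁, ← abs_pow]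
      gcongr; exact abs_sub _ _
    have : s * (|A₁₁| * |A₁| + |A₁| ^ 3) ≤ s * (8 * W + 8 * W) := by gcongr
    linarith
  have t3 : |p₁ / n * (A₃ - 3 * s * (A₁₂ - A₁ * A₂) +
        s ^ 2 * (A₁₁₁ - 3 * (A₁₁ * A₁) + 2 * A₁ ^ 3))| ≤
      κ / n * (2 * W + 3 * s * (8 * W) + s ^ 2 * (48 * W)) := by
    rw [abs_mul]
    refine mul_le_mul (by simpa using n2 1 (by norm_num) _ hp₁) ?_ (by positivity) (by positivity)
    have i1 : |A₁₂ - A₁ * A₂| ≤ 8 * W := by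
      refine (abs_sub _ _).trans ?_; rw [abs_mul]; linarith
    have i2 : |A₁₁₁ - 3 * (A₁₁ * A₁) + 2 * A₁ ^ 3| ≤ 48 * W := by
      refine (abs_add_le _ _).trans ?_
      have := abs_sub A₁₁₁ (3 * (A₁₁ * A₁))
      rw [abs_mul, abs_mul] at this
      rw [abs_mul 2, abs_pow]
      norm_num at this ⊢
      linarith
    refine (abs_add_le _ _).trans ?_
    have := abs_sub A₃ (3 * s * (A₁₂ - A₁ * A₂))
    rw [abs_mul, abs_of_nonneg (by positivity : 0 ≤ 3 * s)] at this
    rw [abs_mul, abs_of_nonneg (by positivity : 0 ≤ s ^ 2)]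
    have j1 : 3 * s * |A₁₂ - A₁ * A₂| ≤ 3 * s * (8 * W) := by gcongr
    have j2 : s ^ 2 * |A₁₁₁ - 3 * (A₁₁ * A₁) + 2 * A₁ ^ 3| ≤ s ^ 2 * (48 * W) := by gcongr
    linarith
  refine (abs_add_le _ _).trans ((add_le_add ((abs_add_le _ _).trans (add_le_add t1 t2)) t3).trans ?_)
  -- Here `22 = 8 + 12 + 2` and `72 = 48 + 24`; each coefficient is at most the one in `48 (1 +
  -- s)²`.
  have : κ / n * (8 * W) + κ / n * (3 * (4 * W + s * (8 * W + 8 * W))) +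
      κ / n * (2 * W + 3 * s * (8 * W) + s ^ 2 * (48 * W)) =
      κ / n * W * (22 + 72 * s + 48 * s ^ 2) := by ring
  rw [this]
  calc κ / n * W * (22 + 72 * s + 48 * s ^ 2) ≤ κ / n * W * (48 * (1 + s) ^ 2) := by
        gcongr; nlinarith
    _ = _ := by rw [hW]; ring

/-- A function together with its derivatives of orders one to three. -/
structure HasThreeDerivs (f f₁ f₂ f₃ : ℝ → ℝ) : Prop where
  first : ∀ x, HasDerivAt f (f₁ x) x
  second : ∀ x, HasDerivAt f₁ (f₂ x) x
  third : ∀ x, HasDerivAt f₂ (f₃ x) x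

/-- Second-order Taylor expansion of `φ` of a soft minimum along a line, with the remainder
controlled by the Gibbs average that does not involve the moving loss. -/
theorem abs_softMin_taylor_le {c b y mm : ι → ℝ} {ℓ ℓ₁ ℓ₂ ℓ₃ φ φ₁ φ₂ φ₃ : ℝ → ℝ}
    {q₁ q₂ q₃ Q s D Y n κ : ℝ} (hN : N.Nonempty) (hc : ∀ u ∈ N, 0 < c u)
    (hℓ : HasThreeDerivs ℓ ℓ₁ ℓ₂ ℓ₃) (hφ : HasThreeDerivs φ φ₁ φ₂ φ₃)
    (hℓ0 : ∀ x, 0 ≤ ℓ x)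
    (hq₁ : 0 ≤ q₁) (hq₂ : 0 ≤ q₂) (hq₃ : 0 ≤ q₃)
    (h₁ : 3 * q₁ ≤ Q) (h₂ : q₁ + q₂ ≤ Q) (h₃ : q₃ ≤ Q)
    (hs : 0 < s) (hD : 1 ≤ D) (hY : 0 ≤ Y) (hn : 1 ≤ n)
    (hφ₁ : ∀ x, |φ₁ x| ≤ κ) (hφ₂ : ∀ x, |φ₂ x| ≤ κ) (hφ₃ : ∀ x, |φ₃ x| ≤ κ)
    (hℓ₁ : ∀ x, |ℓ₁ x| ≤ D * (1 + ℓ x ^ q₁)) (hℓ₂ : ∀ x, |ℓ₂ x| ≤ D * (1 + ℓ x ^ q₂))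
    (hℓ₃ : ∀ x, |ℓ₃ x| ≤ D * (1 + ℓ x ^ q₃))
    (hy : ∀ u ∈ N, |y u| ≤ Y)
    (hm : ∀ u ∈ N, ∀ t ∈ Icc (0 : ℝ) 1, (1 + ℓ (b u + t * y u)) ^ Q ≤ mm u)
    {F : (ι → ℝ) → ℝ}
    (hF : F = fun z => -(1 / (n * s)) * Real.log (∑ u ∈ N, c u * Real.exp (-s * ℓ (z u))))
    {A : (ι → ℝ) → ℝ} (hA : A = gibbsAvg N (fun u => c u * Real.exp (-s * ℓ (b u)))) :
    |φ (F (fun u => b u + y u)) - φ (F b) - φ₁ (F b) / n * A (fun u => ℓ₁ (b u) * y u) -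
      (φ₂ (F b) / n ^ 2 * A (fun u => ℓ₁ (b u) * y u) ^ 2 + φ₁ (F b) / n *
        (A (fun u => ℓ₂ (b u) * y u ^ 2) - s * (A (fun u => (ℓ₁ (b u) * y u) * (ℓ₁ (b u) * y u)) -
          A (fun u => ℓ₁ (b u) * y u) * A (fun u => ℓ₁ (b u) * y u)))) / 2| ≤
      48 * κ / n * (1 + s) ^ 2 * D ^ 3 * Y ^ 3 * gibbsAvg N c mm := by
  set f₁ : ι → ℝ → ℝ := fun u t => ℓ₁ (b u + t * y u) * y u with hf₁
  set f₂ : ι → ℝ → ℝ := fun u t => ℓ₂ (b u + t * y u) * y u ^ 2 with hf₂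
  set f₃ : ι → ℝ → ℝ := fun u t => ℓ₃ (b u + t * y u) * y u ^ 3 with hf₃
  set w : ι → ℝ → ℝ := fun u t => c u * Real.exp (-s * ℓ (b u + t * y u)) with hwdef
  have hlin : ∀ u t, HasDerivAt (fun t => b u + t * y u) (y u) t := fun u t => by
    simpa using ((hasDerivAt_id t).mul_const (y u)).const_add (b u)
  have dℓ : ∀ u t, HasDerivAt (fun t => ℓ (b u + t * y u)) (f₁ u t) t := fun u t =>
    (hℓ.first _).comp t (hlin u t)
  have df₁ : ∀ u t, HasDerivAt (f₁ u) (f₂ u t) t := fun u t =>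
    (((hℓ.second _).comp t (hlin u t)).mul_const (y u)).congr_deriv (by rw [hf₂]; ring)
  have df₂ : ∀ u t, HasDerivAt (f₂ u) (f₃ u t) t := fun u t =>
    (((hℓ.third _).comp t (hlin u t)).mul_const (y u ^ 2)).congr_deriv (by rw [hf₃]; ring)
  have wpos : ∀ t, ∀ u ∈ N, 0 < w u t := fun t u hu => mul_pos (hc u hu) (Real.exp_pos _)
  have wsum : ∀ t, 0 < ∑ u ∈ N, w u t := fun t => Finset.sum_pos (wpos t) hN
  have dw : ∀ t u, HasDerivAt (w u) (-s * f₁ u t * w u t) t := fun t u =>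
    ((((dℓ u t).const_mul (-s)).exp).const_mul (c u)).congr_deriv (by rw [hwdef]; ring)
  have hn0 : 0 < n := by linarith
  set G : ℝ → ℝ := fun t => F (fun u => b u + t * y u) with hG
  set av : (ι → ℝ → ℝ) → ℝ → ℝ := fun f t => gibbsAvg N (fun u => w u t) (fun u => f u t) with hav
  have dav : ∀ (f f' : ι → ℝ → ℝ), (∀ u t, HasDerivAt (f u) (f' u t) t) → ∀ t,
      HasDerivAt (av f) (av f' t - s * (av (fun u t => f₁ u t * f u t) t - av f₁ t * av f t)) t :=
    fun f f' h t => hasDerivAt_gibbsAvg (wsum t) (fun u _ => dw t u) (fun u _ => h u t)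
  have dG : ∀ t, HasDerivAt G (av f₁ t / n) t := fun t => by
    have h1 : HasDerivAt (fun t => ∑ u ∈ N, w u t) (∑ u ∈ N, -s * f₁ u t * w u t) t :=
      HasDerivAt.fun_sum fun u _ => dw t u
    have h2 := (h1.log (wsum t).ne').const_mul (-(1 / (n * s)))
    have : G = fun t => -(1 / (n * s)) * Real.log (∑ u ∈ N, w u t) := by rw [hG, hF]
    rw [this]
    refine h2.congr_deriv ?_
    rw [hav]; simp only [gibbsAvg]
    have e2 : ∑ u ∈ N, -s * f₁ u t * w u t = -s * ∑ u ∈ N, w u t * f₁ u t := by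
      rw [Finset.mul_sum]; exact Finset.sum_congr rfl fun u _ => by ring
    rw [e2]
    have := (wsum t).ne'
    field_simp
  set a1 : ℝ → ℝ := av f₁ with ha1
  set a11 : ℝ → ℝ := av (fun u t => f₁ u t * f₁ u t) with ha11
  set a2 : ℝ → ℝ := av f₂ with ha2
  have da1 : ∀ t, HasDerivAt a1 (a2 t - s * (a11 t - a1 t * a1 t)) t := dav _ _ df₁
  have da2 : ∀ t, HasDerivAt a2 (av f₃ t - s * (av (fun u t => f₁ u t * f₂ u t) t - a1 t * a2 t)) t :=
    dav _ _ df₂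
  have da11 : ∀ t, HasDerivAt a11 (2 * av (fun u t => f₁ u t * f₂ u t) t -
      s * (av (fun u t => f₁ u t * (f₁ u t * f₁ u t)) t - a1 t * a11 t)) t := fun t => by
    refine (dav (fun u t => f₁ u t * f₁ u t) (fun u t => 2 * (f₁ u t * f₂ u t))
      (fun u t => ((df₁ u t).fun_mul (df₁ u t)).congr_deriv (by ring)) t).congr_deriv ?_
    congr 1
    exact gibbsAvg_const_mul 2
  -- the derivatives of the composition
  set g₁ : ℝ → ℝ := fun t => φ₁ (G t) / n * a1 t with hg₁
  set g₂ : ℝ → ℝ := fun t => φ₂ (G t) / n ^ 2 * a1 t ^ 2 +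
    φ₁ (G t) / n * (a2 t - s * (a11 t - a1 t * a1 t)) with hg₂
  have dg : ∀ t, HasDerivAt (fun t => φ (G t)) (g₁ t) t := fun t =>
    ((hφ.first _).comp t (dG t)).congr_deriv (by rw [hg₁]; ring)
  have dφ₁ : ∀ t, HasDerivAt (fun t => φ₁ (G t)) (φ₂ (G t) * (a1 t / n)) t := fun t =>
    (hφ.second _).comp t (dG t)
  have dφ₂ : ∀ t, HasDerivAt (fun t => φ₂ (G t)) (φ₃ (G t) * (a1 t / n)) t := fun t =>
    (hφ.third _).comp t (dG t)
  have dg₁ : ∀ t, HasDerivAt g₁ (g₂ t) t := fun t =>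
    (((dφ₁ t).div_const n).fun_mul (da1 t)).congr_deriv (by
      rw [hg₂]; field_simp)
  have dg₂ := fun t => (((dφ₂ t).div_const (n ^ 2)).fun_mul ((da1 t).fun_pow 2)).fun_add
    (((dφ₁ t).div_const n).fun_mul
      ((da2 t).fun_sub (((da11 t).fun_sub ((da1 t).fun_mul (da1 t))).const_mul s)))
  have main := abs_taylor_two_le (K := 48 * κ / n * (1 + s) ^ 2 * D ^ 3 * Y ^ 3 * gibbsAvg N c mm)
    dg dg₁ dg₂ ?_
  · have e0 : ∀ z : ι → ℝ, (fun u => z u + 0 * y u) = z := fun z => by ext u; ring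
    have G0 : G 0 = F b := by rw [hG]; simp
    have G1 : G 1 = F (fun u => b u + y u) := by rw [hG]; simp
    have av0 : ∀ f, av f 0 = A (fun u => f u 0) := fun f => by rw [hav, hA]; simp [hwdef]
    have F1 : (fun u => f₁ u 0) = fun u => ℓ₁ (b u) * y u := by ext u; simp [hf₁]
    have F11 : (fun u => f₁ u 0 * f₁ u 0) = fun u => (ℓ₁ (b u) * y u) * (ℓ₁ (b u) * y u) := by
      ext u; simp [hf₁]
    have F2 : (fun u => f₂ u 0) = fun u => ℓ₂ (b u) * y u ^ 2 := by ext u; simp [hf₂]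
    simp only [hg₁, hg₂, ha1, ha2, ha11, av0, G0, G1, F1, F11, F2] at main
    exact main
  · intro t ht
    have v1 : ∀ u ∈ N, 1 ≤ 1 + ℓ (b u + t * y u) := fun u _ => by linarith [hℓ0 (b u + t * y u)]
    -- Passing from `ℓ` to `1 + ℓ ≥ 1` makes powers increasing in the exponent, as the merging of
    -- exponents requires.
    have bd : ∀ (a : ℝ) (x : ℝ), 0 ≤ a → 1 + ℓ x ^ a ≤ 2 * (1 + ℓ x) ^ a := fun a x ha => by
      have h1 : ℓ x ^ a ≤ (1 + ℓ x) ^ a := Real.rpow_le_rpow (hℓ0 x) (by linarith) ha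
      have h2 : 1 ≤ (1 + ℓ x) ^ a := Real.one_le_rpow (by linarith [hℓ0 x]) ha
      linarith
    have bb : ∀ (a L x yy : ℝ) (k : ℕ), 0 ≤ a → |L| ≤ D * (1 + ℓ x ^ a) → |yy| ≤ Y →
        |L * yy ^ k| ≤ D * Y ^ k * (2 * (1 + ℓ x) ^ a) := by
      intro a L x yy k ha hL hyy
      rw [abs_mul, abs_pow]
      calc |L| * |yy| ^ k ≤ (D * (1 + ℓ x ^ a)) * Y ^ k := by
            gcongr
            exact (abs_nonneg _).trans hL
        _ ≤ (D * (2 * (1 + ℓ x) ^ a)) * Y ^ k := by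
            have := bd a x ha
            gcongr
        _ = _ := by ring
    have key := abs_third_derivative_le (N := N) (w := fun u => w u t)
      (v := fun u => 1 + ℓ (b u + t * y u)) (f₁ := fun u => f₁ u t) (f₂ := fun u => f₂ u t)
      (f₃ := fun u => f₃ u t) (p₁ := φ₁ (G t)) (p₂ := φ₂ (G t)) (p₃ := φ₃ (G t))
      (fun u hu => (wpos t u hu).le) (wsum t) v1 hq₁ hq₂ h₁ h₂ h₃ hs.le hD hY hn (hφ₁ _) (hφ₂ _)
      (hφ₃ _) (fun u hu => by
        have := bb q₁ _ _ _ 1 hq₁ (hℓ₁ (b u + t * y u)) (hy u hu)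
        rwa [pow_one, pow_one] at this)
      (fun u hu => bb q₂ _ _ _ 2 hq₂ (hℓ₂ _) (hy u hu))
      (fun u hu => bb q₃ _ _ _ 3 hq₃ (hℓ₃ _) (hy u hu)) rfl rfl rfl rfl rfl rfl
    have hQ : 0 ≤ Q := by linarith
    -- The weight `w` is `c` times a decreasing function of the moving loss, while the averaged
    -- quantity increases with it. Dropping the factor therefore bounds the average by one whose
    -- weights depend neither on `t` nor on the moving loss.
    have tilt : gibbsAvg N (fun u => w u t) (fun u => (1 + ℓ (b u + t * y u)) ^ Q) ≤
        gibbsAvg N c mm := by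
      refine (gibbsAvg_tilt_le (fun u hu => (hc u hu).le) (Finset.sum_pos hc hN) (wsum t)
        fun u hu v hv => ?_).trans (gibbsAvg_mono (fun u hu => (hc u hu).le)
          fun u hu => hm u hu t ht)
      rcases le_total (ℓ (b u + t * y u)) (ℓ (b v + t * y v)) with h | h
      · refine mul_nonpos_of_nonpos_of_nonneg (sub_nonpos.2 ?_) (sub_nonneg.2 ?_)
        · exact Real.rpow_le_rpow (by linarith [hℓ0 (b u + t * y u)]) (by linarith) hQ
        · exact Real.exp_le_exp.2 (by nlinarith)
      · refine mul_nonpos_of_nonneg_of_nonpos (sub_nonneg.2 ?_) (sub_nonpos.2 ?_)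
        · exact Real.rpow_le_rpow (by linarith [hℓ0 (b v + t * y v)]) (by linarith) hQ
        · exact Real.exp_le_exp.2 (by nlinarith)
    have hκ : 0 ≤ κ := (abs_nonneg _).trans (hφ₁ 0)
    refine (le_of_eq ?_).trans (key.trans (mul_le_mul_of_nonneg_left tilt (by positivity)))
    congr 1
    simp only [ha1, ha2, ha11, hav]
    field_simp
    ring

end SoftMin

/-! ### Even moments of sums of independent centred variables -/

section Moments

/-- Interpolation: exchange the surplus factors for the larger of `|S|` and `|Z|`, and one of the
two extreme monomials results. -/
theorem abs_pow_mul_abs_pow_le (S Z : ℝ) {j k : ℕ} (hk : k ≤ 2 * j) :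
    |Z| ^ (k + 2) * |S| ^ (2 * j - k) ≤ S ^ (2 * j) * Z ^ 2 + Z ^ (2 * j + 2) := by
  have e1 : S ^ (2 * j) = |S| ^ (2 * j) := (Even.pow_abs (even_two_mul j) S).symm
  have e2 : Z ^ 2 = |Z| ^ 2 := (sq_abs Z).symm
  have e3 : Z ^ (2 * j + 2) = |Z| ^ (2 * j + 2) := (Even.pow_abs ⟨j + 1, by ring⟩ Z).symm
  rw [e1, e2, e3]
  rcases le_total |Z| |S| with h | h
  · have : |Z| ^ (k + 2) * |S| ^ (2 * j - k) ≤ |S| ^ (2 * j) * |Z| ^ 2 := by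
      calc |Z| ^ (k + 2) * |S| ^ (2 * j - k) = |Z| ^ k * |S| ^ (2 * j - k) * |Z| ^ 2 := by ring
        _ ≤ |S| ^ k * |S| ^ (2 * j - k) * |Z| ^ 2 := by gcongr
        _ = _ := by rw [← pow_add, Nat.add_sub_cancel' hk]
    have : 0 ≤ |Z| ^ (2 * j + 2) := by positivity
    linarith
  · have : |Z| ^ (k + 2) * |S| ^ (2 * j - k) ≤ |Z| ^ (2 * j + 2) := by
      calc |Z| ^ (k + 2) * |S| ^ (2 * j - k) ≤ |Z| ^ (k + 2) * |Z| ^ (2 * j - k) := by gcongr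
        _ = _ := by rw [← pow_add]; congr 1; omega
    have : 0 ≤ |S| ^ (2 * j) * |Z| ^ 2 := by positivity
    linarith

/-- Binomial expansion in which every term of degree at least two in `Z` is interpolated between the
extremes. The linear term is kept exact because it vanishes in expectation when `Z` is centred and
independent of `S`. -/
theorem add_pow_even_le (S Z : ℝ) (j : ℕ) :
    (S + Z) ^ (2 * j + 2) ≤ S ^ (2 * j + 2) + (2 * j + 2) * (S ^ (2 * j + 1) * Z) +
      2 ^ (2 * j + 2) * (S ^ (2 * j) * Z ^ 2 + Z ^ (2 * j + 2)) := by
  rw [add_comm S Z, add_pow, Finset.sum_range_succ', Finset.sum_range_succ']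
  set R := S ^ (2 * j) * Z ^ 2 + Z ^ (2 * j + 2)
  have hR : 0 ≤ R := by
    have h1 : 0 ≤ S ^ (2 * j) := (even_two_mul j).pow_nonneg S
    have h2 : 0 ≤ Z ^ (2 * j + 2) := Even.pow_nonneg ⟨j + 1, by ring⟩ Z
    positivity
  have hsum : ∑ k ∈ Finset.range (2 * j + 1), Z ^ (k + 1 + 1) * S ^ (2 * j + 2 - (k + 1 + 1)) *
      ((2 * j + 2).choose (k + 1 + 1) : ℝ) ≤ 2 ^ (2 * j + 2) * R := by
    calc _ ≤ ∑ k ∈ Finset.range (2 * j + 1), R * ((2 * j + 2).choose (k + 1 + 1) : ℝ) := by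
          refine Finset.sum_le_sum fun k hk => ?_
          refine mul_le_mul_of_nonneg_right ?_ (by positivity)
          have hk' : k ≤ 2 * j := by have := Finset.mem_range.1 hk; omega
          refine le_trans ?_ (abs_pow_mul_abs_pow_le S Z hk')
          rw [show 2 * j + 2 - (k + 1 + 1) = 2 * j - k by omega]
          rw [← abs_pow, ← abs_pow, ← abs_mul]
          exact le_abs_self _
      _ = R * ∑ k ∈ Finset.range (2 * j + 1), ((2 * j + 2).choose (k + 1 + 1) : ℝ) := by
          rw [Finset.mul_sum]
      _ ≤ R * 2 ^ (2 * j + 2) := by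
          refine mul_le_mul_of_nonneg_left ?_ hR
          have h := Nat.sum_range_choose (2 * j + 2)
          rw [Finset.sum_range_succ', Finset.sum_range_succ'] at h
          have : ∑ k ∈ Finset.range (2 * j + 1), (2 * j + 2).choose (k + 1 + 1) ≤ 2 ^ (2 * j + 2) := by
            omega
          exact_mod_cast this
      _ = _ := by ring
  have : Z ^ (0 + 1) * S ^ (2 * j + 2 - (0 + 1)) * ((2 * j + 2).choose (0 + 1) : ℝ) =
      (2 * j + 2) * (S ^ (2 * j + 1) * Z) := by
    rw [show 2 * j + 2 - (0 + 1) = 2 * j + 1 by omega]; simp; ring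
  rw [this]
  simp only [pow_zero, one_mul, Nat.sub_zero, Nat.choose_zero_right, Nat.cast_one, mul_one]
  linarith

/-- The constants of the moment inequality for sums of independent variables. -/
def sumMomentConst : ℕ → ℝ
  | 0 => 1
  | j + 1 => 2 ^ (2 * j + 2) * (sumMomentConst j + 1)

theorem sumMomentConst_pos (j : ℕ) : 0 < sumMomentConst j := by
  induction j with
  | zero => simp [sumMomentConst]
  | succ j ih => simp only [sumMomentConst]; positivity

variable {Ω κ : Type*} [MeasurableSpace Ω] {P : Measure Ω} [IsProbabilityMeasure P]

theorem integrable_pow_of_memLp {Z : Ω → ℝ} {r k : ℕ} (h : MemLp Z (r : ℝ≥0∞) P) (hk : k ≤ r) :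
    Integrable (fun ω => Z ω ^ k) P := by
  have h1 : MemLp Z (k : ℝ≥0∞) P := h.mono_exponent (by exact_mod_cast hk)
  have h2 := h1.integrable_norm_pow'
  refine h2.mono' (h1.1.pow k) (ae_of_all _ fun ω => ?_)
  simp

/-- A Rosenthal-type inequality: even moments of a sum of independent centred variables. -/
theorem integral_sum_pow_le {Z : κ → Ω → ℝ} (hind : iIndepFun Z P) (hm : ∀ b, Measurable (Z b))
    (hmean : ∀ b, ∫ ω, Z b ω ∂P = 0) {h : ℕ} (hL : ∀ b, MemLp (Z b) ((2 * h : ℕ) : ℝ≥0∞) P)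
    {a W : ℝ} (ha : 0 ≤ a) (hW : 1 ≤ W) {s : Finset κ}
    (h2 : ∑ b ∈ s, ∫ ω, Z b ω ^ 2 ∂P ≤ a ^ 2)
    (hh : ∀ j, 1 ≤ j → j ≤ h → ∑ b ∈ s, ∫ ω, Z b ω ^ (2 * j) ∂P ≤ a ^ (2 * j) * W)
    {j : ℕ} (hj : j ≤ h) {t : Finset κ} (hts : t ⊆ s) :
    ∫ ω, (∑ b ∈ t, Z b ω) ^ (2 * j) ∂P ≤ sumMomentConst j * a ^ (2 * j) * W := by
  classical
  induction j generalizing t with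
  | zero => simpa [sumMomentConst] using hW
  | succ j ih =>
    have hW0 : 0 ≤ W := by linarith
    have cj := (sumMomentConst_pos j).le
    -- Adding one summand at a time, the bound of order `2j` is only ever multiplied by second
    -- moments, whose total is at most `a ^ 2` without `W`. Hence `W` stays linear in the final
    -- estimate.
    have claim : ∀ t ⊆ s, ∫ ω, (∑ b ∈ t, Z b ω) ^ (2 * j + 2) ∂P ≤
        2 ^ (2 * j + 2) * ∑ b ∈ t, (sumMomentConst j * a ^ (2 * j) * W * ∫ ω, Z b ω ^ 2 ∂P +
          ∫ ω, Z b ω ^ (2 * j + 2) ∂P) := by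
      intro t
      induction t using Finset.induction_on with
      | empty => intro _; simp
      | insert b t hb iht =>
        intro hbs
        have hts : t ⊆ s := (Finset.subset_insert b t).trans hbs
        have iht := iht hts
        set S : Ω → ℝ := fun ω => ∑ b ∈ t, Z b ω with hS
        have hSL : MemLp S ((2 * h : ℕ) : ℝ≥0∞) P := memLp_finsetSum t fun b _ => hL b
        have hSm : Measurable S := Finset.measurable_sum t fun b _ => hm b
        have hI : IndepFun S (Z b) P := by
          have := hind.indepFun_finsetSum_of_notMem hm hb
          convert this using 1
          ext ω; simp [hS]
        have hIp : ∀ k l : ℕ, IndepFun (fun ω => S ω ^ k) (fun ω => Z b ω ^ l) P := fun k l =>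
          hI.comp (φ := fun x => x ^ k) (ψ := fun x => x ^ l) (by fun_prop) (by fun_prop)
        have iS : ∀ k, k ≤ 2 * h → Integrable (fun ω => S ω ^ k) P := fun k hk =>
          integrable_pow_of_memLp hSL hk
        have iZ : ∀ k, k ≤ 2 * h → Integrable (fun ω => Z b ω ^ k) P := fun k hk =>
          integrable_pow_of_memLp (hL b) hk
        have iSZ : ∀ k l, k ≤ 2 * h → l ≤ 2 * h → Integrable (fun ω => S ω ^ k * Z b ω ^ l) P :=
          fun k l hk hl => (hIp k l).integrable_mul (iS k hk) (iZ l hl)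
        have mul : ∀ k l, ∫ ω, S ω ^ k * Z b ω ^ l ∂P = (∫ ω, S ω ^ k ∂P) * ∫ ω, Z b ω ^ l ∂P :=
          fun k l => (hIp k l).integral_fun_mul_eq_mul_integral
            (by fun_prop) (by have := hm b; fun_prop)
        have pt : ∀ ω, (∑ b ∈ insert b t, Z b ω) ^ (2 * j + 2) ≤ S ω ^ (2 * j + 2) +
            (2 * j + 2) * (S ω ^ (2 * j + 1) * Z b ω ^ 1) +
            2 ^ (2 * j + 2) * (S ω ^ (2 * j) * Z b ω ^ 2 + Z b ω ^ (2 * j + 2)) := fun ω => by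
          rw [Finset.sum_insert hb, add_comm (Z b ω), pow_one]
          exact add_pow_even_le _ _ _
        have i1 := iS (2 * j + 2) (by omega)
        have i2 := (iSZ (2 * j + 1) 1 (by omega) (by omega)).const_mul (2 * j + 2 : ℝ)
        have i3 := iSZ (2 * j) 2 (by omega) (by omega)
        have i4 := iZ (2 * j + 2) (by omega)
        have i0 : Integrable (fun ω => (∑ b ∈ insert b t, Z b ω) ^ (2 * j + 2)) P :=
          integrable_pow_of_memLp (memLp_finsetSum (insert b t) fun b _ => hL b) (by omega)
        have := integral_mono i0 ((i1.fun_add i2).fun_add ((i3.fun_add i4).const_mul (2 ^ (2 * j + 2)))) pt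
        refine this.trans ?_
        rw [integral_add (i1.fun_add i2) ((i3.fun_add i4).const_mul _), integral_add i1 i2,
          integral_const_mul, integral_const_mul, mul, integral_add i3 i4, mul]
        simp only [pow_one, hmean, mul_zero, add_zero]
        rw [Finset.sum_insert hb]
        have hSj : ∫ ω, S ω ^ (2 * j) ∂P ≤ sumMomentConst j * a ^ (2 * j) * W :=
          ih (by omega) hts
        have hz : 0 ≤ ∫ ω, Z b ω ^ 2 ∂P := integral_nonneg fun ω => sq_nonneg _
        have := mul_le_mul_of_nonneg_right hSj hz
        have := mul_le_mul_of_nonneg_left this (by positivity : (0 : ℝ) ≤ 2 ^ (2 * j + 2))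
        linarith
    have nn : ∀ (l : ℕ) b, 0 ≤ ∫ ω, Z b ω ^ (2 * l) ∂P := fun l b =>
      integral_nonneg fun ω => (even_two_mul l).pow_nonneg _
    refine (claim t hts).trans ?_
    rw [Finset.sum_add_distrib, ← Finset.mul_sum]
    have s1 : ∑ b ∈ t, ∫ ω, Z b ω ^ 2 ∂P ≤ a ^ 2 :=
      (Finset.sum_le_sum_of_subset_of_nonneg hts fun b _ _ => nn 1 b).trans h2
    have s2 : ∑ b ∈ t, ∫ ω, Z b ω ^ (2 * j + 2) ∂P ≤ a ^ (2 * j + 2) * W :=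
      (Finset.sum_le_sum_of_subset_of_nonneg hts fun b _ _ => nn (j + 1) b).trans
        (hh (j + 1) (by omega) hj)
    calc _ ≤ 2 ^ (2 * j + 2) * (sumMomentConst j * a ^ (2 * j) * W * a ^ 2 +
            a ^ (2 * j + 2) * W) := by gcongr
      _ = _ := by simp only [sumMomentConst]; ring

end Moments

/-! ### Lindeberg telescoping for product measures -/

section Telescope

variable {ι E : Type*} [Fintype ι] [DecidableEq ι] [MeasurableSpace E]

/-- The preimage of a box is a box with side `j` freed, times that side. This turns each
intermediate measure of the telescoping into an iterated integral whose inner variable is the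
swapped coordinate. -/
theorem map_update_pi (m : ι → Measure E) [∀ i, IsProbabilityMeasure (m i)] (j : ι)
    (ν : Measure E) [IsProbabilityMeasure ν] :
    ((Measure.pi m).prod ν).map (fun z => Function.update z.1 j z.2) =
      Measure.pi (Function.update m j ν) := by
  have : ∀ i, IsProbabilityMeasure (Function.update m j ν i) := fun i => by
    rcases eq_or_ne i j with rfl | h
    · simpa
    · simpa [h] using (inferInstance : IsProbabilityMeasure (m i))
  have hmeas : Measurable (fun z : (ι → E) × E => Function.update z.1 j z.2) := by
    refine measurable_pi_iff.2 fun i => ?_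
    rcases eq_or_ne i j with rfl | h
    · simpa using measurable_snd
    · simp only [Function.update_of_ne h]; fun_prop
  refine (Measure.pi_eq fun s hs => ?_).symm
  rw [Measure.map_apply hmeas (MeasurableSet.univ_pi hs)]
  have : (fun z : (ι → E) × E => Function.update z.1 j z.2) ⁻¹' univ.pi s =
      (univ.pi (Function.update s j univ)) ×ˢ s j := by
    ext ⟨x, y⟩
    simp only [mem_preimage, mem_pi, mem_univ, true_imp_iff, mem_prod]
    constructor
    · intro h
      refine ⟨fun i => ?_, by simpa using h j⟩
      rcases eq_or_ne i j with rfl | hi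
      · simp
      · simpa [hi] using h i
    · rintro ⟨h1, h2⟩ i
      rcases eq_or_ne i j with rfl | hi
      · simpa
      · simpa [hi] using h1 i
  rw [this, Measure.prod_prod, Measure.pi_pi,
    Fintype.prod_eq_mul_prod_compl j (fun i => m i (Function.update s j univ i)),
    Fintype.prod_eq_mul_prod_compl j]
  simp only [Function.update_self, measure_univ, one_mul]
  rw [mul_comm]
  congr 1
  refine Finset.prod_congr rfl fun i hi => ?_
  have hij : i ≠ j := by simpa using hi
  simp [hij]

/-- Lindeberg's telescoping: replacing the factors of a product measure one at a time. -/
theorem abs_integral_pi_sub_le (μ ν : ι → Measure E) [∀ i, IsProbabilityMeasure (μ i)]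
    [∀ i, IsProbabilityMeasure (ν i)] {f : (ι → E) → ℝ} (hf : Measurable f) {c : ℝ}
    (hb : ∀ x, |f x| ≤ c) {ε : ι → ℝ}
    (h : ∀ (j : ι) (m : ι → Measure E), (∀ i, m i = μ i ∨ m i = ν i) →
      |∫ x, (∫ y, f (Function.update x j y) ∂μ j - ∫ y, f (Function.update x j y) ∂ν j)
        ∂Measure.pi m| ≤ ε j) :
    |∫ x, f x ∂Measure.pi μ - ∫ x, f x ∂Measure.pi ν| ≤ ∑ j, ε j := by
  have claim : ∀ s : Finset ι, |∫ x, f x ∂Measure.pi μ -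
      ∫ x, f x ∂Measure.pi (fun i => if i ∈ s then ν i else μ i)| ≤ ∑ j ∈ s, ε j := by
    intro s
    induction s using Finset.induction_on with
    | empty => simp
    | insert j s hj ih =>
      set m : ι → Measure E := fun i => if i ∈ s then ν i else μ i with hm
      have : ∀ i, IsProbabilityMeasure (m i) := fun i => by
        rw [hm]; dsimp only; split_ifs <;> infer_instance
      -- As `j ∉ s`, the hybrid still carries `μ j` there, so consecutive hybrids are updates of the
      -- same `m`.
      have e1 : m = Function.update m j (μ j) := by
        ext1 i
        rcases eq_or_ne i j with rfl | hi
        · simp [hm, hj]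
        · simp [hi]
      have e2 : (fun i => if i ∈ insert j s then ν i else μ i) = Function.update m j (ν j) := by
        ext1 i
        rcases eq_or_ne i j with rfl | hi
        · simp
        · simp [hi, hm]
      have hmeas : Measurable (fun z : (ι → E) × E => Function.update z.1 j z.2) := by
        refine measurable_pi_iff.2 fun i => ?_
        rcases eq_or_ne i j with rfl | h
        · simpa using measurable_snd
        · simp only [Function.update_of_ne h]; fun_prop
      have hfm : Measurable (fun z : (ι → E) × E => f (Function.update z.1 j z.2)) := hf.comp hmeas
      have hint : ∀ (ρ : Measure E) [IsProbabilityMeasure ρ],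
          Integrable (fun z : (ι → E) × E => f (Function.update z.1 j z.2))
            ((Measure.pi m).prod ρ) := fun ρ _ =>
        Integrable.of_bound hfm.aestronglyMeasurable c (ae_of_all _ fun z => hb _)
      have key : ∀ (ρ : Measure E) [IsProbabilityMeasure ρ],
          ∫ x, f x ∂Measure.pi (Function.update m j ρ) =
            ∫ x, ∫ y, f (Function.update x j y) ∂ρ ∂Measure.pi m := fun ρ _ => by
        rw [← map_update_pi, integral_map hmeas.aemeasurable hf.aestronglyMeasurable,
          integral_prod _ (hint ρ)]
      have hd := h j m fun i => by
        rw [hm]; dsimp only; split_ifs <;> simp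
      rw [integral_sub (hint (μ j)).integral_prod_left (hint (ν j)).integral_prod_left,
        ← key, ← key, ← e1] at hd
      rw [e2, Finset.sum_insert hj]
      calc _ = |(∫ x, f x ∂Measure.pi μ - ∫ x, f x ∂Measure.pi m) + (∫ x, f x ∂Measure.pi m -
              ∫ x, f x ∂Measure.pi (Function.update m j (ν j)))| := by ring_nf
        _ ≤ _ := (abs_add_le _ _).trans (by linarith)
  simpa using claim Finset.univ

end Telescope

/-! ### Taylor expansion of the soft minimum in one row -/

section RowTaylor

theorem hasThreeDerivs_of_contDiff {f : ℝ → ℝ} (hf : ContDiff ℝ 3 f) :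
    HasThreeDerivs f (iteratedDeriv 1 f) (iteratedDeriv 2 f) (iteratedDeriv 3 f) := by
  have h : ∀ k : ℕ, k < 3 → ∀ x, HasDerivAt (iteratedDeriv k f) (iteratedDeriv (k + 1) f x) x := by
    intro k hk x
    rw [iteratedDeriv_succ]
    exact ((hf.differentiable_iteratedDeriv k (by exact_mod_cast hk)) x).hasDerivAt
  refine ⟨fun x => ?_, h 1 (by norm_num), h 2 (by norm_num)⟩
  simpa using h 0 (by norm_num) x

/-- A nonnegative `C³` loss with self-bounded derivatives and polynomial growth. -/
structure SmoothLoss (q : Fin 4 → ℝ) (D Λ : ℝ) (ℓ : ℝ → ℝ) : Prop where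
  nonneg : ∀ x, 0 ≤ ℓ x
  contDiff : ContDiff ℝ 3 ℓ
  deriv_le : ∀ k : Fin 4, k ≠ 0 → ∀ x, |iteratedDeriv (k : ℕ) ℓ x| ≤ D * (1 + ℓ x ^ q k)
  growth : ∀ x, ℓ x ≤ Λ * (2 + |x| ^ q 0)

/-- A `C³` function with values in `[0, 1]` whose first three derivatives are bounded by `κ`. -/
structure SmoothTest (κ : ℝ) (φ : ℝ → ℝ) : Prop where
  mem_Icc : ∀ x, φ x ∈ Icc (0 : ℝ) 1
  contDiff : ContDiff ℝ 3 φ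
  deriv_le : ∀ k ∈ Finset.Icc 1 3, ∀ x, |iteratedDeriv k φ x| ≤ κ

variable {q : Fin 4 → ℝ}

theorem bigQ_nonneg (hq : ∀ k, 0 ≤ q k) : 0 ≤ bigQ q :=
  (mul_nonneg (by norm_num) (hq 1)).trans (le_max_left _ _)

theorem q0_mul_bigQ_le_qBar (q : Fin 4 → ℝ) : q 0 * bigQ q ≤ qBar q := by
  have := Nat.le_ceil (q 0 * bigQ q / 2)
  unfold qBar
  push_cast
  linarith

/-- With `y = max 1 |x|` the hypothesis reads `e ≤ 6 Λ y ^ r`, and since `y ≥ 1` the real exponent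
`r a` can be rounded up to the natural number `m`. The constant 5 leaves room for the `1` in `1 +
ℓ`. -/
theorem rpow_growth_le {x r a e : ℝ} {m : ℕ} {Λ : ℝ} (hΛ : 1 ≤ Λ) (ha : 0 ≤ a) (hr : 0 ≤ r)
    (he : 0 ≤ e) (hm : r * a ≤ m) (he' : e ≤ Λ * (5 + |x| ^ r)) :
    e ^ a ≤ 6 ^ a * Λ ^ a * (1 + |x| ^ m) := by
  set y := max 1 |x| with hy
  have hy1 : 1 ≤ y := le_max_left _ _
  have h1 : |x| ^ r ≤ y ^ r := Real.rpow_le_rpow (abs_nonneg _) (le_max_right _ _) hr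
  have h2 : 1 ≤ y ^ r := Real.one_le_rpow hy1 hr
  have h3 : e ≤ 6 * Λ * y ^ r := by
    calc e ≤ Λ * (5 + |x| ^ r) := he'
      _ ≤ Λ * (6 * y ^ r) := by gcongr; linarith
      _ = _ := by ring
  calc e ^ a ≤ (6 * Λ * y ^ r) ^ a := Real.rpow_le_rpow he h3 ha
    _ = 6 ^ a * Λ ^ a * (y ^ r) ^ a := by
        rw [Real.mul_rpow (by positivity) (by positivity), Real.mul_rpow (by positivity) (by positivity)]
    _ ≤ 6 ^ a * Λ ^ a * (1 + |x| ^ m) := by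
        gcongr
        rw [← Real.rpow_mul (by linarith)]
        calc y ^ (r * a) ≤ y ^ (m : ℝ) := Real.rpow_le_rpow_of_exponent_le hy1 hm
          _ = y ^ m := Real.rpow_natCast _ _
          _ ≤ 1 + |x| ^ m := by
            rcases le_total 1 |x| with h | h
            · rw [hy, max_eq_right h]; linarith
            · rw [hy, max_eq_left h, one_pow]; have : 0 ≤ |x| ^ m := by positivity
              linarith

theorem gibbsAvg_sum {ι κ : Type*} {N : Finset ι} {w : ι → ℝ} (s : Finset κ) (f : κ → ι → ℝ) :
    gibbsAvg N w (fun u => ∑ j ∈ s, f j u) = ∑ j ∈ s, gibbsAvg N w (f j) := by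
  unfold gibbsAvg
  rw [← Finset.sum_div]
  congr 1
  rw [Finset.sum_comm]
  exact Finset.sum_congr rfl fun u _ => by rw [Finset.mul_sum]

theorem gibbsAvg_add {ι : Type*} {N : Finset ι} {w f g : ι → ℝ} :
    gibbsAvg N w (fun u => f u + g u) = gibbsAvg N w f + gibbsAvg N w g := by
  unfold gibbsAvg
  rw [← add_div, ← Finset.sum_add_distrib]
  congr 1; exact Finset.sum_congr rfl fun u _ => by ring

theorem gibbsAvg_const {ι : Type*} {N : Finset ι} {w : ι → ℝ} (h : 0 < ∑ u ∈ N, w u) (a : ℝ) :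
    gibbsAvg N w (fun _ => a) = a := by
  unfold gibbsAvg
  rw [← Finset.sum_mul]
  field_simp

variable {p : ℕ} {N : Finset (Fin p → ℝ)} {w g : (Fin p → ℝ) → ℝ}

/-- Together with the quadratic version, this exhibits the first two derivatives as linear and
quadratic forms in the increment, so that only the mean and covariance of a row enter. -/
theorem gibbsAvg_mul_dotProduct (y : Fin p → ℝ) :
    gibbsAvg N w (fun u => g u * (y ⬝ᵥ u)) = ∑ j, gibbsAvg N w (fun u => g u * u j) * y j := by
  have : (fun u : Fin p → ℝ => g u * (y ⬝ᵥ u)) = fun u => ∑ j, y j * (g u * u j) := by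
    ext u; rw [dotProduct, Finset.mul_sum]; exact Finset.sum_congr rfl fun j _ => by ring
  rw [this, gibbsAvg_sum]
  exact Finset.sum_congr rfl fun j _ => by rw [gibbsAvg_const_mul]; ring

theorem gibbsAvg_mul_dotProduct_sq (y : Fin p → ℝ) :
    gibbsAvg N w (fun u => g u * (y ⬝ᵥ u) ^ 2) =
      ∑ j, ∑ k, gibbsAvg N w (fun u => g u * (u j * u k)) * (y j * y k) := by
  have : (fun u : Fin p → ℝ => g u * (y ⬝ᵥ u) ^ 2) =
      fun u => ∑ j, ∑ k, (y j * y k) * (g u * (u j * u k)) := by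
    ext u; rw [dotProduct, sq, Finset.sum_mul_sum, Finset.mul_sum]
    refine Finset.sum_congr rfl fun j _ => ?_
    rw [Finset.mul_sum]; exact Finset.sum_congr rfl fun k _ => by ring
  rw [this, gibbsAvg_sum]
  refine Finset.sum_congr rfl fun j _ => ?_
  rw [gibbsAvg_sum]
  exact Finset.sum_congr rfl fun k _ => by rw [gibbsAvg_const_mul]; ring

theorem abs_dotProduct_le {L : ℝ} (y u : Fin p → ℝ) (hu : ‖u‖ ≤ L) : |y ⬝ᵥ u| ≤ L * ∑ j, |y j| := by
  rw [dotProduct, Finset.mul_sum]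
  refine (Finset.abs_sum_le_sum_abs _ _).trans (Finset.sum_le_sum fun j _ => ?_)
  rw [abs_mul, mul_comm]
  exact mul_le_mul_of_nonneg_right ((norm_le_pi_norm u j).trans hu) (abs_nonneg _)

/-- `φ` of the soft minimum of the risk, as a function of one row of the design. -/
noncomputable def rowFun (N : Finset (Fin p → ℝ)) (c : (Fin p → ℝ) → ℝ) (φ ℓ : ℝ → ℝ) (n s : ℝ)
    (x : Fin p → ℝ) : ℝ :=
  φ (-(1 / (n * s)) * Real.log (∑ u ∈ N, c u * Real.exp (-s * ℓ (x ⬝ᵥ u))))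

/-- The constant in front of the third-order remainder. -/
noncomputable def taylorConst (q : Fin 4 → ℝ) (n s D Λ κ : ℝ) : ℝ :=
  48 * κ / n * (1 + s) ^ 2 * D ^ 3 * (6 ^ bigQ q * Λ ^ bigQ q * 2 ^ qBar q)

/-- The coefficients depend on `x` alone, and the remainder averages against `c`, which is
independent of both `x` and `y`. This permits integrating `y` over one block and then `x` over the
others. -/
theorem exists_rowFun_taylor (hq : ∀ k, 0 ≤ q k) {ℓ φ : ℝ → ℝ} {D Λ κ L n s : ℝ}
    (hℓ : SmoothLoss q D Λ ℓ) (hφ : SmoothTest κ φ) (hD : 1 ≤ D) (hΛ : 1 ≤ Λ)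
    (hL : 0 ≤ L) (hn : 1 ≤ n) (hs : 0 < s)
    (hN : N.Nonempty) (hNL : ∀ u ∈ N, ‖u‖ ≤ L) {c : (Fin p → ℝ) → ℝ} (hc : ∀ u ∈ N, 0 < c u)
    (x : Fin p → ℝ) :
    ∃ (α : Fin p → ℝ) (A : Fin p → Fin p → ℝ), ∀ y : Fin p → ℝ,
      |rowFun N c φ ℓ n s (x + y) - rowFun N c φ ℓ n s x - ∑ j, α j * y j -
        ∑ j, ∑ k, A j k * (y j * y k)| ≤
      taylorConst q n s D Λ κ * (L * ∑ j, |y j|) ^ 3 *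
        (1 + (L * ∑ j, |y j|) ^ qBar q + gibbsAvg N c (fun u => (x ⬝ᵥ u) ^ qBar q)) := by
  set b : (Fin p → ℝ) → ℝ := fun u => x ⬝ᵥ u with hb
  set F : ((Fin p → ℝ) → ℝ) → ℝ :=
    fun z => -(1 / (n * s)) * Real.log (∑ u ∈ N, c u * Real.exp (-s * ℓ (z u))) with hF
  set W : (Fin p → ℝ) → ℝ := fun u => c u * Real.exp (-s * ℓ (b u)) with hW
  set ℓ₁ := iteratedDeriv 1 ℓ
  set ℓ₂ := iteratedDeriv 2 ℓ
  set a1 : Fin p → ℝ := fun j => gibbsAvg N W (fun u => ℓ₁ (b u) * u j) with ha1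
  have hκ : 0 ≤ κ := (abs_nonneg _).trans (hφ.deriv_le 1 (by simp) 0)
  have hsum : 0 < ∑ u ∈ N, c u := Finset.sum_pos hc hN
  refine ⟨fun j => iteratedDeriv 1 φ (F b) / n * a1 j, fun j k =>
    (iteratedDeriv 2 φ (F b) / n ^ 2 * (a1 j * a1 k) + iteratedDeriv 1 φ (F b) / n *
      (gibbsAvg N W (fun u => ℓ₂ (b u) * (u j * u k)) -
        s * (gibbsAvg N W (fun u => ℓ₁ (b u) ^ 2 * (u j * u k)) - a1 j * a1 k))) / 2, fun y => ?_⟩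
  set Y := L * ∑ j, |y j| with hY
  have hY0 : 0 ≤ Y := mul_nonneg hL (Finset.sum_nonneg fun j _ => abs_nonneg _)
  -- Evenness is what lets the absolute value be dropped, so that the remainder contains a
  -- polynomial moment of `x ⬝ᵥ u`.
  have even : Even (qBar q) := ⟨⌈q 0 * bigQ q / 2⌉₊, by unfold qBar; ring⟩
  have key := abs_softMin_taylor_le (N := N) (c := c) (b := b) (y := fun u => y ⬝ᵥ u)
    (mm := fun u => 6 ^ bigQ q * Λ ^ bigQ q * 2 ^ qBar q * (1 + Y ^ qBar q + (x ⬝ᵥ u) ^ qBar q))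
    (q₁ := q 1) (q₂ := q 2) (q₃ := q 3) (Q := bigQ q) (s := s) (D := D) (Y := Y) (n := n) (κ := κ)
    hN hc (hasThreeDerivs_of_contDiff hℓ.contDiff) (hasThreeDerivs_of_contDiff hφ.contDiff)
    hℓ.nonneg (hq 1) (hq 2) (hq 3) (le_max_left _ _)
    ((le_max_left _ _).trans (le_max_right _ _)) ((le_max_right _ _).trans (le_max_right _ _))
    hs hD hY0 hn (hφ.deriv_le 1 (by simp)) (hφ.deriv_le 2 (by simp)) (hφ.deriv_le 3 (by simp))
    (fun x => hℓ.deriv_le 1 (by decide) x) (fun x => hℓ.deriv_le 2 (by decide) x)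
    (fun x => hℓ.deriv_le 3 (by decide) x)
    (fun u hu => abs_dotProduct_le y u (hNL u hu)) ?_ hF rfl
  · have e1 : rowFun N c φ ℓ n s (x + y) = φ (F (fun u => b u + y ⬝ᵥ u)) := by
      simp only [rowFun, hF, hb, add_dotProduct]
    have e2 : rowFun N c φ ℓ n s x = φ (F b) := rfl
    have e3 : gibbsAvg N W (fun u => ℓ₁ (b u) * (y ⬝ᵥ u)) = ∑ j, a1 j * y j :=
      gibbsAvg_mul_dotProduct y
    have e4 := gibbsAvg_mul_dotProduct_sq (N := N) (w := W) (g := fun u => ℓ₂ (b u)) y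
    have e5 : gibbsAvg N W (fun u => (ℓ₁ (b u) * (y ⬝ᵥ u)) * (ℓ₁ (b u) * (y ⬝ᵥ u))) =
        ∑ j, ∑ k, gibbsAvg N W (fun u => ℓ₁ (b u) ^ 2 * (u j * u k)) * (y j * y k) := by
      rw [← gibbsAvg_mul_dotProduct_sq]; congr 1; ext u; ring
    have e6 : (∑ j, a1 j * y j) * (∑ j, a1 j * y j) = ∑ j, ∑ k, (a1 j * a1 k) * (y j * y k) := by
      rw [Finset.sum_mul_sum]
      exact Finset.sum_congr rfl fun j _ => Finset.sum_congr rfl fun k _ => by ring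
    have lin : ∑ j, iteratedDeriv 1 φ (F b) / n * a1 j * y j =
        iteratedDeriv 1 φ (F b) / n * ∑ j, a1 j * y j := by
      rw [Finset.mul_sum]; exact Finset.sum_congr rfl fun j _ => by ring
    rw [e3, e4, e5, sq (∑ j, a1 j * y j), e6] at key
    rw [e1, e2, lin]
    have quad : ∑ j, ∑ k, (iteratedDeriv 2 φ (F b) / n ^ 2 * (a1 j * a1 k) +
        iteratedDeriv 1 φ (F b) / n * (gibbsAvg N W (fun u => ℓ₂ (b u) * (u j * u k)) -
        s * (gibbsAvg N W (fun u => ℓ₁ (b u) ^ 2 * (u j * u k)) - a1 j * a1 k))) / 2 *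
          (y j * y k) =
        (iteratedDeriv 2 φ (F b) / n ^ 2 * (∑ j, ∑ k, (a1 j * a1 k) * (y j * y k)) +
          iteratedDeriv 1 φ (F b) / n *
          ((∑ j, ∑ k, gibbsAvg N W (fun u => ℓ₂ (b u) * (u j * u k)) * (y j * y k)) -
            s * ((∑ j, ∑ k, gibbsAvg N W (fun u => ℓ₁ (b u) ^ 2 * (u j * u k)) * (y j * y k)) -
              ∑ j, ∑ k, (a1 j * a1 k) * (y j * y k)))) / 2 := by
      simp only [Finset.mul_sum, ← Finset.sum_sub_distrib, ← Finset.sum_add_distrib,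
        Finset.sum_div]
      exact Finset.sum_congr rfl fun j _ => Finset.sum_congr rfl fun k _ => by ring
    rw [quad]
    refine key.trans_eq ?_
    rw [gibbsAvg_const_mul, gibbsAvg_add, gibbsAvg_const hsum, taylorConst]
    ring
  · intro u hu t ht
    have gr : 1 + ℓ (b u + t * (y ⬝ᵥ u)) ≤ Λ * (5 + |b u + t * (y ⬝ᵥ u)| ^ q 0) := by
      have := hℓ.growth (b u + t * (y ⬝ᵥ u))
      linarith
    refine (rpow_growth_le hΛ (bigQ_nonneg hq) (hq 0)
      (by linarith [hℓ.nonneg (b u + t * (y ⬝ᵥ u))]) (q0_mul_bigQ_le_qBar q) gr).trans ?_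
    rw [mul_assoc _ (2 ^ qBar q : ℝ)]
    have hΛ0 : 0 ≤ Λ := by linarith
    refine mul_le_mul_of_nonneg_left ?_ (by positivity)
    have hty : |t * (y ⬝ᵥ u)| ≤ Y := by
      rw [abs_mul, abs_of_nonneg ht.1]
      have := abs_dotProduct_le y u (hNL u hu)
      have h2 := mul_le_mul ht.2 this (abs_nonneg _) (by norm_num)
      linarith
    have h1 : |b u + t * (y ⬝ᵥ u)| ^ qBar q ≤ (|b u| + Y) ^ qBar q := by
      gcongr; exact (abs_add_le _ _).trans (by linarith)
    have h2 : (|b u| + Y) ^ qBar q ≤ 2 ^ qBar q * (|b u| ^ qBar q + Y ^ qBar q) := by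
      refine (add_pow_le (abs_nonneg _) hY0 _).trans ?_
      gcongr
      · norm_num
      · omega
    rw [even.pow_abs] at h2
    have h3 : (1 : ℝ) ≤ 2 ^ qBar q := one_le_pow₀ (by norm_num)
    linarith

end RowTaylor

/-! ### Laws of rows with independent blocks -/

section RowLaw

variable {p k n r : ℕ}

/-- The part of the vector `x` supported on `s`. -/
def blockPart (s : Finset (Fin p)) (x : Fin p → ℝ) : Fin p → ℝ := fun j => if j ∈ s then x j else 0

theorem measurable_blockPart (s : Finset (Fin p)) : Measurable (blockPart s) := by
  refine measurable_pi_iff.2 fun j => ?_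
  unfold blockPart
  split_ifs <;> fun_prop

/-- The law of a centred row with covariance `Σ / n`, moments up to order `r` of the right size,
and independent parts on the cells `B`. -/
structure RowLaw (B : Fin k → Finset (Fin p)) (Sig : Matrix (Fin p) (Fin p) ℝ) (n r : ℕ) (K : ℝ)
    (μ : Measure (Fin p → ℝ)) : Prop where
  blocks : (Measure.pi fun a => μ.map (blockPart (B a))).map (fun x => ∑ a, x a) = μ
  memLp : ∀ j, MemLp (fun x => x j) (r : ℝ≥0∞) μ
  mean : ∀ j, ∫ x, x j ∂μ = 0
  cov : ∀ i j, ∫ x, x i * x j ∂μ = Sig i j / n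
  moment : ∀ j, ∀ l ≤ r, ∫ x, |x j| ^ l ∂μ ≤ K / Real.sqrt n ^ l

variable {B : Fin k → Finset (Fin p)} {Sig : Matrix (Fin p) (Fin p) ℝ} {K : ℝ}
  {μ ν : Measure (Fin p → ℝ)} [IsProbabilityMeasure μ] [IsProbabilityMeasure ν]

theorem RowLaw.integrable_mul (hμ : RowLaw B Sig n r K μ) (hr : 2 ≤ r) (i j : Fin p) :
    Integrable (fun x => x i * x j) μ := by
  have h2 : ∀ j, MemLp (fun x : Fin p → ℝ => x j) 2 μ := fun j =>
    (hμ.memLp j).mono_exponent (by exact_mod_cast hr)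
  exact (h2 i).integrable_mul (h2 j)

theorem RowLaw.integrable_l1_pow (hμ : RowLaw B Sig n r K μ) (s : Finset (Fin p)) {l : ℕ}
    (hl : l ≤ r) : Integrable (fun x => (∑ j ∈ s, |x j|) ^ l) μ :=
  integrable_pow_of_memLp (memLp_finsetSum s fun j _ => (hμ.memLp j).abs) hl

/-- By the power-mean inequality the `ℓ¹` norm of a block costs a power of its size times
coordinatewise moments; no independence inside the block is needed. -/
theorem RowLaw.integral_l1_pow_le (hμ : RowLaw B Sig n r K μ) (hK : 1 ≤ K) (s : Finset (Fin p))
    {l : ℕ} (hl : l ≤ r) :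
    ∫ x, (∑ j ∈ s, |x j|) ^ l ∂μ ≤ K * ((s.card : ℝ) / Real.sqrt n) ^ l := by
  rcases l with _ | l
  · simpa using hK
  · have i1 : ∀ j, Integrable (fun x : Fin p → ℝ => |x j| ^ (l + 1)) μ := fun j =>
      integrable_pow_of_memLp (hμ.memLp j).abs hl
    have pt : ∀ x : Fin p → ℝ, (∑ j ∈ s, |x j|) ^ (l + 1) ≤
        (s.card : ℝ) ^ l * ∑ j ∈ s, |x j| ^ (l + 1) := fun x => by
      rcases s.eq_empty_or_nonempty with rfl | hs
      · simp
      · have := pow_sum_div_card_le_sum_pow (s := s) (f := fun j => |x j|)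
          (fun j _ => abs_nonneg _) l
        have hc : (0 : ℝ) < (s.card : ℝ) ^ l := by
          have : 0 < s.card := hs.card_pos
          positivity
        rwa [div_le_iff₀ hc, mul_comm] at this
    calc ∫ x, (∑ j ∈ s, |x j|) ^ (l + 1) ∂μ
        ≤ ∫ x, (s.card : ℝ) ^ l * ∑ j ∈ s, |x j| ^ (l + 1) ∂μ :=
          integral_mono (hμ.integrable_l1_pow s hl)
            ((integrable_finsetSum s fun j _ => i1 j).const_mul _) pt
      _ = (s.card : ℝ) ^ l * ∑ j ∈ s, ∫ x, |x j| ^ (l + 1) ∂μ := by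
          rw [integral_const_mul, integral_finsetSum s fun j _ => i1 j]
      _ ≤ (s.card : ℝ) ^ l * ∑ j ∈ s, K / Real.sqrt n ^ (l + 1) := by
          gcongr with j _
          exact hμ.moment j _ hl
      _ = _ := by rw [Finset.sum_const, nsmul_eq_mul, div_pow]; ring

theorem sum_abs_blockPart (s : Finset (Fin p)) (x : Fin p → ℝ) :
    ∑ j, |blockPart s x j| = ∑ j ∈ s, |x j| := by
  rw [← Finset.sum_filter_add_sum_filter_not Finset.univ (· ∈ s)]
  rw [Finset.sum_eq_zero (s := Finset.univ.filter (· ∉ s)), add_zero, Finset.filter_mem_eq_inter,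
    Finset.univ_inter]
  · exact Finset.sum_congr rfl fun j hj => by simp [blockPart, hj]
  · intro j hj; simp at hj; simp [blockPart, hj]

theorem blockPart_dotProduct (s : Finset (Fin p)) (x u : Fin p → ℝ) :
    blockPart s x ⬝ᵥ u = x ⬝ᵥ blockPart s u := by
  unfold dotProduct blockPart
  refine Finset.sum_congr rfl fun j _ => ?_
  split_ifs <;> simp

theorem abs_blockPart_dotProduct_le {L : ℝ} (s : Finset (Fin p)) (x u : Fin p → ℝ) (hu : ‖u‖ ≤ L) :
    |blockPart s x ⬝ᵥ u| ≤ L * ∑ j ∈ s, |x j| := by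
  rw [← sum_abs_blockPart]; exact abs_dotProduct_le _ _ hu

theorem RowLaw.memLp_blockPart_dotProduct (hμ : RowLaw B Sig n r K μ) (s : Finset (Fin p))
    (u : Fin p → ℝ) : MemLp (fun x => blockPart s x ⬝ᵥ u) (r : ℝ≥0∞) μ := by
  simp only [blockPart_dotProduct]
  simp only [dotProduct]
  exact memLp_finsetSum _ fun j _ => (hμ.memLp j).mul_const _

theorem RowLaw.integral_blockPart_dotProduct (hμ : RowLaw B Sig n r K μ) (hr : 1 ≤ r)
    (s : Finset (Fin p)) (u : Fin p → ℝ) : ∫ x, blockPart s x ⬝ᵥ u ∂μ = 0 := by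
  simp only [blockPart_dotProduct]
  simp only [dotProduct]
  rw [integral_finsetSum]
  · refine Finset.sum_eq_zero fun j _ => ?_
    rw [integral_mul_const, hμ.mean, zero_mul]
  · intro j _
    exact ((hμ.memLp j).integrable (by exact_mod_cast hr)).mul_const _

theorem RowLaw.integral_quadratic (hμ : RowLaw B Sig n r K μ) (hr : 2 ≤ r)
    (A : Fin p → Fin p → ℝ) :
    ∫ x, ∑ i, ∑ j, A i j * (x i * x j) ∂μ = ∑ i, ∑ j, A i j * (Sig i j / n) := by
  rw [integral_finsetSum]
  · refine Finset.sum_congr rfl fun i _ => ?_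
    rw [integral_finsetSum]
    · exact Finset.sum_congr rfl fun j _ => by rw [integral_const_mul, hμ.cov]
    · exact fun j _ => (hμ.integrable_mul hr i j).const_mul _
  · exact fun i _ => integrable_finsetSum _ fun j _ => (hμ.integrable_mul hr i j).const_mul _

theorem RowLaw.integrable_quadratic (hμ : RowLaw B Sig n r K μ) (hr : 2 ≤ r)
    (A : Fin p → Fin p → ℝ) : Integrable (fun x => ∑ i, ∑ j, A i j * (x i * x j)) μ :=
  integrable_finsetSum _ fun i _ => integrable_finsetSum _ fun j _ =>
    (hμ.integrable_mul hr i j).const_mul _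

/-- The second moment is a quadratic form of the covariance, so the operator bound applies. It is
linear in the size of the block, where coordinatewise moments would give its square. -/
theorem RowLaw.integral_blockPart_dotProduct_sq_le (hμ : RowLaw B Sig n r K μ) (hr : 2 ≤ r)
    {M L : ℝ} (hM : 0 ≤ M)
    (hSig : ∀ v : Fin p → ℝ, ∑ i, ∑ j, Sig i j * (v i * v j) ≤ M * ∑ i, v i ^ 2)
    (s : Finset (Fin p)) {u : Fin p → ℝ} (hu : ‖u‖ ≤ L) :
    ∫ x, (blockPart s x ⬝ᵥ u) ^ 2 ∂μ ≤ M * L ^ 2 * (s.card / n) := by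
  set v := blockPart s u with hv
  have e : (fun x : Fin p → ℝ => (blockPart s x ⬝ᵥ u) ^ 2) =
      fun x => ∑ i, ∑ j, (v i * v j) * (x i * x j) := by
    ext x
    rw [blockPart_dotProduct, sq, dotProduct, Finset.sum_mul_sum]
    exact Finset.sum_congr rfl fun i _ => Finset.sum_congr rfl fun j _ => by ring
  rw [e, hμ.integral_quadratic hr]
  have h1 : ∑ i, ∑ j, v i * v j * (Sig i j / n) = (∑ i, ∑ j, Sig i j * (v i * v j)) / n := by
    simp only [Finset.sum_div]
    exact Finset.sum_congr rfl fun i _ => Finset.sum_congr rfl fun j _ => by ring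
  have h2 : ∑ i, v i ^ 2 ≤ L ^ 2 * s.card := by
    have : ∀ i, v i ^ 2 ≤ if i ∈ s then L ^ 2 else 0 := fun i => by
      rw [hv]; unfold blockPart
      split_ifs
      · exact sq_le_sq' (by have := (abs_le.1 ((norm_le_pi_norm u i).trans hu)).1; linarith)
          (abs_le.1 ((norm_le_pi_norm u i).trans hu)).2
      · simp
    refine (Finset.sum_le_sum fun i _ => this i).trans_eq ?_
    rw [Finset.sum_ite_mem, Finset.univ_inter, Finset.sum_const, nsmul_eq_mul, mul_comm]
  rw [h1]
  calc (∑ i, ∑ j, Sig i j * (v i * v j)) / n ≤ (M * (L ^ 2 * s.card)) / n := by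
        gcongr; exact (hSig v).trans (by gcongr)
    _ = _ := by ring

/-- Integrating a second-order expansion over one block of a row. -/
theorem RowLaw.abs_integral_sub_quadratic_le (hμ : RowLaw B Sig n r K μ) (hK : 1 ≤ K)
    (s : Finset (Fin p)) {m : ℕ} (hr : m + 3 ≤ r) {g : (Fin p → ℝ) → ℝ} (hg : Measurable g)
    {b : ℝ} (hgb : ∀ y, |g y| ≤ b) {g₀ T L v : ℝ} (hT : 0 ≤ T) (hL : 0 ≤ L) (hv : 0 ≤ v)
    {α : Fin p → ℝ} {A : Fin p → Fin p → ℝ}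
    (h : ∀ y, |g y - g₀ - ∑ j, α j * y j - ∑ i, ∑ j, A i j * (y i * y j)| ≤
      T * (L * ∑ j, |y j|) ^ 3 * (1 + (L * ∑ j, |y j|) ^ m + v)) :
    |∫ x, g (blockPart s x) ∂μ - g₀ - ∑ i, ∑ j,
        (if i ∈ s then (if j ∈ s then A i j else 0) else 0) * (Sig i j / n)| ≤
      T * L ^ 3 * K * ((s.card : ℝ) / Real.sqrt n) ^ 3 *
        (1 + v + (L * (s.card / Real.sqrt n)) ^ m) := by
  -- Restricting the quadratic form to `s × s` expresses its integral through `Sig` alone, hence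
  -- identically for any two row laws with these parameters.
  set A' : Fin p → Fin p → ℝ := fun i j => if i ∈ s then (if j ∈ s then A i j else 0) else 0
  have hgi : Integrable (fun x => g (blockPart s x)) μ :=
    Integrable.of_bound (hg.comp (measurable_blockPart s)).aestronglyMeasurable b
      (ae_of_all _ fun x => hgb _)
  have hlin : Integrable (fun x => blockPart s x ⬝ᵥ α) μ :=
    (hμ.memLp_blockPart_dotProduct s α).integrable (by exact_mod_cast (by omega : 1 ≤ r))
  have hquad := hμ.integrable_quadratic (by omega) A'
  have e : ∫ x, (g (blockPart s x) - g₀ - blockPart s x ⬝ᵥ α -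
      ∑ i, ∑ j, A' i j * (x i * x j)) ∂μ =
      ∫ x, g (blockPart s x) ∂μ - g₀ - ∑ i, ∑ j, A' i j * (Sig i j / n) := by
    have s1 : Integrable (fun x => g (blockPart s x) - g₀) μ := hgi.sub (integrable_const g₀)
    have s2 : Integrable (fun x => g (blockPart s x) - g₀ - blockPart s x ⬝ᵥ α) μ := s1.sub hlin
    rw [integral_sub s2 hquad, integral_sub s1 hlin, integral_sub hgi (integrable_const g₀),
      hμ.integral_blockPart_dotProduct (by omega), hμ.integral_quadratic (by omega)]
    simp
  rw [← e]
  -- The remainder has pieces of degrees `3` and `m + 3`, whence the requirement `m + 3 ≤ r`.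
  have i3 := (hμ.integrable_l1_pow s (l := 3) (by omega)).const_mul (T * L ^ 3 * (1 + v))
  have im := (hμ.integrable_l1_pow s (l := m + 3) hr).const_mul (T * L ^ (m + 3))
  have := norm_integral_le_of_norm_le (i3.fun_add im) (f := fun x => g (blockPart s x) - g₀ -
    blockPart s x ⬝ᵥ α - ∑ i, ∑ j, A' i j * (x i * x j)) (ae_of_all _ fun x => ?_)
  · rw [Real.norm_eq_abs, integral_add i3 im, integral_const_mul, integral_const_mul] at this
    refine this.trans ?_
    have m3 := hμ.integral_l1_pow_le hK s (l := 3) (by omega)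
    have mm := hμ.integral_l1_pow_le hK s (l := m + 3) hr
    calc _ ≤ T * L ^ 3 * (1 + v) * (K * ((s.card : ℝ) / Real.sqrt n) ^ 3) +
          T * L ^ (m + 3) * (K * ((s.card : ℝ) / Real.sqrt n) ^ (m + 3)) := by gcongr
      _ = _ := by ring
  · have h0 := h (blockPart s x)
    rw [sum_abs_blockPart] at h0
    have e1 : ∑ j, α j * blockPart s x j = blockPart s x ⬝ᵥ α := by
      rw [dotProduct]; exact Finset.sum_congr rfl fun j _ => by ring
    have e2 : ∑ i, ∑ j, A i j * (blockPart s x i * blockPart s x j) =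
        ∑ i, ∑ j, A' i j * (x i * x j) := by
      refine Finset.sum_congr rfl fun i _ => Finset.sum_congr rfl fun j _ => ?_
      simp only [A', blockPart]
      split_ifs <;> simp
    rw [e1, e2] at h0
    refine h0.trans_eq ?_
    ring

end RowLaw

/-! ### Moments of rows mixing blocks of both laws -/

section Hybrid

variable {p k n r : ℕ} {B : Fin k → Finset (Fin p)} {Sig : Matrix (Fin p) (Fin p) ℝ} {K : ℝ}
  {μ ν : Measure (Fin p → ℝ)}

theorem sum_card_le (hB : ∀ a b, a ≠ b → Disjoint (B a) (B b)) : ∑ a, (B a).card ≤ p := by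
  have h := Finset.card_biUnion (s := Finset.univ) (t := B) fun a _ b _ hab => hB a b hab
  rw [← h]
  simpa using Finset.card_le_univ (Finset.univ.biUnion B)

/-- Of the `2(i + 2)` factors of a block size, one is kept for the sum over blocks, `i` are bounded
by `p` and the other `i + 3` by `d`. Then `p ^ i` times the total size is at most `(θ n) ^ (i + 1)`,
so one factor `1 / n` survives next to `d ^ (h + 1)`. -/
theorem sum_card_pow_le (hB : ∀ a b, a ≠ b → Disjoint (B a) (B b)) {d h i : ℕ} (hd : 1 ≤ d)
    (hBd : ∀ a, (B a).card ≤ d) (hn : 0 < n) {θ : ℝ} (hθ : 1 ≤ θ) (hp : (p : ℝ) ≤ θ * n)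
    {L Q : ℝ} (hL : 0 ≤ L) (hK : 1 ≤ K) (hQ : K * θ ≤ Q) (hi : i + 2 ≤ h) :
    ∑ b, L ^ (2 * (i + 2)) * (K * (((B b).card : ℝ) / Real.sqrt n) ^ (2 * (i + 2))) ≤
      L ^ (2 * (i + 2)) * Q ^ (i + 2) * (1 + (d : ℝ) ^ (h + 1) / n) := by
  have hn0 : (0 : ℝ) < n := by exact_mod_cast hn
  have sumcard : ∑ b, ((B b).card : ℝ) ≤ θ * n := by
    have : ((∑ b, (B b).card : ℕ) : ℝ) ≤ p := by exact_mod_cast sum_card_le hB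
    push_cast at this; linarith
  have cardp : ∀ b, ((B b).card : ℝ) ≤ p := fun b => by
    exact_mod_cast (by simpa using Finset.card_le_univ (B b))
  have cardd : ∀ b, ((B b).card : ℝ) ≤ d := fun b => by exact_mod_cast hBd b
  have hd1 : (1 : ℝ) ≤ d := by exact_mod_cast hd
  have cardpow : ∀ b, (((B b).card : ℝ) / Real.sqrt n) ^ (2 * (i + 2)) ≤
      ((B b).card : ℝ) * ((d : ℝ) ^ (h + 1) * (p : ℝ) ^ i / (n : ℝ) ^ (i + 2)) := fun b => by
    rw [div_pow, pow_mul (Real.sqrt n), Real.sq_sqrt hn0.le, ← mul_div_assoc]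
    refine div_le_div_of_nonneg_right ?_ (by positivity)
    calc ((B b).card : ℝ) ^ (2 * (i + 2)) =
          (B b).card * (((B b).card : ℝ) ^ (i + 3) * ((B b).card : ℝ) ^ i) := by ring
      _ ≤ (B b).card * ((d : ℝ) ^ (h + 1) * (p : ℝ) ^ i) := by
          have h1 : ((B b).card : ℝ) ^ (i + 3) ≤ (d : ℝ) ^ (h + 1) :=
            (pow_le_pow_left₀ (by positivity) (cardd b) _).trans
              (pow_le_pow_right₀ hd1 (by omega))
          have h2 := pow_le_pow_left₀ (by positivity) (cardp b) i
          exact mul_le_mul_of_nonneg_left (mul_le_mul h1 h2 (by positivity) (by positivity))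
            (by positivity)
  have hpi : (p : ℝ) ^ i ≤ (θ * n) ^ i := pow_le_pow_left₀ (by positivity) hp i
  have hKθ : K * θ ^ (i + 1) ≤ Q ^ (i + 2) := by
    calc K * θ ^ (i + 1) ≤ K ^ (i + 2) * θ ^ (i + 2) :=
          mul_le_mul (le_self_pow₀ hK (by omega)) (pow_le_pow_right₀ hθ (by omega))
            (by positivity) (by positivity)
      _ = (K * θ) ^ (i + 2) := by rw [mul_pow]
      _ ≤ Q ^ (i + 2) := pow_le_pow_left₀ (by positivity) hQ _
  have step : ∑ b, K * (((B b).card : ℝ) / Real.sqrt n) ^ (2 * (i + 2)) ≤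
      Q ^ (i + 2) * (1 + (d : ℝ) ^ (h + 1) / n) := by
    calc ∑ b, K * (((B b).card : ℝ) / Real.sqrt n) ^ (2 * (i + 2))
        ≤ ∑ b, K * (((B b).card : ℝ) *
            ((d : ℝ) ^ (h + 1) * (p : ℝ) ^ i / (n : ℝ) ^ (i + 2))) :=
          Finset.sum_le_sum fun b _ => mul_le_mul_of_nonneg_left (cardpow b) (by linarith)
      _ = K * ((d : ℝ) ^ (h + 1) * (p : ℝ) ^ i / (n : ℝ) ^ (i + 2)) * ∑ b, ((B b).card : ℝ) := by
          rw [Finset.mul_sum]; exact Finset.sum_congr rfl fun b _ => by ring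
      _ ≤ K * ((d : ℝ) ^ (h + 1) * (θ * n) ^ i / (n : ℝ) ^ (i + 2)) * (θ * n) := by
          gcongr
      _ = (K * θ ^ (i + 1)) * ((d : ℝ) ^ (h + 1) / n) := by field_simp; ring
      _ ≤ Q ^ (i + 2) * (1 + (d : ℝ) ^ (h + 1) / n) :=
          mul_le_mul hKθ (by linarith) (by positivity) ((by positivity : (0:ℝ) ≤ K * θ ^ (i + 1)).trans hKθ)
  rw [← Finset.mul_sum, mul_assoc]
  exact mul_le_mul_of_nonneg_left step (by positivity)

/-- Even moments of a linear functional of a row whose blocks follow either of two row laws. -/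
theorem integral_hybrid_pow_le [IsProbabilityMeasure μ] [IsProbabilityMeasure ν]
    (hμ : RowLaw B Sig n r K μ) (hν : RowLaw B Sig n r K ν) (hK : 1 ≤ K)
    (hB : ∀ a b, a ≠ b → Disjoint (B a) (B b)) {d h : ℕ} (hd : 1 ≤ d) (hBd : ∀ a, (B a).card ≤ d)
    (hr : 2 * h ≤ r) (hr2 : 2 ≤ r) (hn : 0 < n) {θ : ℝ} (hθ : 1 ≤ θ) (hp : (p : ℝ) ≤ θ * n)
    {M L : ℝ} (hM : 0 ≤ M) (hL : 0 ≤ L)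
    (hSig : ∀ v : Fin p → ℝ, ∑ i, ∑ j, Sig i j * (v i * v j) ≤ M * ∑ i, v i ^ 2)
    {u : Fin p → ℝ} (hu : ‖u‖ ≤ L)
    (m : Fin k → Measure (Fin p → ℝ))
    (hm : ∀ a, m a = μ.map (blockPart (B a)) ∨ m a = ν.map (blockPart (B a)))
    (t : Finset (Fin k)) :
    Integrable (fun x => ((∑ b ∈ t, x b) ⬝ᵥ u) ^ (2 * h)) (Measure.pi m) ∧
    ∫ x, ((∑ b ∈ t, x b) ⬝ᵥ u) ^ (2 * h) ∂Measure.pi m ≤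
      sumMomentConst h * (L ^ 2 * ((1 + M) * K * θ)) ^ h * (1 + (d : ℝ) ^ (h + 1) / n) := by
  have hprob : ∀ a, IsProbabilityMeasure (m a) := fun a => by
    rcases hm a with h | h <;> rw [h] <;>
      exact Measure.isProbabilityMeasure_map (measurable_blockPart _).aemeasurable
  have hn0 : (0 : ℝ) < n := by exact_mod_cast hn
  have hmeasdot : Measurable (fun y : Fin p → ℝ => y ⬝ᵥ u) := by
    unfold dotProduct; fun_prop
  -- a uniform description of the marginals
  have hmarg : ∀ a, ∃ ρ : Measure (Fin p → ℝ), IsProbabilityMeasure ρ ∧ RowLaw B Sig n r K ρ ∧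
      m a = ρ.map (blockPart (B a)) := fun a => by
    rcases hm a with h | h
    · exact ⟨μ, inferInstance, hμ, h⟩
    · exact ⟨ν, inferInstance, hν, h⟩
  choose ρ hρp hρ hmρ using hmarg
  set Z : Fin k → (Fin k → Fin p → ℝ) → ℝ := fun b x => x b ⬝ᵥ u with hZ
  have hZm : ∀ b, Measurable (Z b) := fun b => hmeasdot.comp (measurable_pi_apply b)
  have hind : iIndepFun Z (Measure.pi m) :=
    iIndepFun_pi (X := fun _ y => y ⬝ᵥ u) fun b => hmeasdot.aemeasurable
  have hint : ∀ b (f : ℝ → ℝ), Measurable f →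
      ∫ x, f (Z b x) ∂Measure.pi m = ∫ x, f (blockPart (B b) x ⬝ᵥ u) ∂ρ b := by
    intro b f hf
    have h1 := (measurePreserving_eval m b).map_eq
    have h2 : ∫ x, f (Z b x) ∂Measure.pi m = ∫ y, f (y ⬝ᵥ u) ∂m b := by
      rw [← h1, integral_map (measurable_pi_apply b).aemeasurable
        (hf.comp hmeasdot).aestronglyMeasurable]
    rw [h2, hmρ b]
    exact integral_map (measurable_blockPart _).aemeasurable
      (hf.comp hmeasdot).aestronglyMeasurable
  have hLp : ∀ b, MemLp (Z b) (r : ℝ≥0∞) (Measure.pi m) := fun b => by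
    have h1 : MemLp (fun y : Fin p → ℝ => y ⬝ᵥ u) (r : ℝ≥0∞) (m b) := by
      rw [hmρ b, memLp_map_measure_iff hmeasdot.aestronglyMeasurable
        (measurable_blockPart _).aemeasurable]
      exact (hρ b).memLp_blockPart_dotProduct (B b) u
    exact h1.comp_measurePreserving (measurePreserving_eval m b)
  have hmean : ∀ b, ∫ x, Z b x ∂Measure.pi m = 0 := fun b => by
    rw [hint b (fun x => x) measurable_id]
    exact (hρ b).integral_blockPart_dotProduct (by omega) _ _
  have sumcard : ∑ b, ((B b).card : ℝ) ≤ θ * n := by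
    have : ((∑ b, (B b).card : ℕ) : ℝ) ≤ p := by exact_mod_cast sum_card_le hB
    push_cast at this; linarith
  set Q : ℝ := (1 + M) * K * θ with hQ
  have hQ0 : 0 ≤ Q := by positivity
  set W : ℝ := 1 + (d : ℝ) ^ (h + 1) / n with hW
  have hW1 : 1 ≤ W := by rw [hW]; have : 0 ≤ (d : ℝ) ^ (h + 1) / n := by positivity
                         linarith
  -- `Q` dominates both `M θ`, needed for the variances, and `K θ`, needed for the higher moments.
  set a := L * Real.sqrt Q with ha
  have ha2 : ∀ j, a ^ (2 * j) = (L ^ 2 * Q) ^ j := fun j => by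
    rw [pow_mul, ha, mul_pow, Real.sq_sqrt hQ0]
  have h2 : ∑ b, ∫ x, Z b x ^ 2 ∂Measure.pi m ≤ a ^ 2 := by
    calc ∑ b, ∫ x, Z b x ^ 2 ∂Measure.pi m ≤ ∑ b, M * L ^ 2 * ((B b).card / n) := by
          refine Finset.sum_le_sum fun b _ => ?_
          rw [hint b (fun x => x ^ 2) (by fun_prop)]
          exact (hρ b).integral_blockPart_dotProduct_sq_le hr2 hM hSig _ hu
      _ = M * L ^ 2 * ((∑ b, ((B b).card : ℝ)) / n) := by rw [← Finset.mul_sum, Finset.sum_div]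
      _ ≤ M * L ^ 2 * θ := by
          gcongr; rw [div_le_iff₀ hn0]; exact sumcard
      _ ≤ (L ^ 2 * Q) ^ 1 := by
          rw [pow_one, hQ]
          have : M ≤ (1 + M) * K := by nlinarith
          calc M * L ^ 2 * θ ≤ ((1 + M) * K) * L ^ 2 * θ := by gcongr
            _ = _ := by ring
      _ = a ^ 2 := by rw [← ha2]
  have hh : ∀ j, 1 ≤ j → j ≤ h → ∑ b, ∫ x, Z b x ^ (2 * j) ∂Measure.pi m ≤ a ^ (2 * j) * W := by
    intro j hj1 hjh
    rcases Nat.lt_or_ge j 2 with hj2 | hj2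
    -- Order two goes through the covariance bound; the block-size count used for higher orders
    -- would lose a factor `d`.
    · have : j = 1 := by omega
      subst this
      simp only [mul_one]
      exact h2.trans (le_mul_of_one_le_right (by positivity) hW1)
    · obtain ⟨i, rfl⟩ := Nat.exists_eq_add_of_le' hj2
      have hQ' : K * θ ≤ Q := by
        rw [hQ]; have : K * θ ≤ (1 + M) * (K * θ) := le_mul_of_one_le_left (by positivity) (by linarith)
        linarith
      have term : ∀ b, ∫ x, Z b x ^ (2 * (i + 2)) ∂Measure.pi m ≤
          L ^ (2 * (i + 2)) * (K * (((B b).card : ℝ) / Real.sqrt n) ^ (2 * (i + 2))) := fun b => by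
        rw [hint b (fun x => x ^ (2 * (i + 2))) (by fun_prop)]
        have hb := (hρ b).integral_l1_pow_le hK (B b) (l := 2 * (i + 2)) (by omega)
        have hi := (hρ b).integrable_l1_pow (B b) (l := 2 * (i + 2)) (by omega)
        calc _ ≤ ∫ x, L ^ (2 * (i + 2)) * (∑ j ∈ B b, |x j|) ^ (2 * (i + 2)) ∂ρ b := by
              refine integral_mono (integrable_pow_of_memLp
                ((hρ b).memLp_blockPart_dotProduct (B b) u) (by omega)) (hi.const_mul _) fun x => ?_
              have := abs_blockPart_dotProduct_le (B b) x u hu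
              dsimp only
              rw [← (even_two_mul (i + 2)).pow_abs, ← mul_pow]
              gcongr
          _ ≤ _ := by rw [integral_const_mul]; gcongr
      refine (Finset.sum_le_sum fun b _ => term b).trans
        ((sum_card_pow_le hB hd hBd hn hθ hp hL hK hQ' hjh).trans_eq ?_)
      rw [ha2, mul_pow (L ^ 2), ← pow_mul]
  have e : ∀ x : Fin k → Fin p → ℝ, (∑ b ∈ t, x b) ⬝ᵥ u = ∑ b ∈ t, Z b x := fun x => by
    rw [hZ, sum_dotProduct]
  have hLp' : ∀ b, MemLp (Z b) ((2 * h : ℕ) : ℝ≥0∞) (Measure.pi m) := fun b =>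
    (hLp b).mono_exponent (by exact_mod_cast hr)
  simp only [e]
  refine ⟨integrable_pow_of_memLp (memLp_finsetSum t fun b _ => hLp' b) le_rfl, ?_⟩
  rw [← ha2]
  exact integral_sum_pow_le hind hZm hmean hLp' (by positivity) hW1 h2 hh le_rfl
    (Finset.subset_univ t)

end Hybrid

/-! ### Replacing one row, block by block -/

section RowSwap

variable {p k n r : ℕ} {q : Fin 4 → ℝ}

/-- Half of the even exponent `qBar`. -/
noncomputable def qHalf (q : Fin 4 → ℝ) : ℕ := ⌈q 0 * bigQ q / 2⌉₊

theorem qBar_eq (q : Fin 4 → ℝ) : qBar q = 2 * qHalf q := rfl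

/-- Factored in this way the rate shows its origin: the prefactor bounds the sum over blocks of
`(|B| / √n)³`, the first two terms of the bracket come from the rest of the row, and the last from
the moving block itself. -/
theorem sigmaRate_eq (n p d : ℕ) (q : Fin 4 → ℝ) (hn : 0 < n) :
    sigmaRate n p d q = p * (d : ℝ) ^ 2 / Real.sqrt n ^ 3 *
      (1 + (d : ℝ) ^ (qHalf q + 1) / n + (d / Real.sqrt n) ^ qBar q) := by
  have hn0 : (0 : ℝ) < n := by exact_mod_cast hn
  have hs : 0 < Real.sqrt n := Real.sqrt_pos.2 hn0
  have hrp : ∀ l : ℕ, (n : ℝ) ^ ((l : ℝ) / 2) = Real.sqrt n ^ l := fun l => by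
    rw [Real.sqrt_eq_rpow, ← Real.rpow_natCast, ← Real.rpow_mul hn0.le]; congr 1; ring
  have h5 : (n : ℝ) ^ ((5 : ℝ) / 2) = Real.sqrt n ^ 3 * n := by
    have := hrp 5
    push_cast at this
    rw [this]; nth_rw 3 [← Real.sq_sqrt hn0.le]; ring
  have h3 : (n : ℝ) ^ ((3 : ℝ) / 2) = Real.sqrt n ^ 3 := by
    have := hrp 3
    push_cast at this
    exact this
  have hm : (n : ℝ) ^ (((qBar q : ℝ) + 3) / 2) = Real.sqrt n ^ (qBar q + 3) := by
    have := hrp (qBar q + 3)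
    push_cast at this
    exact this
  have hd : (d : ℝ) ^ (3 + (qBar q : ℝ) / 2) = (d : ℝ) ^ (3 + qHalf q) := by
    rw [qBar_eq, ← Real.rpow_natCast]; push_cast; congr 1; ring
  unfold sigmaRate
  rw [h5, h3, hm, hd, div_pow]
  field_simp
  ring

theorem sigmaRate_pos {n p d : ℕ} (q : Fin 4 → ℝ) (hn : 0 < n) (hp : 0 < p) (hd : 0 < d) :
    0 < sigmaRate n p d q := by
  rw [sigmaRate_eq n p d q hn]
  have : (0 : ℝ) < n := by exact_mod_cast hn
  have : 0 < Real.sqrt n := Real.sqrt_pos.2 this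
  positivity

variable {N : Finset (Fin p → ℝ)}

theorem continuous_rowFun {c : (Fin p → ℝ) → ℝ} {φ ℓ : ℝ → ℝ} (hN : N.Nonempty)
    (hc : ∀ u ∈ N, 0 < c u) (hφ : Continuous φ) (hℓ : Continuous ℓ) (n s : ℝ) :
    Continuous (rowFun N c φ ℓ n s) := by
  unfold rowFun
  refine hφ.comp (continuous_const.mul (Continuous.log ?_ fun x => ?_))
  · unfold dotProduct; fun_prop
  · exact (Finset.sum_pos (fun u hu => mul_pos (hc u hu) (Real.exp_pos _)) hN).ne'

variable {B : Fin k → Finset (Fin p)} {Sig : Matrix (Fin p) (Fin p) ℝ} {K : ℝ}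
  {μ ν : Measure (Fin p → ℝ)} [IsProbabilityMeasure μ] [IsProbabilityMeasure ν]

theorem sum_erase_update (x : Fin k → Fin p → ℝ) (a : Fin k) (y : Fin p → ℝ) :
    ∑ b, Function.update x a y b = (∑ b ∈ Finset.univ.erase a, x b) + y := by
  rw [← Finset.sum_erase_add _ _ (Finset.mem_univ a), Function.update_self]
  congr 1
  exact Finset.sum_congr rfl fun b hb => by rw [Function.update_of_ne (Finset.ne_of_mem_erase hb)]

/-- The constant in the comparison of two row laws. -/
noncomputable def rowConst (q : Fin 4 → ℝ) (M K θ : ℝ) : ℝ :=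
  2 * K * (1 + sumMomentConst (qHalf q) * ((1 + M) * K * θ) ^ qHalf q)

/-- Cubes of block sizes sum to at most `p d²`, since two factors are at most `d` and the sizes add
up to at most `p`. As `L ≥ 1`, all powers of `L` are absorbed in `L ^ (qBar q + 3)`. -/
theorem sum_blocks_le {B : Fin k → Finset (Fin p)}
    (hB : ∀ a b, a ≠ b → Disjoint (B a) (B b)) {d : ℕ} (hBd : ∀ a, (B a).card ≤ d)
    (hn : 0 < n) {K θ M L T : ℝ} (hθ : 0 ≤ θ) (hK : 0 ≤ K) (hM : 0 ≤ M) (hL : 1 ≤ L)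
    (hT : 0 ≤ T) :
    ∑ a, 2 * (T * L ^ 3 * K * (((B a).card : ℝ) / Real.sqrt n) ^ 3 *
      (1 + sumMomentConst (qHalf q) * (L ^ 2 * ((1 + M) * K * θ)) ^ qHalf q *
        (1 + (d : ℝ) ^ (qHalf q + 1) / n) + (L * (d / Real.sqrt n)) ^ qBar q)) ≤
      rowConst q M K θ * T * L ^ (qBar q + 3) * sigmaRate n p d q := by
  have hn0 : (0 : ℝ) < n := by exact_mod_cast hn
  have hsn : 0 < Real.sqrt n := Real.sqrt_pos.2 hn0
  have sumcube : ∑ a, (((B a).card : ℝ) / Real.sqrt n) ^ 3 ≤ p * (d : ℝ) ^ 2 / Real.sqrt n ^ 3 := by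
    have h1 : ((∑ b, (B b).card : ℕ) : ℝ) ≤ p := by exact_mod_cast sum_card_le hB
    push_cast at h1
    calc ∑ a, (((B a).card : ℝ) / Real.sqrt n) ^ 3
        ≤ ∑ a, ((B a).card : ℝ) * ((d : ℝ) ^ 2 / Real.sqrt n ^ 3) := by
          refine Finset.sum_le_sum fun a _ => ?_
          have hcd : ((B a).card : ℝ) ≤ d := by exact_mod_cast hBd a
          rw [div_pow, ← mul_div_assoc, pow_succ' _ 2]
          gcongr
      _ = (∑ a, ((B a).card : ℝ)) * ((d : ℝ) ^ 2 / Real.sqrt n ^ 3) := by rw [Finset.sum_mul]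
      _ ≤ p * ((d : ℝ) ^ 2 / Real.sqrt n ^ 3) := by gcongr
      _ = _ := by ring
  have hx0 : 0 ≤ sumMomentConst (qHalf q) * ((1 + M) * K * θ) ^ qHalf q := by
    have := (sumMomentConst_pos (qHalf q)).le; positivity
  rw [sigmaRate_eq n p d q hn, rowConst]
  have hS : sumMomentConst (qHalf q) * (L ^ 2 * ((1 + M) * K * θ)) ^ qHalf q =
      L ^ qBar q * (sumMomentConst (qHalf q) * ((1 + M) * K * θ) ^ qHalf q) := by
    rw [mul_pow, ← pow_mul, ← qBar_eq]; ring
  rw [hS, mul_pow L]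
  generalize sumMomentConst (qHalf q) * ((1 + M) * K * θ) ^ qHalf q = x at hx0 ⊢
  have he0 : 0 ≤ (d : ℝ) ^ (qHalf q + 1) / n := by positivity
  have hg0 : 0 ≤ ((d : ℝ) / Real.sqrt n) ^ qBar q := by positivity
  generalize (d : ℝ) ^ (qHalf q + 1) / n = e at he0 ⊢
  generalize ((d : ℝ) / Real.sqrt n) ^ qBar q = g at hg0 ⊢
  have hl : (1 : ℝ) ≤ L ^ qBar q := one_le_pow₀ hL
  rw [pow_add]
  generalize L ^ qBar q = l at hl ⊢
  have hW : 1 + l * x * (1 + e) + l * g ≤ l * ((1 + x) * (1 + e + g)) := by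
    have : 1 + x * (1 + e) + g ≤ (1 + x) * (1 + e + g) := by nlinarith [mul_nonneg hx0 hg0]
    nlinarith [mul_le_mul_of_nonneg_left this (by linarith : (0 : ℝ) ≤ l)]
  have hW0 : 0 ≤ 1 + l * x * (1 + e) + l * g := by positivity
  have e1 : ∑ a, 2 * (T * L ^ 3 * K * (((B a).card : ℝ) / Real.sqrt n) ^ 3 *
      (1 + l * x * (1 + e) + l * g)) = 2 * T * L ^ 3 * K * (1 + l * x * (1 + e) + l * g) *
        ∑ a, (((B a).card : ℝ) / Real.sqrt n) ^ 3 := by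
    rw [Finset.mul_sum]; exact Finset.sum_congr rfl fun a _ => by ring
  rw [e1]
  have hL0 : 0 ≤ L := by linarith
  calc _ ≤ 2 * T * L ^ 3 * K * (l * ((1 + x) * (1 + e + g))) *
        (p * (d : ℝ) ^ 2 / Real.sqrt n ^ 3) := by
          refine mul_le_mul (mul_le_mul_of_nonneg_left hW (by positivity)) sumcube
            (Finset.sum_nonneg fun a _ => by positivity) ?_
          exact mul_nonneg (by positivity) (hW0.trans hW)
    _ = _ := by ring

/-- Replacing one row of the design. -/
theorem abs_integral_rowFun_sub_le (hq : ∀ k, 0 ≤ q k)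
    (hμ : RowLaw B Sig n r K μ) (hν : RowLaw B Sig n r K ν) (hK : 1 ≤ K)
    (hB : ∀ a b, a ≠ b → Disjoint (B a) (B b)) {d : ℕ} (hd : 1 ≤ d) (hBd : ∀ a, (B a).card ≤ d)
    (hr : qBar q + 3 ≤ r) (hn : 0 < n) {θ : ℝ} (hθ : 1 ≤ θ) (hp : (p : ℝ) ≤ θ * n)
    {M L : ℝ} (hM : 0 ≤ M) (hL : 1 ≤ L)
    (hSig : ∀ v : Fin p → ℝ, ∑ i, ∑ j, Sig i j * (v i * v j) ≤ M * ∑ i, v i ^ 2)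
    {ℓ φ : ℝ → ℝ} {D Λ κ s : ℝ}
    (hℓ : SmoothLoss q D Λ ℓ) (hφ : SmoothTest κ φ) (hD : 1 ≤ D) (hΛ : 1 ≤ Λ) (hs : 0 < s)
    (hN : N.Nonempty) (hNL : ∀ u ∈ N, ‖u‖ ≤ L) {c : (Fin p → ℝ) → ℝ} (hc : ∀ u ∈ N, 0 < c u) :
    |∫ x, rowFun N c φ ℓ n s x ∂μ - ∫ x, rowFun N c φ ℓ n s x ∂ν| ≤
      rowConst q M K θ * taylorConst q n s D Λ κ * L ^ (qBar q + 3) * sigmaRate n p d q := by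
  have hn0 : (0 : ℝ) < n := by exact_mod_cast hn
  have hn1 : (1 : ℝ) ≤ n := by exact_mod_cast hn
  have hL0 : 0 ≤ L := by linarith
  have hsn : 0 < Real.sqrt n := Real.sqrt_pos.2 hn0
  have hκ : 0 ≤ κ := (abs_nonneg _).trans (hφ.deriv_le 1 (by simp) 0)
  set Ψ := rowFun N c φ ℓ n s with hΨ
  have hΨc : Continuous Ψ :=
    continuous_rowFun hN hc hφ.contDiff.continuous hℓ.contDiff.continuous n s
  have hΨb : ∀ x, |Ψ x| ≤ 1 := fun x => by
    have := hφ.mem_Icc (-(1 / (n * s)) * Real.log (∑ u ∈ N, c u * Real.exp (-s * ℓ (x ⬝ᵥ u))))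
    exact abs_le.2 ⟨by have := this.1; unfold Ψ rowFun; linarith, this.2⟩
  set T := taylorConst q n s D Λ κ with hT
  have hT0 : 0 ≤ T := by
    rw [hT]; unfold taylorConst
    have : 0 ≤ Λ := by linarith
    positivity
  have hc0 : ∀ u ∈ N, 0 ≤ c u := fun u hu => (hc u hu).le
  have hcs : 0 < ∑ u ∈ N, c u := Finset.sum_pos hc hN
  set h := qHalf q with hh
  have hm2 : qBar q = 2 * h := rfl
  set S : ℝ := sumMomentConst h * (L ^ 2 * ((1 + M) * K * θ)) ^ h * (1 + (d : ℝ) ^ (h + 1) / n)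
    with hS
  set f : (Fin k → Fin p → ℝ) → ℝ := fun x => Ψ (∑ a, x a) with hf
  have hfm : Measurable f := hΨc.measurable.comp (Finset.measurable_sum _ fun a _ =>
    measurable_pi_apply a)
  have hpr : ∀ (ρ : Measure (Fin p → ℝ)) [IsProbabilityMeasure ρ] (a : Fin k),
      IsProbabilityMeasure (ρ.map (blockPart (B a))) := fun ρ _ a =>
    Measure.isProbabilityMeasure_map (measurable_blockPart _).aemeasurable
  have hpμ := hpr μ
  have hpν := hpr ν
  -- A row is the sum of its independent blocks, so its law becomes a product measure on which the
  -- telescoping can act.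
  have hlaw : ∀ ρ : Measure (Fin p → ℝ), RowLaw B Sig n r K ρ →
      ∫ x, Ψ x ∂ρ = ∫ x, f x ∂Measure.pi fun a => ρ.map (blockPart (B a)) := by
    intro ρ hρ
    conv_lhs => rw [← hρ.blocks]
    exact integral_map (Finset.measurable_sum _ fun a _ => measurable_pi_apply a).aemeasurable
      hΨc.aestronglyMeasurable
  set ε : Fin k → ℝ := fun a => 2 * (T * L ^ 3 * K * (((B a).card : ℝ) / Real.sqrt n) ^ 3 *
    (1 + S + (L * (d / Real.sqrt n)) ^ qBar q)) with hε
  have main : |∫ x, Ψ x ∂μ - ∫ x, Ψ x ∂ν| ≤ ∑ a, ε a := by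
    rw [hlaw μ hμ, hlaw ν hν]
    refine abs_integral_pi_sub_le _ _ hfm (c := 1) (fun x => hΨb _) fun a m hm => ?_
    set x0 : (Fin k → Fin p → ℝ) → Fin p → ℝ := fun x => ∑ b ∈ Finset.univ.erase a, x b with hx0
    set v : (Fin k → Fin p → ℝ) → ℝ := fun x => gibbsAvg N c (fun u => (x0 x ⬝ᵥ u) ^ qBar q)
      with hv
    have hv0 : ∀ x, 0 ≤ v x := fun x => gibbsAvg_nonneg hc0 fun u _ => by
      rw [hm2]; exact (even_two_mul h).pow_nonneg _
    have mom := fun u (hu : u ∈ N) => integral_hybrid_pow_le hμ hν hK hB hd hBd (h := h)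
      (by omega) (by omega) hn hθ hp hM hL0 hSig (hNL u hu) m hm (Finset.univ.erase a)
    have vint : Integrable v (Measure.pi m) := by
      rw [hv]; unfold gibbsAvg
      exact (integrable_finsetSum N fun u hu => (mom u hu).1.const_mul (c u)).div_const _
    have vle : ∫ x, v x ∂Measure.pi m ≤ S := by
      have : ∫ x, v x ∂Measure.pi m =
          gibbsAvg N c (fun u => ∫ x, (x0 x ⬝ᵥ u) ^ (2 * h) ∂Measure.pi m) := by
        rw [hv, hm2]; simp only [gibbsAvg]
        rw [integral_div, integral_finsetSum N fun u hu => (mom u hu).1.const_mul (c u)]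
        simp only [integral_const_mul, hx0]
      rw [this]
      exact gibbsAvg_le_of_le hc0 hcs fun u hu => (mom u hu).2
    have hmp : IsProbabilityMeasure (Measure.pi m) := by
      have : ∀ a, IsProbabilityMeasure (m a) := fun a => by
        rcases hm a with h | h <;> rw [h] <;> infer_instance
      infer_instance
    set Cc : ℝ := (T * L ^ 3 * K * (((B a).card : ℝ) / Real.sqrt n) ^ 3) with hCc
    have pt : ∀ x, ‖∫ y, f (Function.update x a y) ∂μ.map (blockPart (B a)) -
        ∫ y, f (Function.update x a y) ∂ν.map (blockPart (B a))‖ ≤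
        2 * (Cc * (1 + v x + (L * ((B a).card / Real.sqrt n)) ^ qBar q)) := by
      intro x
      have hfu : ∀ y, f (Function.update x a y) = Ψ (x0 x + y) := fun y => by
        rw [hf]; simp only; rw [sum_erase_update]
      simp only [hfu]
      have hgc : Continuous fun y => Ψ (x0 x + y) := hΨc.comp (by fun_prop)
      rw [integral_map (measurable_blockPart _).aemeasurable hgc.aestronglyMeasurable,
        integral_map (measurable_blockPart _).aemeasurable hgc.aestronglyMeasurable]
      -- The same expansion point and coefficients serve both laws, so the zeroth-order and
      -- quadratic contributions cancel in the difference below.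
      obtain ⟨α, A, hA⟩ := exists_rowFun_taylor hq hℓ hφ hD hΛ hL0 hn1 hs hN hNL hc (x0 x)
      have b1 := hμ.abs_integral_sub_quadratic_le hK (B a) hr (g := fun y => Ψ (x0 x + y))
        hgc.measurable (fun y => hΨb _) hT0 hL0 (hv0 x) hA
      have b2 := hν.abs_integral_sub_quadratic_le hK (B a) hr (g := fun y => Ψ (x0 x + y))
        hgc.measurable (fun y => hΨb _) hT0 hL0 (hv0 x) hA
      rw [Real.norm_eq_abs, abs_le]
      rw [abs_le] at b1 b2
      constructor <;> linarith [b1.1, b1.2, b2.1, b2.2]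
    have bi : Integrable (fun x => 2 * (Cc * (1 + v x + (L * ((B a).card / Real.sqrt n)) ^ qBar q)))
        (Measure.pi m) :=
      ((((integrable_const _).add vint).add (integrable_const _)).const_mul _).const_mul _
    have := norm_integral_le_of_norm_le bi (ae_of_all _ pt)
    rw [Real.norm_eq_abs] at this
    refine this.trans ?_
    rw [integral_const_mul, integral_const_mul, integral_add ((integrable_const 1).fun_add vint)
      (integrable_const _), integral_add (integrable_const _) vint]
    simp only [integral_const, probReal_univ, smul_eq_mul, one_mul]
    -- Only the power `qBar q` is weakened to `d`. The cube keeps the size of the block, which is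
    -- still to be summed.
    have hcd : ((B a).card : ℝ) ≤ d := by exact_mod_cast hBd a
    have hCc0 : 0 ≤ Cc := by positivity
    rw [hε]; dsimp only
    rw [← hCc]
    gcongr
  exact main.trans (sum_blocks_le hB hBd hn (by linarith) (by linarith) hM hL hT0)

end RowSwap

/-! ### The soft minimum of the risk and its Gaussian comparison -/

section Design

variable {p k n r : ℕ} {q : Fin 4 → ℝ} {N : Finset (Fin p → ℝ)}

/-- The soft minimum of the risk over `N` at inverse temperature `n s`. -/
noncomputable def softRisk (N : Finset (Fin p → ℝ)) (ℓ : Fin n → ℝ → ℝ) (R : (Fin p → ℝ) → ℝ)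
    (s : ℝ) (A : Matrix (Fin n) (Fin p) ℝ) : ℝ :=
  -(1 / (n * s)) * Real.log (∑ u ∈ N, Real.exp (-(n * s * risk ℓ R u A)))

/-- A sum of exponentials is at least any one of its terms. -/
theorem softRisk_le_risk {ℓ : Fin n → ℝ → ℝ} {R : (Fin p → ℝ) → ℝ} {s : ℝ} (hs : 0 < s)
    (hn : 0 < n) (A : Matrix (Fin n) (Fin p) ℝ) {u : Fin p → ℝ} (hu : u ∈ N) :
    softRisk N ℓ R s A ≤ risk ℓ R u A := by
  have hn0 : (0 : ℝ) < n := by exact_mod_cast hn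
  have h1 : Real.exp (-(n * s * risk ℓ R u A)) ≤ ∑ u ∈ N, Real.exp (-(n * s * risk ℓ R u A)) :=
    Finset.single_le_sum (f := fun u => Real.exp (-(n * s * risk ℓ R u A)))
      (fun u _ => (Real.exp_pos _).le) hu
  have h2 := Real.log_le_log (Real.exp_pos _) h1
  rw [Real.log_exp] at h2
  unfold softRisk
  rw [neg_mul, one_div, inv_mul_eq_div, neg_le, ← sub_nonneg]
  have : Real.log (∑ u ∈ N, Real.exp (-(n * s * risk ℓ R u A))) / (n * s) - -risk ℓ R u A =
    (Real.log (∑ u ∈ N, Real.exp (-(n * s * risk ℓ R u A))) - -(n * s * risk ℓ R u A)) / (n * s) := by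
    field_simp
  rw [this]
  exact div_nonneg (by linarith) (by positivity)

/-- A sum of exponentials is at most the number of terms times the largest; the logarithm of that
number is the entropy cost of softening the minimum. -/
theorem le_softRisk_of_forall_le {ℓ : Fin n → ℝ → ℝ} {R : (Fin p → ℝ) → ℝ} {s : ℝ} (hs : 0 < s)
    (hn : 0 < n) (A : Matrix (Fin n) (Fin p) ℝ) (hN : N.Nonempty) {b : ℝ}
    (hb : ∀ u ∈ N, b ≤ risk ℓ R u A) :
    b - Real.log N.card / (n * s) ≤ softRisk N ℓ R s A := by
  have hn0 : (0 : ℝ) < n := by exact_mod_cast hn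
  have hc : (0 : ℝ) < N.card := by exact_mod_cast hN.card_pos
  have h1 : ∑ u ∈ N, Real.exp (-(n * s * risk ℓ R u A)) ≤ N.card * Real.exp (-(n * s * b)) := by
    rw [← nsmul_eq_mul (N.card)]
    refine Finset.sum_le_card_nsmul _ _ _ fun u hu => Real.exp_le_exp.2 ?_
    have := hb u hu
    gcongr
  have h2 := Real.log_le_log (Finset.sum_pos (fun u _ => Real.exp_pos _) hN) h1
  rw [Real.log_mul hc.ne' (Real.exp_pos _).ne', Real.log_exp] at h2
  unfold softRisk
  rw [neg_mul, one_div, inv_mul_eq_div, ← sub_nonneg]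
  set l := Real.log (∑ u ∈ N, Real.exp (-(n * s * risk ℓ R u A)))
  have : -(l / (n * s)) - (b - Real.log N.card / (n * s)) =
      (Real.log N.card + -(n * s * b) - l) / (n * s) := by field_simp; ring
  rw [this]
  exact div_nonneg (by linarith) (by positivity)

/-- The factor `n` in the temperature cancels the `1 / n` in the risk. The other rows and the
regularizer form a positive weight free of row `i`, which puts the soft minimum in the shape of
`rowFun`. -/
theorem risk_update (ℓ : Fin n → ℝ → ℝ) (R : (Fin p → ℝ) → ℝ) (u : Fin p → ℝ)
    (A : Fin n → Fin p → ℝ) (i : Fin n) (y : Fin p → ℝ) (s : ℝ) :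
    Real.exp (-(n * s * risk ℓ R u (Matrix.of (Function.update A i y)))) =
      Real.exp (-(s * ∑ j ∈ Finset.univ.erase i, ℓ j (A j ⬝ᵥ u)) - n * s * R u) *
        Real.exp (-s * ℓ i (y ⬝ᵥ u)) := by
  have hn0 : (n : ℝ) ≠ 0 := by
    have : 0 < n := i.pos
    positivity
  rw [← Real.exp_add]
  congr 1
  unfold risk
  rw [← Finset.sum_erase_add _ _ (Finset.mem_univ i)]
  have e1 : ∀ j, (Matrix.of (Function.update A i y)).mulVec u j = Function.update A i y j ⬝ᵥ u :=
    fun j => rfl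
  have e2 : ∑ j ∈ Finset.univ.erase i, ℓ j ((Matrix.of (Function.update A i y)).mulVec u j) =
      ∑ j ∈ Finset.univ.erase i, ℓ j (A j ⬝ᵥ u) :=
    Finset.sum_congr rfl fun j hj => by
      rw [e1, Function.update_of_ne (Finset.ne_of_mem_erase hj)]
  rw [e2, e1, Function.update_self]
  field_simp
  ring

variable {B : Fin k → Finset (Fin p)} {Sig : Matrix (Fin p) (Fin p) ℝ} {K : ℝ}
  {μ ν : Measure (Fin p → ℝ)} [IsProbabilityMeasure μ] [IsProbabilityMeasure ν]

theorem continuous_softRisk (hN : N.Nonempty) {ℓ : Fin n → ℝ → ℝ} (hℓ : ∀ i, Continuous (ℓ i))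
    (R : (Fin p → ℝ) → ℝ) (s : ℝ) :
    Continuous fun A : Fin n → Fin p → ℝ => softRisk N ℓ R s (Matrix.of A) := by
  unfold softRisk risk
  refine continuous_const.mul (Continuous.log ?_ fun x => ?_)
  · have : ∀ i (u : Fin p → ℝ), Continuous fun A : Fin n → Fin p → ℝ =>
        ℓ i ((Matrix.of A).mulVec u i) := fun i u => by
      refine (hℓ i).comp ?_
      change Continuous fun A : Fin n → Fin p → ℝ => A i ⬝ᵥ u
      unfold dotProduct
      fun_prop
    fun_prop
  · exact LT.lt.ne' (Finset.sum_pos (fun u hu => Real.exp_pos _) hN)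

/-- Gaussian comparison for the soft minimum of the risk. -/
theorem abs_integral_softRisk_sub_le (hq : ∀ k, 0 ≤ q k)
    (hμ : RowLaw B Sig n r K μ) (hν : RowLaw B Sig n r K ν) (hK : 1 ≤ K)
    (hB : ∀ a b, a ≠ b → Disjoint (B a) (B b)) {d : ℕ} (hd : 1 ≤ d) (hBd : ∀ a, (B a).card ≤ d)
    (hr : qBar q + 3 ≤ r) (hn : 0 < n) {θ : ℝ} (hθ : 1 ≤ θ) (hp : (p : ℝ) ≤ θ * n)
    {M L : ℝ} (hM : 0 ≤ M) (hL : 1 ≤ L)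
    (hSig : ∀ v : Fin p → ℝ, ∑ i, ∑ j, Sig i j * (v i * v j) ≤ M * ∑ i, v i ^ 2)
    {ℓ : Fin n → ℝ → ℝ} {R : (Fin p → ℝ) → ℝ} {φ : ℝ → ℝ} {D κ s : ℝ} {Λ : Fin n → ℝ}
    (hℓ : ∀ i, SmoothLoss q D (Λ i) (ℓ i)) (hφ : SmoothTest κ φ) (hD : 1 ≤ D) (hΛ : ∀ i, 1 ≤ Λ i)
    (hs : 0 < s) (hN : N.Nonempty) (hNL : ∀ u ∈ N, ‖u‖ ≤ L) :
    |∫ A, φ (softRisk N ℓ R s (Matrix.of A)) ∂Measure.pi (fun _ : Fin n => μ) -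
      ∫ A, φ (softRisk N ℓ R s (Matrix.of A)) ∂Measure.pi (fun _ : Fin n => ν)| ≤
      48 * 6 ^ bigQ q * 2 ^ qBar q * rowConst q M K θ * κ * (1 + s) ^ 2 * D ^ 3 *
        (avgL q Λ * L ^ (qBar q + 3) * sigmaRate n p d q) := by
  have hfm : Continuous fun A : Fin n → Fin p → ℝ => φ (softRisk N ℓ R s (Matrix.of A)) :=
    hφ.contDiff.continuous.comp (continuous_softRisk hN (fun i => (hℓ i).contDiff.continuous) R s)
  refine (abs_integral_pi_sub_le (c := 1) (ε := fun i => rowConst q M K θ *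
    taylorConst q n s D (Λ i) κ * L ^ (qBar q + 3) * sigmaRate n p d q) _ _ hfm.measurable
    (fun A => ?_) (fun i m hm => ?_)).trans_eq ?_
  · have := hφ.mem_Icc (softRisk N ℓ R s (Matrix.of A))
    exact abs_le.2 ⟨by linarith [this.1], this.2⟩
  · have hmp : IsProbabilityMeasure (Measure.pi m) := by
      have : ∀ a, IsProbabilityMeasure (m a) := fun a => by
        rcases hm a with h | h <;> rw [h] <;> infer_instance
      infer_instance
    have pt : ∀ A : Fin n → Fin p → ℝ,
        ‖∫ y, φ (softRisk N ℓ R s (Matrix.of (Function.update A i y))) ∂μ -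
          ∫ y, φ (softRisk N ℓ R s (Matrix.of (Function.update A i y))) ∂ν‖ ≤
        rowConst q M K θ * taylorConst q n s D (Λ i) κ * L ^ (qBar q + 3) * sigmaRate n p d q := by
      intro A
      have e : ∀ y, φ (softRisk N ℓ R s (Matrix.of (Function.update A i y))) =
          rowFun N (fun u => Real.exp (-(s * ∑ j ∈ Finset.univ.erase i, ℓ j (A j ⬝ᵥ u)) -
            n * s * R u)) φ (ℓ i) n s y := fun y => by
        unfold softRisk rowFun
        simp only [risk_update]
      simp only [e]
      exact abs_integral_rowFun_sub_le hq hμ hν hK hB hd hBd hr hn hθ hp hM hL hSig (hℓ i) hφ hD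
        (hΛ i) hs hN hNL fun u _ => Real.exp_pos _
    have := norm_integral_le_of_norm_le (integrable_const _) (ae_of_all (Measure.pi m) pt)
    simpa using this
  -- The `1 / n` in the remainder constant turns the sum over rows into the average `avgL`.
  · unfold taylorConst avgL
    rw [Finset.mul_sum, Finset.sum_mul, Finset.sum_mul, Finset.mul_sum]
    exact Finset.sum_congr rfl fun i _ => by ring

end Design

/-! ### Nets of the cube and their entropy -/

section Net

variable {p : ℕ}

/-- A subset of the cube of side `2 L` has a `δ`-net of its own points with at most
`(2 L / δ + 1) ^ p` elements. -/
theorem exists_finset_net {L δ : ℝ} (hδ : 0 < δ) {T : Set (Fin p → ℝ)}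
    (hT : ∀ w ∈ T, ‖w‖ ≤ L) (hne : T.Nonempty) :
    ∃ N : Finset (Fin p → ℝ), N.Nonempty ∧ (∀ u ∈ N, u ∈ T) ∧
      (∀ w ∈ T, ∃ u ∈ N, ‖w - u‖ ≤ δ) ∧ (N.card : ℝ) ≤ (2 * L / δ + 1) ^ p := by
  classical
  obtain ⟨w₀, hw₀⟩ := hne
  have hL : 0 ≤ L := (norm_nonneg _).trans (hT w₀ hw₀)
  set cell : (Fin p → ℝ) → Fin p → ℕ := fun w j => ⌊(w j + L) / δ⌋₊ with hcell
  have hb : ∀ w ∈ T, ∀ j, -L ≤ w j ∧ w j ≤ L := fun w hw j =>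
    abs_le.1 ((norm_le_pi_norm w j).trans (hT w hw))
  set I : Finset (Fin p → ℕ) := Fintype.piFinset fun _ => Finset.range (⌊2 * L / δ⌋₊ + 1) with hI
  have hmem : ∀ w ∈ T, cell w ∈ I := fun w hw => by
    refine Fintype.mem_piFinset.2 fun j => Finset.mem_range.2 (Nat.lt_succ_of_le ?_)
    refine Nat.floor_le_floor ?_
    gcongr
    linarith [(hb w hw j).2]
  -- One point of `T` is chosen in each occupied cell, which keeps the net inside `T`; `w₀` is the
  -- value on empty cells.
  set rep : (Fin p → ℕ) → Fin p → ℝ := fun c => if h : ∃ w ∈ T, cell w = c then h.choose else w₀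
    with hrep
  have rep_mem : ∀ c, rep c ∈ T := fun c => by
    rw [hrep]; dsimp only
    split_ifs with h
    · exact h.choose_spec.1
    · exact hw₀
  have rep_cell : ∀ w ∈ T, cell (rep (cell w)) = cell w := fun w hw => by
    have h : ∃ w' ∈ T, cell w' = cell w := ⟨w, hw, rfl⟩
    rw [hrep]; simp only [h, ↓reduceDIte]
    exact h.choose_spec.2
  refine ⟨I.image rep, ⟨rep (cell w₀), Finset.mem_image_of_mem _ (hmem w₀ hw₀)⟩, ?_, ?_, ?_⟩
  · intro u hu
    obtain ⟨c, _, rfl⟩ := Finset.mem_image.1 hu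
    exact rep_mem c
  · intro w hw
    refine ⟨rep (cell w), Finset.mem_image_of_mem _ (hmem w hw), ?_⟩
    refine (pi_norm_le_iff_of_nonneg hδ.le).2 fun j => ?_
    have e : ⌊(rep (cell w) j + L) / δ⌋₊ = ⌊(w j + L) / δ⌋₊ := congrFun (rep_cell w hw) j
    have p1 : 0 ≤ (w j + L) / δ := div_nonneg (by linarith [(hb w hw j).1]) hδ.le
    have p2 : 0 ≤ (rep (cell w) j + L) / δ :=
      div_nonneg (by linarith [(hb _ (rep_mem (cell w)) j).1]) hδ.le
    have a1 := Nat.floor_le p1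
    have a2 := Nat.lt_floor_add_one ((w j + L) / δ)
    have b1 := Nat.floor_le p2
    have b2 := Nat.lt_floor_add_one ((rep (cell w) j + L) / δ)
    rw [e] at b1 b2
    have d1 : (w j + L) / δ - (rep (cell w) j + L) / δ = (w j - rep (cell w) j) / δ := by ring
    have c1 : (w j - rep (cell w) j) / δ < 1 := by rw [← d1]; linarith
    have c2 : -1 < (w j - rep (cell w) j) / δ := by rw [← d1]; linarith
    rw [div_lt_iff₀ hδ] at c1
    rw [lt_div_iff₀ hδ] at c2
    rw [Pi.sub_apply, Real.norm_eq_abs]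
    exact abs_le.2 ⟨by linarith, by linarith⟩
  · have h1 : (I.image rep).card ≤ (⌊2 * L / δ⌋₊ + 1) ^ p := by
      refine Finset.card_image_le.trans ?_
      rw [hI, Fintype.card_piFinset]
      simp
    have h2 : ((⌊2 * L / δ⌋₊ : ℕ) : ℝ) ≤ 2 * L / δ := Nat.floor_le (by positivity)
    calc ((I.image rep).card : ℝ) ≤ (((⌊2 * L / δ⌋₊ + 1) ^ p : ℕ) : ℝ) := by exact_mod_cast h1
      _ = ((⌊2 * L / δ⌋₊ : ℝ) + 1) ^ p := by push_cast; rfl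
      _ ≤ _ := by gcongr

theorem one_le_logPlus (x : ℝ) : 1 ≤ logPlus x := le_max_left _ _

theorem log_two_mul_add_one_le {x : ℝ} (hx : 0 < x) : Real.log (2 * x + 1) ≤ 3 * logPlus x := by
  have l3 : Real.log 3 ≤ 2 := by
    have := Real.log_le_sub_one_of_pos (by norm_num : (0 : ℝ) < 3); linarith
  have h1 := one_le_logPlus x
  rcases le_total x 1 with h | h
  · have := Real.log_le_log (by linarith) (by linarith : 2 * x + 1 ≤ 3)
    linarith
  · have h2 := Real.log_le_log (by linarith) (by linarith : 2 * x + 1 ≤ 3 * x)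
    rw [Real.log_mul (by norm_num) (by linarith)] at h2
    have h3 : Real.log x ≤ logPlus x := le_max_right _ _
    linarith

theorem log_card_net_le {N : Finset (Fin p → ℝ)} (hN : N.Nonempty) {L δ : ℝ} (hL : 0 < L)
    (hδ : 0 < δ) (h : (N.card : ℝ) ≤ (2 * L / δ + 1) ^ p) :
    Real.log N.card ≤ 3 * p * logPlus (L / δ) := by
  have h0 : (0 : ℝ) < N.card := by exact_mod_cast hN.card_pos
  have h1 := Real.log_le_log h0 h
  rw [Real.log_pow, mul_div_assoc] at h1
  have h2 := log_two_mul_add_one_le (div_pos hL hδ)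
  calc Real.log N.card ≤ p * (3 * logPlus (L / δ)) := h1.trans (by gcongr)
    _ = _ := by ring

end Net

/-! ### Smooth test functions -/

section Test

/-- Off `[0, 1]` the function is locally constant, and on this compact interval the derivatives are
continuous. -/
theorem exists_bound_iteratedDeriv_smoothTransition :
    ∃ C : ℝ, 1 ≤ C ∧ ∀ k ∈ Finset.Icc 1 3, ∀ x, |iteratedDeriv k Real.smoothTransition x| ≤ C := by
  have hc : ∀ k : ℕ, Continuous (iteratedDeriv k Real.smoothTransition) := fun k =>
    (Real.smoothTransition.contDiff (n := ⊤)).continuous_iteratedDeriv k (by exact_mod_cast le_top)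
  have hb : ∀ k : ℕ, ∃ C : ℝ, ∀ x ∈ Icc (0 : ℝ) 1, |iteratedDeriv k Real.smoothTransition x| ≤ C :=
    fun k => isCompact_Icc.exists_bound_of_continuousOn (hc k).continuousOn
  choose C hC using hb
  have hout : ∀ k, k ≠ 0 → ∀ x ∉ Icc (0 : ℝ) 1, iteratedDeriv k Real.smoothTransition x = 0 := by
    intro k hk x hx
    have : ∃ a : ℝ, Real.smoothTransition =ᶠ[nhds x] fun _ => a := by
      rcases lt_or_ge x 0 with h | h
      · exact ⟨0, Filter.eventually_of_mem (Iio_mem_nhds h) fun y hy =>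
          Real.smoothTransition.zero_of_nonpos (le_of_lt hy)⟩
      · have h1 : 1 < x := by
          by_contra h'
          exact hx ⟨h, by linarith⟩
        exact ⟨1, Filter.eventually_of_mem (Ioi_mem_nhds h1) fun y hy =>
          Real.smoothTransition.one_of_one_le (le_of_lt hy)⟩
    obtain ⟨a, ha⟩ := this
    rw [ha.iteratedDeriv_eq k, iteratedDeriv_const]
    simp [hk]
  refine ⟨max 1 (max (C 1) (max (C 2) (C 3))), le_max_left _ _, fun k hk x => ?_⟩
  by_cases hx : x ∈ Icc (0 : ℝ) 1
  · refine (hC k x hx).trans ?_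
    have h := Finset.mem_Icc.1 hk
    have : k = 1 ∨ k = 2 ∨ k = 3 := by omega
    rcases this with rfl | rfl | rfl <;> simp
  · rw [hout k (by have := (Finset.mem_Icc.1 hk).1; omega) x hx]
    simp

theorem smoothTest_smoothTransition {C a b κ : ℝ}
    (hC : ∀ k ∈ Finset.Icc 1 3, ∀ x, |iteratedDeriv k Real.smoothTransition x| ≤ C)
    (hκ : ∀ k ∈ Finset.Icc 1 3, |b| ^ k * C ≤ κ) :
    SmoothTest κ (fun x => Real.smoothTransition (b * (x - a))) where
  mem_Icc x := ⟨Real.smoothTransition.nonneg _, Real.smoothTransition.le_one _⟩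
  contDiff := (Real.smoothTransition.contDiff (n := 3)).comp (by fun_prop)
  deriv_le k hk x := by
    have h1 : iteratedDeriv k (fun x => Real.smoothTransition (b * (x - a))) x =
        b ^ k * iteratedDeriv k Real.smoothTransition (b * (x - a)) := by
      have h2 := iteratedDeriv_comp_sub_const k (fun x => Real.smoothTransition (b * x)) a
      have h3 := iteratedDeriv_comp_const_mul (n := k) (f := Real.smoothTransition)
        (Real.smoothTransition.contDiff (n := k)) b
      rw [h2, h3]
    rw [h1, abs_mul, abs_pow]
    refine le_trans ?_ (hκ k hk)
    gcongr
    exact hC k hk _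

end Test

/-! ### Lipschitz bound for the risk on the cube -/

section Lipschitz

variable {p n : ℕ} {q : Fin 4 → ℝ}

/-- The constant of the Lipschitz bound below. -/
noncomputable def lipConst (q : Fin 4 → ℝ) (n : ℕ) (D L : ℝ) : ℝ :=
  4 * 6 ^ q 1 * D * (L * Real.sqrt n) ^ (q 0 * q 1) * Real.sqrt n

/-- A bound for the Lipschitz constant of the risk on the cube of side `2 L`. -/
noncomputable def lipBound (q : Fin 4 → ℝ) (D L : ℝ) (Λ : Fin n → ℝ) (A : Fin n → Fin p → ℝ) : ℝ :=
  lipConst q n D L * ((1 / (n : ℝ)) *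
    ∑ i, Λ i ^ bigQ q * (1 + ((∑ j, |A i j|) / Real.sqrt n) ^ (qBar q + 1)))

theorem q1_le_bigQ (hq : ∀ k, 0 ≤ q k) : q 1 ≤ bigQ q := by
  have : 3 * q 1 ≤ bigQ q := le_max_left _ _
  linarith [hq 1]

theorem q0_mul_q1_le_qBar (hq : ∀ k, 0 ≤ q k) : q 0 * q 1 ≤ qBar q :=
  (mul_le_mul_of_nonneg_left (q1_le_bigQ hq) (hq 0)).trans (q0_mul_bigQ_le_qBar q)

/-- The scale `L √n` is pulled out with the exact real power `q 0 * q 1`, and only the normalized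
size `T` is raised to the integer exponent. This exponent of `n` is the one that `omegaRate`
compensates. -/
theorem SmoothLoss.abs_deriv_le (hq : ∀ k, 0 ≤ q k) {D Λ L : ℝ} {ℓ : ℝ → ℝ}
    (hℓ : SmoothLoss q D Λ ℓ) (hD : 1 ≤ D) (hΛ : 1 ≤ Λ) (hL : 1 ≤ L) (hn : 0 < n) {T x : ℝ}
    (hT : 0 ≤ T) (hx : |x| ≤ L * Real.sqrt n * T) :
    |iteratedDeriv 1 ℓ x| ≤ 2 * 6 ^ q 1 * D * (L * Real.sqrt n) ^ (q 0 * q 1) *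
      (Λ ^ bigQ q * (1 + T ^ qBar q)) := by
  have hn1 : (1 : ℝ) ≤ n := by exact_mod_cast hn
  have hs1 : 1 ≤ Real.sqrt n := Real.one_le_sqrt.2 hn1
  set Y := L * Real.sqrt n with hY
  have hY1 : 1 ≤ Y := by nlinarith
  have hYq : 1 ≤ Y ^ q 0 := Real.one_le_rpow hY1 (hq 0)
  have h1 : ℓ x ≤ Λ * (Y ^ q 0 * (5 + T ^ q 0)) := by
    refine (hℓ.growth x).trans ?_
    have : |x| ^ q 0 ≤ Y ^ q 0 * T ^ q 0 := by
      rw [← Real.mul_rpow (by linarith) hT]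
      exact Real.rpow_le_rpow (abs_nonneg _) hx (hq 0)
    gcongr
    nlinarith
  have h2 : ℓ x ^ q 1 ≤ Λ ^ q 1 * (Y ^ (q 0 * q 1) * (6 ^ q 1 * (1 + T ^ qBar q))) := by
    have hg := rpow_growth_le (x := T) (r := q 0) (a := q 1) (e := 5 + T ^ q 0) (m := qBar q)
      (Λ := 1) le_rfl (hq 1) (hq 0) (by positivity) (q0_mul_q1_le_qBar hq)
      (by rw [abs_of_nonneg hT, one_mul])
    rw [abs_of_nonneg hT, Real.one_rpow, mul_one] at hg
    calc ℓ x ^ q 1 ≤ (Λ * (Y ^ q 0 * (5 + T ^ q 0))) ^ q 1 :=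
          Real.rpow_le_rpow (hℓ.nonneg x) h1 (hq 1)
      _ = Λ ^ q 1 * (Y ^ (q 0 * q 1) * (5 + T ^ q 0) ^ q 1) := by
          rw [Real.mul_rpow (by linarith) (by positivity),
            Real.mul_rpow (by positivity) (by positivity), ← Real.rpow_mul (by linarith)]
      _ ≤ _ := by gcongr
  have h3 : Λ ^ q 1 ≤ Λ ^ bigQ q := Real.rpow_le_rpow_of_exponent_le hΛ (q1_le_bigQ hq)
  have a1 : 1 ≤ Λ ^ bigQ q := Real.one_le_rpow hΛ (bigQ_nonneg hq)
  have a2 : 1 ≤ Y ^ (q 0 * q 1) := Real.one_le_rpow hY1 (mul_nonneg (hq 0) (hq 1))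
  have a3 : (1 : ℝ) ≤ 6 ^ q 1 := Real.one_le_rpow (by norm_num) (hq 1)
  have a4 : 1 ≤ 1 + T ^ qBar q := by have : 0 ≤ T ^ qBar q := by positivity
                                     linarith
  set Z := Λ ^ bigQ q * (Y ^ (q 0 * q 1) * (6 ^ q 1 * (1 + T ^ qBar q))) with hZ
  have hZ1 : 1 ≤ Z := by
    have := one_le_mul_of_one_le_of_one_le a3 a4
    have := one_le_mul_of_one_le_of_one_le a2 this
    exact one_le_mul_of_one_le_of_one_le a1 this
  have h4 : ℓ x ^ q 1 ≤ Z := h2.trans (by rw [hZ]; gcongr)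
  calc |iteratedDeriv 1 ℓ x| ≤ D * (1 + ℓ x ^ q 1) := hℓ.deriv_le 1 (by decide) x
    _ ≤ D * (2 * Z) := by gcongr; linarith
    _ = _ := by rw [hZ]; ring

theorem abs_sub_le_regModulus {R : (Fin p → ℝ) → ℝ} (hR : ConvexOn ℝ univ R) {L δ : ℝ}
    {w w' : Fin p → ℝ} (hw : ‖w‖ ≤ L) (hw' : ‖w'‖ ≤ L) (h : ‖w - w'‖ ≤ δ) :
    |R w - R w'| ≤ regModulus R L δ := by
  have hc : Continuous R := hR.locallyLipschitz.continuous
  -- Convexity serves here for continuity: the set in `regModulus` must be bounded above for its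
  -- `sSup` to dominate its elements.
  obtain ⟨C, hC⟩ := (isCompact_closedBall (0 : Fin p → ℝ) L).exists_bound_of_continuousOn
    hc.continuousOn
  refine le_csSup ⟨C + C, ?_⟩ ⟨w, w', hw, hw', h, rfl⟩
  rintro x ⟨v, v', hv, hv', -, rfl⟩
  refine (abs_sub _ _).trans (add_le_add ?_ ?_)
  · exact hC v (by simpa using hv)
  · exact hC v' (by simpa using hv')

theorem regModulus_nonneg (R : (Fin p → ℝ) → ℝ) (L δ : ℝ) : 0 ≤ regModulus R L δ := by
  refine Real.sSup_nonneg ?_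
  rintro x ⟨v, v', -, -, -, rfl⟩
  exact abs_nonneg _

/-- The risk is Lipschitz on the cube up to the modulus of continuity of the regularizer. -/
theorem abs_risk_sub_le (hq : ∀ k, 0 ≤ q k) {D L δ : ℝ} {Λ : Fin n → ℝ} {ℓ : Fin n → ℝ → ℝ}
    {R : (Fin p → ℝ) → ℝ} (hR : ConvexOn ℝ univ R)
    (hℓ : ∀ i, SmoothLoss q D (Λ i) (ℓ i)) (hD : 1 ≤ D) (hΛ : ∀ i, 1 ≤ Λ i) (hL : 1 ≤ L)
    (hn : 0 < n) {w w' : Fin p → ℝ} (hw : ‖w‖ ≤ L) (hw' : ‖w'‖ ≤ L) (h : ‖w - w'‖ ≤ δ)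
    (A : Fin n → Fin p → ℝ) :
    |risk ℓ R w (Matrix.of A) - risk ℓ R w' (Matrix.of A)| ≤
      regModulus R L δ + δ * lipBound q D L Λ A := by
  have hn0 : (0 : ℝ) < n := by exact_mod_cast hn
  have hs : 0 < Real.sqrt n := Real.sqrt_pos.2 hn0
  have hδ : 0 ≤ δ := (norm_nonneg _).trans h
  have term : ∀ i, |ℓ i (A i ⬝ᵥ w) - ℓ i (A i ⬝ᵥ w')| ≤ δ * (lipConst q n D L *
      (Λ i ^ bigQ q * (1 + ((∑ j, |A i j|) / Real.sqrt n) ^ (qBar q + 1)))) := by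
    intro i
    set t := ∑ j, |A i j| with ht
    have ht0 : 0 ≤ t := Finset.sum_nonneg fun j _ => abs_nonneg _
    set T := t / Real.sqrt n with hT
    have hT0 : 0 ≤ T := by positivity
    have htT : t = Real.sqrt n * T := by rw [hT]; field_simp
    have hder : ∀ x ∈ Icc (-(L * Real.sqrt n * T)) (L * Real.sqrt n * T),
        HasDerivWithinAt (ℓ i) (iteratedDeriv 1 (ℓ i) x)
          (Icc (-(L * Real.sqrt n * T)) (L * Real.sqrt n * T)) x := fun x _ =>
      ((hasThreeDerivs_of_contDiff (hℓ i).contDiff).first x).hasDerivWithinAt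
    have hdot : ∀ v : Fin p → ℝ, ‖v‖ ≤ L →
        A i ⬝ᵥ v ∈ Icc (-(L * Real.sqrt n * T)) (L * Real.sqrt n * T) := fun v hv => by
      have := abs_dotProduct_le (A i) v hv
      rw [← ht, htT, ← mul_assoc] at this
      exact abs_le.1 this
    have mv := (convex_Icc (-(L * Real.sqrt n * T)) (L * Real.sqrt n * T)).norm_image_sub_le_of_norm_hasDerivWithin_le
      hder (fun x hx => (hℓ i).abs_deriv_le hq hD (hΛ i) hL hn hT0 (abs_le.2 hx))
      (hdot w' hw') (hdot w hw)
    rw [Real.norm_eq_abs, Real.norm_eq_abs, ← dotProduct_sub] at mv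
    have hdiff := abs_dotProduct_le (A i) (w - w') h
    rw [← ht, htT] at hdiff
    have hΛ0 : 0 ≤ Λ i := by linarith [hΛ i]
    -- The extra factor `T` comes from the length of the interval in the mean value inequality, and
    -- explains the exponent `qBar q + 1`.
    have hTT : T * (1 + T ^ qBar q) ≤ 2 * (1 + T ^ (qBar q + 1)) := by
      have h1 : 0 ≤ T ^ (qBar q + 1) := by positivity
      have e : T * (1 + T ^ qBar q) = T + T ^ (qBar q + 1) := by ring
      rw [e]
      rcases le_total T 1 with h | h
      · linarith
      · have := le_self_pow₀ h (by omega : qBar q + 1 ≠ 0)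
        linarith
    set P := 2 * 6 ^ q 1 * D * (L * Real.sqrt n) ^ (q 0 * q 1) with hP
    have hP0 : 0 ≤ P := by positivity
    calc _ ≤ P * (Λ i ^ bigQ q * (1 + T ^ qBar q)) * |A i ⬝ᵥ (w - w')| := mv
      _ ≤ P * (Λ i ^ bigQ q * (1 + T ^ qBar q)) * (δ * (Real.sqrt n * T)) := by gcongr
      _ = δ * (P * Real.sqrt n * (Λ i ^ bigQ q * (T * (1 + T ^ qBar q)))) := by ring
      _ ≤ δ * (P * Real.sqrt n * (Λ i ^ bigQ q * (2 * (1 + T ^ (qBar q + 1))))) := by gcongr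
      _ = _ := by rw [lipConst, hP]; ring
  have e : risk ℓ R w (Matrix.of A) - risk ℓ R w' (Matrix.of A) =
      (1 / (n : ℝ)) * ∑ i, (ℓ i (A i ⬝ᵥ w) - ℓ i (A i ⬝ᵥ w')) + (R w - R w') := by
    unfold risk
    rw [Finset.sum_sub_distrib]
    have : ∀ v i, (Matrix.of A).mulVec v i = A i ⬝ᵥ v := fun v i => rfl
    simp only [this]
    ring
  rw [e]
  refine (abs_add_le _ _).trans ?_
  rw [add_comm]
  refine add_le_add (abs_sub_le_regModulus hR hw hw' h) ?_
  rw [abs_mul, abs_of_pos (by positivity : 0 < 1 / (n : ℝ))]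
  calc _ ≤ 1 / (n : ℝ) * ∑ i, δ * (lipConst q n D L *
        (Λ i ^ bigQ q * (1 + ((∑ j, |A i j|) / Real.sqrt n) ^ (qBar q + 1)))) := by
        gcongr
        exact (Finset.abs_sum_le_sum_abs _ _).trans (Finset.sum_le_sum fun i _ => term i)
    _ = _ := by rw [← Finset.mul_sum, ← Finset.mul_sum, lipBound]; ring

end Lipschitz

/-! ### Quadratic forms and the largest eigenvalue -/

section Covariance

variable {p : ℕ}

/-- The spectrum of `M - Sig` is `M` minus that of `Sig`, hence nonnegative, and so `M - Sig` is
positive semidefinite. -/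
theorem quadratic_le_of_lambdaMax_le {Sig : Matrix (Fin p) (Fin p) ℝ} (hS : Sig.PosDef) {M : ℝ}
    (hM : lambdaMax Sig ≤ M) (v : Fin p → ℝ) :
    ∑ i, ∑ j, Sig i j * (v i * v j) ≤ M * ∑ i, v i ^ 2 := by
  have hH : (algebraMap ℝ (Matrix (Fin p) (Fin p) ℝ) M - Sig).IsHermitian := by
    refine Matrix.IsHermitian.sub ?_ hS.isHermitian
    rw [Algebra.algebraMap_eq_smul_one]
    unfold Matrix.IsHermitian
    simp
  have hpsd : (algebraMap ℝ (Matrix (Fin p) (Fin p) ℝ) M - Sig).PosSemidef := by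
    rw [hH.posSemidef_iff_eigenvalues_nonneg]
    intro i
    have h := hH.eigenvalues_mem_spectrum_real i
    rw [← spectrum.singleton_sub_eq] at h
    obtain ⟨_, rfl, x, hx, hxe⟩ := h
    have : x ≤ lambdaMax Sig := le_csSup Matrix.finite_real_spectrum.bddAbove hx
    rw [Pi.zero_apply, ← hxe]
    linarith
  have h := hpsd.dotProduct_mulVec_nonneg v
  rw [Matrix.sub_mulVec, dotProduct_sub, Algebra.algebraMap_eq_smul_one, Matrix.smul_mulVec,
    Matrix.one_mulVec, dotProduct_smul] at h
  have e1 : star v ⬝ᵥ v = ∑ i, v i ^ 2 := by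
    simp only [dotProduct, star_trivial]
    exact Finset.sum_congr rfl fun i _ => by ring
  have e2 : star v ⬝ᵥ Sig.mulVec v = ∑ i, ∑ j, Sig i j * (v i * v j) := by
    simp only [dotProduct, star_trivial, Matrix.mulVec, Finset.mul_sum]
    exact Finset.sum_congr rfl fun i _ => Finset.sum_congr rfl fun j _ => by ring
  rw [e1, e2, smul_eq_mul] at h
  linarith

theorem diag_le_of_quadratic_le {Sig : Matrix (Fin p) (Fin p) ℝ} {M : ℝ}
    (h : ∀ v : Fin p → ℝ, ∑ i, ∑ j, Sig i j * (v i * v j) ≤ M * ∑ i, v i ^ 2) (i : Fin p) :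
    Sig i i ≤ M := by
  have := h (Pi.single i 1)
  simpa [Pi.single_apply] using this

end Covariance

/-! ### The covariates and the Gaussian rows are row laws -/

section Laws

variable {p k n r : ℕ} {B : Fin k → Finset (Fin p)} {Sig : Matrix (Fin p) (Fin p) ℝ}
  {Ω : Type*} [MeasurableSpace Ω] {P : Measure Ω} [IsProbabilityMeasure P]

theorem sum_blockPart (hB : ∀ a b, a ≠ b → Disjoint (B a) (B b)) (hcov : ∀ j, ∃ a, j ∈ B a)
    (x : Fin p → ℝ) : ∑ a, blockPart (B a) x = x := by
  ext j
  obtain ⟨a, ha⟩ := hcov j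
  rw [Finset.sum_apply, Finset.sum_eq_single a]
  · simp [blockPart, ha]
  · intro b _ hb
    have : j ∉ B b := fun h => Finset.disjoint_left.1 (hB a b hb.symm) ha h
    simp [blockPart, this]
  · simp

/-- The law of a random vector with independent blocks is a row law. -/
theorem rowLaw_map {V : Ω → Fin p → ℝ} (hV : Measurable V) {K : ℝ}
    (hB : ∀ a b, a ≠ b → Disjoint (B a) (B b)) (hcov : ∀ j, ∃ a, j ∈ B a)
    (hind : iIndepFun (fun (a : Fin k) (ω : Ω) (j : B a) => V ω j) P)
    (hL : ∀ j, MemLp (fun ω => V ω j) (r : ℝ≥0∞) P) (hmean : ∀ j, ∫ ω, V ω j ∂P = 0)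
    (hc : ∀ i j, ∫ ω, V ω i * V ω j ∂P = Sig i j / n)
    (hm : ∀ j, ∀ l ≤ r, ∫ ω, |V ω j| ^ l ∂P ≤ K / Real.sqrt n ^ l) :
    RowLaw B Sig n r K (P.map V) where
  blocks := by
    have hi : iIndepFun (fun (a : Fin k) (ω : Ω) => blockPart (B a) (V ω)) P := by
      refine (hind.comp (fun a (y : B a → ℝ) (j : Fin p) => if h : j ∈ B a then y ⟨j, h⟩ else 0)
        fun a => ?_)
      refine measurable_pi_iff.2 fun j => ?_
      split_ifs <;> fun_prop
    have hbm : ∀ a, Measurable fun ω => blockPart (B a) (V ω) := fun a =>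
      (measurable_blockPart (B a)).comp hV
    have h1 := (iIndepFun_iff_map_fun_eq_pi_map fun a => (hbm a).aemeasurable).1 hi
    have h2 : ∀ a, (P.map V).map (blockPart (B a)) = P.map fun ω => blockPart (B a) (V ω) :=
      fun a => Measure.map_map (measurable_blockPart _) hV
    simp only [h2]
    rw [← h1, Measure.map_map (Finset.measurable_sum _ fun a _ => measurable_pi_apply a)
      (measurable_pi_iff.2 hbm)]
    congr 1
    ext1 ω
    exact sum_blockPart hB hcov (V ω)
  memLp j := by
    rw [memLp_map_measure_iff (measurable_pi_apply j).aestronglyMeasurable hV.aemeasurable]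
    exact hL j
  mean j := by
    rw [integral_map hV.aemeasurable (measurable_pi_apply j).aestronglyMeasurable]; exact hmean j
  cov i j := by
    rw [integral_map hV.aemeasurable (by fun_prop)]; exact hc i j
  moment j l hl := by
    have hmeas : Measurable fun x : Fin p → ℝ => |x j| ^ l := by fun_prop
    rw [integral_map hV.aemeasurable hmeas.aestronglyMeasurable]; exact hm j l hl

theorem integral_abs_pow_le_one_add {Z : Ω → ℝ} (hZ : MemLp Z (r : ℝ≥0∞) P) {l : ℕ} (hl : l ≤ r) :
    ∫ ω, |Z ω| ^ l ∂P ≤ 1 + ∫ ω, |Z ω| ^ r ∂P := by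
  have i1 := integrable_pow_of_memLp hZ.abs hl
  have i2 := integrable_pow_of_memLp hZ.abs (le_refl r)
  have := integral_mono i1 ((integrable_const (1 : ℝ)).fun_add i2) fun ω => by
    change |Z ω| ^ l ≤ 1 + |Z ω| ^ r
    rcases le_total |Z ω| 1 with h | h
    · have h1 := pow_le_one₀ (n := l) (abs_nonneg (Z ω)) h
      have : 0 ≤ |Z ω| ^ r := by positivity
      linarith
    · have := pow_le_pow_right₀ h hl
      linarith
  rw [integral_add (integrable_const _) i2] at this
  simpa using this

/-- With `h = qHalf q` this is `2h + 3 ≤ 2 ^ (h + 2)`. Thus the moment assumption covers order `qBar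
q + 3`, the highest one that the remainder needs. -/
theorem qBar_add_three_le_qStar (q : Fin 4 → ℝ) : qBar q + 3 ≤ qStar q := by
  unfold qStar
  rw [qBar_eq, show (2 * qHalf q + 4) / 2 = qHalf q + 2 by omega]
  have : ∀ h : ℕ, 2 * h + 3 ≤ 2 ^ (h + 2) := fun h => by
    induction h with
    | zero => norm_num
    | succ h ih => rw [show h + 1 + 2 = (h + 2) + 1 by ring, pow_succ]; omega
  exact this _

/-- The moment constant for the covariates. -/
noncomputable def covConst (q : Fin 4 → ℝ) (M : ℝ) : ℝ := 1 + |M| ^ qStar q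

theorem CovariateAssumption.rowLaw {q : Fin 4 → ℝ} {M : ℝ} {d : ℕ} {X : Fin n → Ω → Fin p → ℝ}
    (h : CovariateAssumption P X Sig q M d) (hn : 0 < n) (i : Fin n)
    (hB : ∀ a b, a ≠ b → Disjoint (B a) (B b)) (hcov : ∀ j, ∃ a, j ∈ B a)
    (hind : iIndepFun (fun (a : Fin k) (ω : Ω) (j : B a) => X i ω j) P) :
    RowLaw B Sig n (qStar q) (covConst q M) (P.map (X i)) := by
  have hn0 : (0 : ℝ) < n := by exact_mod_cast hn
  have hs : 0 < Real.sqrt n := Real.sqrt_pos.2 hn0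
  have hm := h.measurable i
  have hLs : ∀ j, MemLp (fun ω => Real.sqrt n * X i ω j) (qStar q : ℝ≥0∞) P := fun j =>
    ⟨by fun_prop, (h.moment_le i j).trans_lt ENNReal.ofReal_lt_top⟩
  have hq0 : qStar q ≠ 0 := by have := qBar_add_three_le_qStar q; omega
  refine rowLaw_map hm hB hcov hind (fun j => ?_) (h.mean i) (h.second_moment i) fun j l hl => ?_
  · have := (hLs j).const_mul (Real.sqrt n)⁻¹
    have e : (fun ω => (Real.sqrt n)⁻¹ * (Real.sqrt n * X i ω j)) = fun ω => X i ω j := by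
      ext ω; field_simp
    rwa [e] at this
  · have h1 := integral_abs_pow_le_one_add (hLs j) hl
    have h2 : ∫ ω, |Real.sqrt n * X i ω j| ^ qStar q ∂P ≤ |M| ^ qStar q := by
      have e := (hLs j).eLpNorm_eq_integral_rpow_norm (by exact_mod_cast hq0)
        (ENNReal.natCast_ne_top _)
      have hle := h.moment_le i j
      rw [e] at hle
      have hle' := hle.trans (ENNReal.ofReal_le_ofReal (le_abs_self M))
      rw [ENNReal.ofReal_le_ofReal_iff (abs_nonneg M)] at hle'
      simp only [ENNReal.toReal_natCast, Real.rpow_natCast, Real.norm_eq_abs] at hle'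
      set I := ∫ ω, |Real.sqrt n * X i ω j| ^ qStar q ∂P with hI
      have hI0 : 0 ≤ I := integral_nonneg fun ω => by positivity
      have := pow_le_pow_left₀ (by positivity) hle' (qStar q)
      rwa [Real.rpow_inv_natCast_pow hI0 hq0] at this
    have h3 : ∫ ω, |Real.sqrt n * X i ω j| ^ l ∂P =
        Real.sqrt n ^ l * ∫ ω, |X i ω j| ^ l ∂P := by
      rw [← integral_const_mul]
      congr 1; ext ω
      rw [abs_mul, abs_of_pos hs, mul_pow]
    rw [le_div_iff₀ (by positivity), mul_comm, ← h3, covConst]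
    linarith

/-- Coordinates in different blocks are uncorrelated. -/
theorem CovariateAssumption.sig_eq_zero {q : Fin 4 → ℝ} {M : ℝ} {d : ℕ}
    {X : Fin n → Ω → Fin p → ℝ} (h : CovariateAssumption P X Sig q M d) (hn : 0 < n) (i : Fin n)
    (hind : iIndepFun (fun (a : Fin k) (ω : Ω) (j : B a) => X i ω j) P) {a b : Fin k} (hab : a ≠ b)
    {j l : Fin p} (hj : j ∈ B a) (hl : l ∈ B b) : Sig j l = 0 := by
  have hn0 : (0 : ℝ) < n := by exact_mod_cast hn
  have hm := h.measurable i
  have hI : IndepFun (fun ω => X i ω j) (fun ω => X i ω l) P :=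
    (hind.indepFun hab).comp (φ := fun y : B a → ℝ => y ⟨j, hj⟩) (ψ := fun y : B b → ℝ => y ⟨l, hl⟩)
      (by fun_prop) (by fun_prop)
  have := hI.integral_fun_mul_eq_mul_integral (by fun_prop) (by fun_prop)
  rw [h.second_moment, h.mean, zero_mul] at this
  have := (div_eq_zero_iff.1 this).resolve_right hn0.ne'
  exact this

/-- The moment constant for the Gaussian rows. -/
noncomputable def gaussConst (r : ℕ) (M : ℝ) : ℝ :=
  (1 + Real.sqrt M) ^ r * (1 + ∫ y, |y| ^ r ∂gaussianReal 0 1)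

/-- Scaling to the standard Gaussian; the base `1 + √M` is at least one, so a single power `r`
serves all `l ≤ r`. -/
theorem integral_abs_pow_gaussianReal_le {v : NNReal} {M : ℝ} (hn : 0 < n)
    (hv : (v : ℝ) ≤ M / n) {l : ℕ} (hl : l ≤ r) :
    ∫ y, |y| ^ l ∂gaussianReal 0 v ≤ gaussConst r M / Real.sqrt n ^ l := by
  have hn0 : (0 : ℝ) < n := by exact_mod_cast hn
  have hs : 0 < Real.sqrt n := Real.sqrt_pos.2 hn0
  have hmap : (gaussianReal 0 1).map (fun x => Real.sqrt v * x) = gaussianReal 0 v := by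
    rw [gaussianReal_map_const_mul]
    congr 1
    · simp
    · rw [mul_one]; ext; simp
  rw [← hmap, integral_map (by fun_prop) (by fun_prop)]
  have e : ∫ y, |Real.sqrt v * y| ^ l ∂gaussianReal 0 1 =
      Real.sqrt v ^ l * ∫ y, |y| ^ l ∂gaussianReal 0 1 := by
    rw [← integral_const_mul]
    congr 1; ext y
    rw [abs_mul, abs_of_nonneg (Real.sqrt_nonneg _), mul_pow]
  rw [e]
  have hid : MemLp (fun y : ℝ => y) (r : ℝ≥0∞) (gaussianReal 0 1) := by
    simpa using! memLp_id_gaussianReal (μ := 0) (v := 1) r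
  have h1 := integral_abs_pow_le_one_add hid hl
  have h2 : Real.sqrt v ≤ (1 + Real.sqrt M) / Real.sqrt n := by
    calc Real.sqrt v ≤ Real.sqrt (M / n) := Real.sqrt_le_sqrt hv
      _ = Real.sqrt M / Real.sqrt n := Real.sqrt_div' _ hn0.le
      _ ≤ _ := by gcongr; linarith
  have h3 : (1 + Real.sqrt M) ^ l ≤ (1 + Real.sqrt M) ^ r :=
    pow_le_pow_right₀ (by linarith [Real.sqrt_nonneg M]) hl
  have h4 : 0 ≤ ∫ y, |y| ^ l ∂gaussianReal 0 1 := integral_nonneg fun y => by positivity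
  calc Real.sqrt v ^ l * ∫ y, |y| ^ l ∂gaussianReal 0 1
      ≤ ((1 + Real.sqrt M) / Real.sqrt n) ^ l * (1 + ∫ y, |y| ^ r ∂gaussianReal 0 1) := by gcongr
    _ = (1 + Real.sqrt M) ^ l * (1 + ∫ y, |y| ^ r ∂gaussianReal 0 1) / Real.sqrt n ^ l := by
        rw [div_pow]; ring
    _ ≤ (1 + Real.sqrt M) ^ r * (1 + ∫ y, |y| ^ r ∂gaussianReal 0 1) / Real.sqrt n ^ l := by
        gcongr

/-- Jointly Gaussian blocks are independent as soon as they are uncorrelated. The vanishing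
cross-block covariances therefore give the Gaussian row the same cells `B` as the covariates, which
makes a blockwise swap possible. -/
theorem IsGaussianDesign.rowLaw {G : Fin n → Ω → Fin p → ℝ} (h : IsGaussianDesign P G Sig)
    (hS : Sig.PosDef) (hn : 0 < n) {M : ℝ} (hM : ∀ j, Sig j j ≤ M) (i : Fin n)
    (hB : ∀ a b, a ≠ b → Disjoint (B a) (B b)) (hcov : ∀ j, ∃ a, j ∈ B a)
    (hzero : ∀ a b, a ≠ b → ∀ j ∈ B a, ∀ l ∈ B b, Sig j l = 0) :
    RowLaw B Sig n r (gaussConst r M) (P.map (G i)) := by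
  have hn0 : (0 : ℝ) < n := by exact_mod_cast hn
  have hm := h.measurable i
  set S : Matrix (Fin p) (Fin p) ℝ := (1 / (n : ℝ)) • Sig with hSdef
  have hSp : S.PosSemidef := hS.posSemidef.smul (by positivity)
  have hSa : ∀ j l, S j l = Sig j l / n := fun j l => by
    rw [hSdef, Matrix.smul_apply, smul_eq_mul]; ring
  set V : Ω → EuclideanSpace ℝ (Fin p) := fun ω => WithLp.toLp 2 (G i ω) with hV
  have hVm : Measurable V := (WithLp.measurable_toLp 2 _).comp hm
  have hlaw : P.map V = multivariateGaussian 0 S := h.law i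
  have hcoord : ∀ j, P.map (fun ω => G i ω j) = gaussianReal 0 (S j j).toNNReal := fun j => by
    have h1 := (measurePreserving_eval_multivariateGaussian (μ := 0) hSp (i := j)).map_eq
    rw [← hlaw, Measure.map_map (by fun_prop) hVm] at h1
    exact h1
  have hGauss : HasGaussianLaw V P := ⟨by rw [hlaw]; infer_instance⟩
  have hint : ∀ j (f : ℝ → ℝ), Measurable f →
      ∫ ω, f (G i ω j) ∂P = ∫ y, f y ∂gaussianReal 0 (S j j).toNNReal := fun j f hf => by
    rw [← hcoord j, integral_map (by fun_prop) hf.aestronglyMeasurable]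
  have hL : ∀ (r : ℕ) j, MemLp (fun ω => G i ω j) (r : ℝ≥0∞) P := fun r j => by
    have h1 : MemLp (fun y : ℝ => y) (r : ℝ≥0∞) (P.map fun ω => G i ω j) := by
      rw [hcoord j]
      simpa using! memLp_id_gaussianReal (μ := 0) (v := (S j j).toNNReal) r
    rw [memLp_map_measure_iff (by fun_prop) (by fun_prop)] at h1
    exact h1
  have hmean : ∀ j, ∫ ω, G i ω j ∂P = 0 := fun j => by
    rw [hint j (fun y => y) measurable_id, integral_id_gaussianReal]
  have hc : ∀ j l, cov[fun ω => G i ω j, fun ω => G i ω l; P] = S j l := fun j l => by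
    rw [← covariance_eval_multivariateGaussian (μ := 0) hSp j l, ← hlaw,
      covariance_map_fun (by fun_prop) (by fun_prop) hVm.aemeasurable]
  refine rowLaw_map hm hB hcov ?_ (hL r) hmean (fun j l => ?_) fun j l hl => ?_
  · refine HasGaussianLaw.iIndepFun_of_covariance_eval (X := fun a (j : B a) ω => G i ω j)
      ?_ fun a b hab j l => ?_
    · exact hGauss.map_fun (ContinuousLinearMap.pi fun a => ContinuousLinearMap.pi
        fun j : B a => (EuclideanSpace.proj (j : Fin p) : EuclideanSpace ℝ (Fin p) →L[ℝ] ℝ))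
    · rw [hc, hSa, hzero a b hab j j.2 l l.2, zero_div]
  · have h2 : ∀ j, MemLp (fun ω => G i ω j) 2 P := fun j => by exact_mod_cast hL 2 j
    have := covariance_eq_sub (h2 j) (h2 l)
    rw [hc, hmean, zero_mul, sub_zero, hSa] at this
    exact this.symm
  · rw [hint j (fun y => |y| ^ l) (by fun_prop)]
    refine integral_abs_pow_gaussianReal_le hn ?_ hl
    rw [hSa, Real.coe_toNNReal']
    refine max_le ?_ ?_
    · have := hM j
      gcongr
    · have h1 := hS.posSemidef.diag_nonneg (i := j)
      exact div_nonneg (h1.trans (hM j)) hn0.le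

end Laws

/-! ### Independent rows and the mean Lipschitz constant -/

section IidRows

variable {p k n r : ℕ} {q : Fin 4 → ℝ} {Ω : Type*} [MeasurableSpace Ω] {P : Measure Ω}
  [IsProbabilityMeasure P] {X : Fin n → Ω → Fin p → ℝ} {μ : Measure (Fin p → ℝ)}

/-- The rows `X i` are independent with common law `μ`. -/
structure IidRows (P : Measure Ω) (X : Fin n → Ω → Fin p → ℝ) (μ : Measure (Fin p → ℝ)) : Prop where
  measurable : ∀ i, Measurable (X i)
  indep : iIndepFun X P
  law : ∀ i, P.map (X i) = μ

theorem IidRows.integral_eq (h : IidRows P X μ) {f : (Fin n → Fin p → ℝ) → ℝ} (hf : Measurable f) :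
    ∫ ω, f (fun i => X i ω) ∂P = ∫ A, f A ∂Measure.pi fun _ : Fin n => μ := by
  have h1 := (iIndepFun_iff_map_fun_eq_pi_map fun i => (h.measurable i).aemeasurable).1 h.indep
  simp only [h.law] at h1
  rw [← h1, integral_map (measurable_pi_iff.2 h.measurable).aemeasurable hf.aestronglyMeasurable]

variable {B : Fin k → Finset (Fin p)} {Sig : Matrix (Fin p) (Fin p) ℝ} {K : ℝ}

theorem RowLaw.mono {K' : ℝ} (h : RowLaw B Sig n r K μ) (hK : K ≤ K') : RowLaw B Sig n r K' μ where
  blocks := h.blocks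
  memLp := h.memLp
  mean := h.mean
  cov := h.cov
  moment j l hl := (h.moment j l hl).trans (by gcongr)

/-- The `ℓ¹` norm of a row is of order `p / √n`; after division by `√n` its moments are bounded
through `p / n ≤ θ`. -/
theorem IidRows.integral_lipBound_le (h : IidRows P X μ) (hμ : RowLaw B Sig n r K μ)
    (hr : qBar q + 1 ≤ r) (hK : 1 ≤ K) (hn : 0 < n) {θ : ℝ} (hp : (p : ℝ) ≤ θ * n)
    {D L : ℝ} (hD : 0 ≤ D) (hL : 0 ≤ L) {Λ : Fin n → ℝ} (hΛ : ∀ i, 1 ≤ Λ i) :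
    Integrable (fun ω => lipBound q D L Λ fun i => X i ω) P ∧
      ∫ ω, lipBound q D L Λ (fun i => X i ω) ∂P ≤
        lipConst q n D L * ((1 + K * θ ^ (qBar q + 1)) * avgL q Λ) := by
  have hn0 : (0 : ℝ) < n := by exact_mod_cast hn
  have hs : 0 < Real.sqrt n := Real.sqrt_pos.2 hn0
  have hprob : IsProbabilityMeasure μ := by
    rw [← h.law ⟨0, hn⟩]
    exact Measure.isProbabilityMeasure_map (h.measurable _).aemeasurable
  have hfm : Measurable fun x : Fin p → ℝ => (∑ j, |x j|) ^ (qBar q + 1) := by fun_prop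
  have hi : ∀ i, Integrable (fun ω => (∑ j, |X i ω j|) ^ (qBar q + 1)) P := fun i => by
    have := hμ.integrable_l1_pow Finset.univ hr
    rw [← h.law i, integrable_map_measure hfm.aestronglyMeasurable
      (h.measurable i).aemeasurable] at this
    exact this
  have hle : ∀ i, ∫ ω, (∑ j, |X i ω j|) ^ (qBar q + 1) ∂P ≤
      K * (p / Real.sqrt n) ^ (qBar q + 1) := fun i => by
    have := hμ.integral_l1_pow_le hK Finset.univ hr
    rw [← h.law i, integral_map (h.measurable i).aemeasurable hfm.aestronglyMeasurable] at this
    simpa using this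
  have hi' : ∀ i, Integrable (fun ω => Λ i ^ bigQ q *
      (1 + ((∑ j, |X i ω j|) / Real.sqrt n) ^ (qBar q + 1))) P := fun i => by
    simp only [div_pow]
    exact ((integrable_const 1).add ((hi i).div_const _)).const_mul _
  have hc0 : 0 ≤ lipConst q n D L := by unfold lipConst; positivity
  unfold lipBound
  refine ⟨((integrable_finsetSum _ fun i _ => hi' i).const_mul _).const_mul _, ?_⟩
  rw [integral_const_mul, integral_const_mul, integral_finsetSum _ fun i _ => hi' i]
  refine mul_le_mul_of_nonneg_left ?_ hc0
  have term : ∀ i, ∫ ω, Λ i ^ bigQ q * (1 + ((∑ j, |X i ω j|) / Real.sqrt n) ^ (qBar q + 1)) ∂P ≤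
      Λ i ^ bigQ q * (1 + K * θ ^ (qBar q + 1)) := fun i => by
    have hΛ0 : 0 ≤ Λ i := by linarith [hΛ i]
    rw [integral_const_mul]
    gcongr
    simp only [div_pow]
    rw [integral_add (integrable_const _) ((hi i).div_const _), integral_div]
    have h1 : (∫ ω, (∑ j, |X i ω j|) ^ (qBar q + 1) ∂P) / Real.sqrt n ^ (qBar q + 1) ≤
        K * θ ^ (qBar q + 1) := by
      calc _ ≤ K * (p / Real.sqrt n) ^ (qBar q + 1) / Real.sqrt n ^ (qBar q + 1) := by
            gcongr; exact hle i
        _ = K * (p / n) ^ (qBar q + 1) := by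
            rw [mul_div_assoc, ← div_pow, div_div, Real.mul_self_sqrt hn0.le]
        _ ≤ K * θ ^ (qBar q + 1) := by
            gcongr
            rwa [div_le_iff₀ hn0]
    simpa using h1
  calc _ ≤ 1 / (n : ℝ) * ∑ i, Λ i ^ bigQ q * (1 + K * θ ^ (qBar q + 1)) := by
        gcongr with i
        exact term i
    _ = _ := by rw [← Finset.sum_mul, avgL]; ring

/-- The exponent in `omegaRate` cancels the powers of `n` in the Lipschitz constant: `ω_n √n ^ (q 0
* q 1 + 1) = σ_n / n`. -/
theorem mul_lipConst_le (hq : ∀ k, 0 ≤ q k) (hn : 0 < n) {d : ℕ} {D L δ : ℝ} (hD : 0 ≤ D)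
    (hL : 1 ≤ L) (hσ : 0 ≤ sigmaRate n p d q) (hδ : δ < omegaRate n p d q) :
    δ * lipConst q n D L ≤ 4 * 6 ^ q 1 * D * (L ^ (qBar q + 3) * sigmaRate n p d q) := by
  have hn0 : (0 : ℝ) < n := by exact_mod_cast hn
  have hn1 : (1 : ℝ) ≤ n := by exact_mod_cast hn
  have hL0 : 0 < L := by linarith
  have hs : 0 < Real.sqrt n := Real.sqrt_pos.2 hn0
  set a := q 0 * q 1 with ha
  have ha0 : 0 ≤ a := mul_nonneg (hq 0) (hq 1)
  have e1 : omegaRate n p d q * (Real.sqrt n ^ a * Real.sqrt n) = sigmaRate n p d q / n := by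
    unfold omegaRate
    have : Real.sqrt n ^ a * Real.sqrt n = (n : ℝ) ^ ((a + 1) / 2) := by
      rw [← Real.rpow_add_one hs.ne', Real.sqrt_eq_rpow, ← Real.rpow_mul hn0.le]
      congr 1; ring
    rw [this, mul_right_comm, ← Real.rpow_add hn0, ← ha,
      show -(a + 3) / 2 + (a + 1) / 2 = -1 by ring, Real.rpow_neg_one]
    field_simp
  have e2 : L ^ a ≤ L ^ (qBar q + 3) := by
    rw [← Real.rpow_natCast]
    refine Real.rpow_le_rpow_of_exponent_le hL ?_
    have := q0_mul_q1_le_qBar hq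
    push_cast; linarith
  have h6 : (0 : ℝ) ≤ 6 ^ q 1 := by positivity
  calc δ * lipConst q n D L
      ≤ omegaRate n p d q * lipConst q n D L := by
        gcongr
        unfold lipConst; positivity
    _ = 4 * 6 ^ q 1 * D * (L ^ a * (omegaRate n p d q * (Real.sqrt n ^ a * Real.sqrt n))) := by
        unfold lipConst
        rw [Real.mul_rpow hL0.le hs.le, ← ha]; ring
    _ = 4 * 6 ^ q 1 * D * (L ^ a * (sigmaRate n p d q / n)) := by rw [e1]
    _ ≤ _ := by
        gcongr
        exact div_le_self hσ hn1

end IidRows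

/-! ### Probabilities against integrals of test functions -/

section Integral

variable {Ω : Type*} [MeasurableSpace Ω] {P : Measure Ω} [IsProbabilityMeasure P]

theorem measureReal_eq_one_le_integral {f : Ω → ℝ} (hf : Measurable f)
    (hb : ∀ ω, f ω ∈ Icc (0 : ℝ) 1) : P.real {ω | f ω = 1} ≤ ∫ ω, f ω ∂P := by
  have hi : Integrable f P := Integrable.of_bound hf.aestronglyMeasurable 1
    (ae_of_all _ fun ω => abs_le.2 ⟨by linarith [(hb ω).1], (hb ω).2⟩)
  have h := mul_meas_ge_le_integral_of_nonneg (ae_of_all P fun ω => (hb ω).1) hi 1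
  rw [one_mul] at h
  exact (measureReal_mono fun ω (hω : f ω = 1) => hω.ge).trans h

/-- The event `E` need not be measurable, so it is replaced by its measurable hull, which has the
same measure. -/
theorem integral_le_measureReal {f : Ω → ℝ}
    (hb : ∀ ω, f ω ∈ Icc (0 : ℝ) 1) {E : Set Ω} (hE : ∀ ω, f ω ≠ 0 → ω ∈ E) :
    ∫ ω, f ω ∂P ≤ P.real E := by
  set E' := toMeasurable P E
  have hm : MeasurableSet E' := measurableSet_toMeasurable P E
  have h1 : ∫ ω, f ω ∂P ≤ ∫ ω, E'.indicator (fun _ => (1 : ℝ)) ω ∂P := by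
    refine integral_mono_of_nonneg (ae_of_all _ fun ω => (hb ω).1)
      ((integrable_const 1).indicator hm) (ae_of_all _ fun ω => ?_)
    by_cases h : f ω = 0
    · rw [h]
      exact indicator_nonneg (fun _ _ => by norm_num) ω
    · have : ω ∈ E' := subset_toMeasurable P E (hE ω h)
      simpa [this] using (hb ω).2
  rw [integral_indicator_const _ hm] at h1
  simpa [E', measureReal_def, measure_toMeasurable] using h1

theorem markov_real {f : Ω → ℝ} (hf : Integrable f P) (h0 : ∀ ω, 0 ≤ f ω) {e b : ℝ} (he : 0 < e)
    (hb : ∫ ω, f ω ∂P ≤ b) : P.real {ω | e ≤ f ω} ≤ b / e := by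
  rw [le_div_iff₀ he, mul_comm]
  exact (mul_meas_ge_le_integral_of_nonneg (ae_of_all P h0) hf e).trans hb

end Integral

/-! ### From comparison of soft minima to location of minimizers -/

section Transfer

variable {p n : ℕ}

theorem abs_risk_sub_risk_le {ℓ ℓ' : Fin n → ℝ → ℝ} {m : ℝ} (hn : 0 < n)
    (h : ∀ i x, |ℓ' i x - ℓ i x| ≤ m) (R : (Fin p → ℝ) → ℝ) (w : Fin p → ℝ)
    (A : Matrix (Fin n) (Fin p) ℝ) : |risk ℓ' R w A - risk ℓ R w A| ≤ m := by
  have hn0 : (0 : ℝ) < n := by exact_mod_cast hn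
  have e : risk ℓ' R w A - risk ℓ R w A =
      (1 / (n : ℝ)) * ∑ i, (ℓ' i (A.mulVec w i) - ℓ i (A.mulVec w i)) := by
    unfold risk; rw [Finset.sum_sub_distrib]; ring
  rw [e, abs_mul, abs_of_pos (by positivity : 0 < 1 / (n : ℝ))]
  calc _ ≤ 1 / (n : ℝ) * ∑ _i : Fin n, m := by
        gcongr
        exact (Finset.abs_sum_le_sum_abs _ _).trans (Finset.sum_le_sum fun i _ => h i _)
    _ = m := by simp; field_simp

variable {Ω Ω' : Type*} [MeasurableSpace Ω] [MeasurableSpace Ω'] {P : Measure Ω} {P' : Measure Ω'}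
  [IsProbabilityMeasure P] [IsProbabilityMeasure P'] {X : Fin n → Ω → Fin p → ℝ}
  {G : Fin n → Ω' → Fin p → ℝ}

/-- Transfer of the location of the minimizer from the design `G` to the design `X`, given a
comparison of smooth functions of soft minima and tail bounds for the discretization errors. -/
theorem measureReal_mem_le_of_comparison {ℓ ℓs : Fin n → ℝ → ℝ} {R : (Fin p → ℝ) → ℝ}
    {L δ s z ρ₀ ε κ mℓ mR lin mk : ℝ} {lip : (Fin n → Fin p → ℝ) → ℝ}
    (hn : 0 < n) (hL : 1 ≤ L) (hδ : 0 < δ) (hs : 0 < s) (hρ₀ : 0 < ρ₀)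
    (hXm : ∀ i, Measurable (X i)) (hℓs : ∀ i, Continuous (ℓs i))
    (hclose : ∀ i x, |ℓs i x - ℓ i x| ≤ mℓ)
    (hlip : ∀ w w' : Fin p → ℝ, ‖w‖ ≤ L → ‖w'‖ ≤ L → ‖w - w'‖ ≤ δ → ∀ A : Fin n → Fin p → ℝ,
      |risk ℓs R w (Matrix.of A) - risk ℓs R w' (Matrix.of A)| ≤ mR + δ * lip A)
    (hmℓ : mℓ ≤ ρ₀ / 32) (hmR : mR ≤ ρ₀ / 32)
    (hent : 3 * p * logPlus (L / δ) / (n * s) ≤ ρ₀ / 32)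
    (htest : ∀ a b : ℝ, |b| = 4 / ρ₀ → SmoothTest κ fun x => Real.smoothTransition (b * (x - a)))
    (hcomp : ∀ N : Finset (Fin p → ℝ), N.Nonempty → (∀ u ∈ N, ‖u‖ ≤ L) → ∀ φ, SmoothTest κ φ →
      ∫ ω, φ (softRisk N ℓs R s (designMatrix X ω)) ∂P ≤
        ∫ ω, φ (softRisk N ℓs R s (designMatrix G ω)) ∂P' + lin)
    (hmkX : P.real {ω | ρ₀ / 32 ≤ δ * lip fun i => X i ω} ≤ mk)
    (hmkG : P'.real {ω | ρ₀ / 32 ≤ δ * lip fun i => G i ω} ≤ mk)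
    {wX : Ω → Fin p → ℝ} {wG : Ω' → Fin p → ℝ}
    (hwX : ∀ᵐ ω ∂P, IsRiskMinimizer ℓ R (designMatrix X ω) (wX ω))
    (hwG : ∀ᵐ ω ∂P', IsRiskMinimizer ℓ R (designMatrix G ω) (wG ω))
    {S : Set (Fin p → ℝ)}
    (hεG : P'.real {ω | L < ‖wG ω‖} ≤ ε) (hεX : P.real {ω | L < ‖wX ω‖} ≤ ε)
    (hmin : P'.real {ω | ((z + ρ₀ : ℝ) : EReal) ≤ minRisk ℓ R univ (designMatrix G ω)} ≤ ε)
    (hminS : P'.real {ω | minRisk ℓ R S (designMatrix G ω) ≤ ((z + 2 * ρ₀ : ℝ) : EReal)} ≤ ε)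
    (hlin : 0 ≤ lin) (hmk : 0 ≤ mk) (hε : 0 ≤ ε) :
    P.real {ω | wX ω ∈ S} ≤ 4 * ε + 2 * lin + 2 * mk := by
  have hn0 : (0 : ℝ) < n := by exact_mod_cast hn
  have hcl := fun w A => abs_le.1 (abs_risk_sub_risk_le hn hclose R w A)
  set T : Set (Fin p → ℝ) := {w | w ∈ S ∧ ‖w‖ ≤ L} with hT
  rcases T.eq_empty_or_nonempty with hTe | hTne
  -- If `S` misses the cube there is no net to build, but then `wX ∈ S` forces `‖wX‖ > L`.
  · refine (measureReal_mono fun ω (hω : wX ω ∈ S) => ?_).trans (hεX.trans (by linarith))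
    by_contra hcon
    have : wX ω ∈ T := ⟨hω, not_lt.1 hcon⟩
    rw [hTe] at this
    exact this
  have hmeasX : Measurable fun ω => (fun i => X i ω : Fin n → Fin p → ℝ) := measurable_pi_iff.2 hXm
  -- nets of the cube and of the part of `S` in it
  obtain ⟨N₁, hN₁, hN₁T, hN₁δ, hN₁c⟩ := exists_finset_net (p := p) (L := L) hδ
    (T := {w | ‖w‖ ≤ L}) (fun w hw => hw) ⟨0, by simpa using by linarith⟩
  obtain ⟨N₂, hN₂, hN₂T, hN₂δ, hN₂c⟩ := exists_finset_net (p := p) (L := L) hδ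
    (T := T) (fun w hw => hw.2) hTne
  have hent' : ∀ N : Finset (Fin p → ℝ), N.Nonempty → (N.card : ℝ) ≤ (2 * L / δ + 1) ^ p →
      Real.log N.card / (n * s) ≤ ρ₀ / 32 := fun N hN hc => by
    refine le_trans ?_ hent
    gcongr
    exact log_card_net_le hN (by linarith) hδ hc
  -- upper bound of the soft minimum near a good point
  have upper : ∀ N : Finset (Fin p → ℝ), (∀ u ∈ N, ‖u‖ ≤ L) → ∀ w : Fin p → ℝ, ‖w‖ ≤ L →
      (∃ u ∈ N, ‖w - u‖ ≤ δ) → ∀ A : Fin n → Fin p → ℝ, δ * lip A < ρ₀ / 32 →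
      softRisk N ℓs R s (Matrix.of A) < risk ℓ R w (Matrix.of A) + 3 * (ρ₀ / 32) := by
    rintro N hNL w hw ⟨u, hu, hwu⟩ A hA
    have h1 := softRisk_le_risk (ℓ := ℓs) (R := R) hs hn (Matrix.of A) hu
    have h2 := (abs_le.1 (hlip w u hw (hNL u hu) hwu A)).1
    have h3 := (hcl w (Matrix.of A)).2
    linarith
  have lower : ∀ N : Finset (Fin p → ℝ), N.Nonempty → (N.card : ℝ) ≤ (2 * L / δ + 1) ^ p →
      ∀ (b : ℝ) (A : Matrix (Fin n) (Fin p) ℝ), (∀ u ∈ N, b ≤ risk ℓ R u A) →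
      b - 2 * (ρ₀ / 32) ≤ softRisk N ℓs R s A := by
    intro N hN hc b A hb
    have h1 := le_softRisk_of_forall_le (ℓ := ℓs) (R := R) (b := b - mℓ) hs hn A hN fun u hu => by
      have := (hcl u A).1
      have := hb u hu
      linarith
    have := hent' N hN hc
    linarith
  -- `φ₁` rises on `[z + 9/8 ρ₀, z + 11/8 ρ₀]` and `φ₂` falls on `[z + 13/8 ρ₀, z + 15/8 ρ₀]`, hence
  -- the slope `4 / ρ₀`. The gaps of `ρ₀ / 8` to `z + ρ₀`, `z + 3/2 ρ₀` and `z + 2 ρ₀` absorb the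
  -- approximation errors of at most `3 ρ₀ / 32`.
  set φ₁ : ℝ → ℝ := fun x => Real.smoothTransition (4 / ρ₀ * (x - (z + 9 / 8 * ρ₀))) with hφ₁
  set φ₂ : ℝ → ℝ := fun x => Real.smoothTransition (-(4 / ρ₀) * (x - (z + 15 / 8 * ρ₀))) with hφ₂
  have hb : 0 < 4 / ρ₀ := by positivity
  have t₁ : SmoothTest κ φ₁ := htest _ _ (abs_of_pos hb)
  have t₂ : SmoothTest κ φ₂ := htest _ _ (by rw [abs_neg, abs_of_pos hb])
  have φ₁one : ∀ x, z + 11 / 8 * ρ₀ ≤ x → φ₁ x = 1 := fun x hx => by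
    refine Real.smoothTransition.one_of_one_le ?_
    rw [div_mul_eq_mul_div, le_div_iff₀ hρ₀]; linarith
  have φ₁zero : ∀ x, x ≤ z + 9 / 8 * ρ₀ → φ₁ x = 0 := fun x hx =>
    Real.smoothTransition.zero_of_nonpos (mul_nonpos_of_nonneg_of_nonpos hb.le (by linarith))
  have φ₂one : ∀ x, x ≤ z + 13 / 8 * ρ₀ → φ₂ x = 1 := fun x hx => by
    refine Real.smoothTransition.one_of_one_le ?_
    rw [neg_mul, ← mul_neg, div_mul_eq_mul_div, le_div_iff₀ hρ₀]; linarith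
  have φ₂zero : ∀ x, z + 15 / 8 * ρ₀ ≤ x → φ₂ x = 0 := fun x hx =>
    Real.smoothTransition.zero_of_nonpos (mul_nonpos_of_nonpos_of_nonneg (by linarith) (by linarith))
  have hN₂L : ∀ u ∈ N₂, ‖u‖ ≤ L := fun u hu => (hN₂T u hu).2
  -- the event for the design `X`
  have hmeas : ∀ N : Finset (Fin p → ℝ), N.Nonempty → ∀ φ, SmoothTest κ φ →
      Measurable fun ω => φ (softRisk N ℓs R s (designMatrix X ω)) := fun N hN φ hφ =>
    (hφ.contDiff.continuous.comp (continuous_softRisk hN hℓs R s)).measurable.comp hmeasX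
  have p₁ := measureReal_eq_one_le_integral (P := P) (hmeas N₁ hN₁ φ₁ t₁) fun ω => t₁.mem_Icc _
  have p₂ := measureReal_eq_one_le_integral (P := P) (hmeas N₂ hN₂ φ₂ t₂) fun ω => t₂.mem_Icc _
  have hnull : P.real {ω | ¬ IsRiskMinimizer ℓ R (designMatrix X ω) (wX ω)} = 0 := by
    rw [measureReal_def, ae_iff.1 hwX]; rfl
  have hnull' : P'.real {ω | ¬ IsRiskMinimizer ℓ R (designMatrix G ω) (wG ω)} = 0 := by
    rw [measureReal_def, ae_iff.1 hwG]; rfl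
  have hcover : {ω | wX ω ∈ S} ⊆ ((({ω | ¬ IsRiskMinimizer ℓ R (designMatrix X ω) (wX ω)} ∪
      {ω | L < ‖wX ω‖}) ∪ {ω | ρ₀ / 32 ≤ δ * lip fun i => X i ω}) ∪
      {ω | φ₁ (softRisk N₁ ℓs R s (designMatrix X ω)) = 1}) ∪
      {ω | φ₂ (softRisk N₂ ℓs R s (designMatrix X ω)) = 1} := by
    intro ω (hω : wX ω ∈ S)
    by_contra hcon
    simp only [mem_union, mem_ofPred_eq, not_or, not_not, not_lt, not_le] at hcon
    obtain ⟨⟨⟨⟨hm, hLw⟩, hlp⟩, hf₁⟩, hf₂⟩ := hcon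
    -- If the minimal risk is high, `φ₁` on the full net detects it. Otherwise `wX` is a point of
    -- `S` in the cube with low risk, and `φ₂` on the net of `S` detects that.
    rcases le_total (z + 3 / 2 * ρ₀) (risk ℓ R (wX ω) (designMatrix X ω)) with hc | hc
    · refine hf₁ (φ₁one _ ?_)
      have := lower N₁ hN₁ hN₁c _ (designMatrix X ω) fun u _ => hc.trans (hm u)
      linarith
    · refine hf₂ (φ₂one _ ?_)
      have := upper N₂ hN₂L (wX ω) hLw (hN₂δ _ ⟨hω, hLw⟩) (fun i => X i ω) hlp
      have e : designMatrix X ω = Matrix.of fun i => X i ω := rfl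
      rw [← e] at this
      linarith
  have hPX : P.real {ω | wX ω ∈ S} ≤ ε + mk +
      ∫ ω, φ₁ (softRisk N₁ ℓs R s (designMatrix X ω)) ∂P +
      ∫ ω, φ₂ (softRisk N₂ ℓs R s (designMatrix X ω)) ∂P := by
    refine (measureReal_mono hcover).trans ?_
    have u1 := measureReal_union_le (μ := P)
      {ω | ¬ IsRiskMinimizer ℓ R (designMatrix X ω) (wX ω)} {ω | L < ‖wX ω‖}
    have u2 := measureReal_union_le (μ := P)
      ({ω | ¬ IsRiskMinimizer ℓ R (designMatrix X ω) (wX ω)} ∪ {ω | L < ‖wX ω‖})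
      {ω | ρ₀ / 32 ≤ δ * lip fun i => X i ω}
    refine (measureReal_union_le _ _).trans ?_
    refine (add_le_add (measureReal_union_le _ _) le_rfl).trans ?_
    linarith
  -- the events for the design `G`
  have g₁ : ∫ ω, φ₁ (softRisk N₁ ℓs R s (designMatrix G ω)) ∂P' ≤ 2 * ε + mk := by
    refine (integral_le_measureReal (P := P') (E :=
      (({ω | ¬ IsRiskMinimizer ℓ R (designMatrix G ω) (wG ω)} ∪ {ω | L < ‖wG ω‖}) ∪
      {ω | ρ₀ / 32 ≤ δ * lip fun i => G i ω}) ∪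
      {ω | ((z + ρ₀ : ℝ) : EReal) ≤ minRisk ℓ R univ (designMatrix G ω)})
      (fun ω => t₁.mem_Icc _) fun ω hω => ?_).trans ?_
    · by_contra hcon
      simp only [mem_union, mem_ofPred_eq, not_or, not_not, not_lt] at hcon
      obtain ⟨⟨⟨hm, hLw⟩, hlp⟩, hmin'⟩ := hcon
      have hlp := not_le.1 hlp
      refine hmin' (le_iInf₂ fun w _ => EReal.coe_le_coe_iff.2 ?_)
      refine le_trans ?_ (hm w)
      by_contra hlt
      refine hω (φ₁zero _ ?_)
      have := upper N₁ hN₁T (wG ω) hLw (hN₁δ _ hLw) (fun i => G i ω) hlp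
      have e : designMatrix G ω = Matrix.of fun i => G i ω := rfl
      rw [← e] at this
      linarith [not_le.1 hlt]
    · have u1 := measureReal_union_le (μ := P')
        {ω | ¬ IsRiskMinimizer ℓ R (designMatrix G ω) (wG ω)} {ω | L < ‖wG ω‖}
      refine (measureReal_union_le _ _).trans ?_
      refine (add_le_add (measureReal_union_le _ _) le_rfl).trans ?_
      linarith
  have g₂ : ∫ ω, φ₂ (softRisk N₂ ℓs R s (designMatrix G ω)) ∂P' ≤ ε := by
    refine (integral_le_measureReal (P := P') (fun ω => t₂.mem_Icc _) fun ω hω => ?_).trans hminS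
    by_contra hcon
    simp only [mem_ofPred_eq, not_le] at hcon
    refine hω (φ₂zero _ ?_)
    have := lower N₂ hN₂ hN₂c (z + 2 * ρ₀) (designMatrix G ω) fun u hu => by
      have h1 : minRisk ℓ R S (designMatrix G ω) ≤ ((risk ℓ R u (designMatrix G ω) : ℝ) : EReal) :=
        iInf₂_le u (hN₂T u hu).1
      exact EReal.coe_le_coe_iff.1 (hcon.le.trans h1)
    linarith
  have c₁ := hcomp N₁ hN₁ hN₁T φ₁ t₁
  have c₂ := hcomp N₂ hN₂ hN₂L φ₂ t₂
  linarith

end Transfer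

/-! ### Consequences of the assumptions on loss and design -/

section Assumptions

variable {n p : ℕ} {q : Fin 4 → ℝ} {Ω : Type*} [MeasurableSpace Ω] {P : Measure Ω}

theorem LossAssumption.exists_smoothLoss {ρbar ρ : ℝ} {Lℓ : Fin n → ℝ} {Dℓ Mℓ : ℝ → ℝ}
    {ℓ : Fin n → ℝ → ℝ} (h : LossAssumption q ρbar Lℓ Dℓ Mℓ ℓ) (hρ : ρ ∈ Ioo 0 ρbar) :
    ∃ ℓs : Fin n → ℝ → ℝ, (∀ i, SmoothLoss q (Dℓ ρ) (Lℓ i) (ℓs i)) ∧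
      ∀ i x, |ℓs i x - ℓ i x| ≤ Mℓ ρ := by
  obtain ⟨ℓs, hs⟩ := h.smooth_approx
  refine ⟨fun i => ℓs i ρ, fun i => ?_, fun i => (hs ρ hρ i).2.2.1⟩
  obtain ⟨h0, hc, hM, hD⟩ := hs ρ hρ i
  refine ⟨h0, hc, fun k hk x => ?_, fun x => ?_⟩
  · have h1 := hD k hk x
    have h2 := Real.rpow_nonneg (h0 x) (q k)
    rwa [abs_of_nonneg (h0 x), div_le_iff₀ (by linarith)] at h1
  -- The `2` in the growth bound absorbs the approximation error, as `Mℓ ρ ≤ 1 ≤ Lℓ i`.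
  · have h1 := h.growth i x
    have h2 := Real.rpow_nonneg (abs_nonneg x) (q 0)
    rw [div_le_iff₀ (by linarith)] at h1
    have h3 := (abs_le.1 (hM x)).2
    have h4 := (h.M_mem ρ hρ).2
    have h5 := le_abs_self (ℓ i x)
    have h6 := h.one_le_L i
    nlinarith

theorem CovariateAssumption.iidRows {X : Fin n → Ω → Fin p → ℝ} {Sig : Matrix (Fin p) (Fin p) ℝ}
    {M : ℝ} {d : ℕ} (h : CovariateAssumption P X Sig q M d) (i : Fin n) :
    IidRows P X (P.map (X i)) where
  measurable := h.measurable
  indep := h.indep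
  law j := (h.identDistrib j i).map_eq

theorem IsGaussianDesign.iidRows {G : Fin n → Ω → Fin p → ℝ} {Sig : Matrix (Fin p) (Fin p) ℝ}
    (h : IsGaussianDesign P G Sig) (i : Fin n) : IidRows P G (P.map (G i)) where
  measurable := h.measurable
  indep := h.indep
  law j := by
    have key : ∀ j, P.map (G j) =
        (P.map fun ω => WithLp.toLp 2 (G j ω)).map (WithLp.ofLp : EuclideanSpace ℝ (Fin p) → _) :=
      fun j => by
        have hm : Measurable fun ω => WithLp.toLp 2 (G j ω) :=
          (WithLp.measurable_toLp 2 _).comp (h.measurable j)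
        rw [Measure.map_map (WithLp.measurable_ofLp 2 _) hm]
        rfl
    rw [key j, key i, h.law j, h.law i]

theorem one_le_covConst_add_gaussConst (r : ℕ) (M M' : ℝ) :
    1 ≤ covConst q M + gaussConst r M' := by
  have h1 : 0 ≤ |M| ^ qStar q := by positivity
  have h2 : 0 ≤ gaussConst r M' :=
    mul_nonneg (by positivity) (add_nonneg zero_le_one (integral_nonneg fun y => by positivity))
  unfold covConst
  linarith

theorem rowConst_nonneg {M K θ : ℝ} (hM : 0 ≤ M) (hK : 0 ≤ K) (hθ : 0 ≤ θ) :
    0 ≤ rowConst q M K θ := by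
  have := (sumMomentConst_pos (qHalf q)).le
  unfold rowConst
  positivity

theorem avgL_pos {Λ : Fin n → ℝ} (hn : 0 < n) (hΛ : ∀ i, 1 ≤ Λ i) : 0 < avgL q Λ := by
  have : (0 : ℝ) < n := by exact_mod_cast hn
  have : Nonempty (Fin n) := ⟨⟨0, hn⟩⟩
  exact mul_pos (by positivity) (Finset.sum_pos (fun i _ => Real.rpow_pos_of_pos
    (by linarith [hΛ i]) _) Finset.univ_nonempty)

end Assumptions

/-! ### Numerical inequalities for the choice of parameters -/

section Numeric

theorem pow_four_div_le {ρ₀ : ℝ} (hρ₀ : 0 < ρ₀) {k : ℕ} (hk : k ∈ Finset.Icc 1 3) :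
    (4 / ρ₀) ^ k ≤ 64 * max 1 (ρ₀ ^ (-3 : ℤ)) := by
  obtain ⟨hk1, hk3⟩ := Finset.mem_Icc.1 hk
  have e : ρ₀ ^ (-3 : ℤ) = (1 / ρ₀) ^ 3 := by
    rw [one_div, inv_pow, zpow_neg]; rfl
  have h4 : (4 : ℝ) ^ k ≤ 4 ^ 3 := pow_le_pow_right₀ (by norm_num) hk3
  have h1 : (1 / ρ₀) ^ k ≤ max 1 (ρ₀ ^ (-3 : ℤ)) := by
    rw [e]
    rcases le_total (1 / ρ₀) 1 with h | h
    · exact (pow_le_one₀ (by positivity) h).trans (le_max_left _ _)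
    · exact (pow_le_pow_right₀ h hk3).trans (le_max_right _ _)
  calc (4 / ρ₀) ^ k = 4 ^ k * (1 / ρ₀) ^ k := by rw [← mul_pow]; ring
    _ ≤ 4 ^ 3 * max 1 (ρ₀ ^ (-3 : ℤ)) := by gcongr
    _ = _ := by norm_num

theorem one_div_le_max_one_zpow (ρ₀ : ℝ) :
    1 / ρ₀ ≤ max 1 (ρ₀ ^ (-3 : ℤ)) := by
  rcases le_total (1 / ρ₀) 1 with h | h
  · exact h.trans (le_max_left _ _)
  · refine le_trans ?_ (le_max_right _ _)
    rw [show ρ₀ ^ (-3 : ℤ) = (1 / ρ₀) ^ 3 by rw [one_div, inv_pow, zpow_neg]; rfl]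
    exact le_self_pow₀ h (by norm_num)

theorem rpow_third_pow_three {a : ℝ} (ha : 0 ≤ a) (b : ℝ) : (a ^ (b / 3)) ^ 3 = a ^ b := by
  rw [← Real.rpow_natCast, ← Real.rpow_mul ha]
  congr 1
  push_cast; ring

/-- Optimizing the smoothing parameter `s`. -/
theorem sq_one_add_div_mul_le {B η lg : ℝ} (hη : 0 < η) (hη1 : η ≤ 1) (hlg : 1 ≤ lg)
    (h : η ^ 3 = B * lg ^ 2) : (1 + lg / η) ^ 2 * B ≤ 4 * η ∧ B ≤ η := by
  have hB : B = η ^ 3 / lg ^ 2 := by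
    rw [h]; field_simp
  have hle : B ≤ η ^ 3 := by
    rw [hB]; exact div_le_self (by positivity) (one_le_pow₀ hlg)
  have h3 : η ^ 3 ≤ η := pow_le_of_le_one hη.le hη1 (by norm_num)
  have e : (lg / η) ^ 2 * B = η := by
    rw [hB]; field_simp
  refine ⟨?_, hle.trans h3⟩
  have hB0 : 0 ≤ B := by rw [hB]; positivity
  nlinarith [mul_nonneg hB0 (sq_nonneg (1 - lg / η))]

theorem le_add_pow_three_mul {m m' η D : ℝ} (hm : 0 ≤ m) (hm' : 0 ≤ m') (hη : 0 ≤ η)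
    (hD : 1 ≤ D) : m ≤ m + D ^ 3 * (m' + η) ∧ m' ≤ m + D ^ 3 * (m' + η) ∧
      η ≤ m + D ^ 3 * (m' + η) ∧ D ^ 3 * η ≤ m + D ^ 3 * (m' + η) := by
  have hD3 : 1 ≤ D ^ 3 := one_le_pow₀ hD
  have h1 := le_mul_of_one_le_left hm' hD3
  have h2 := le_mul_of_one_le_left hη hD3
  rw [mul_add]
  refine ⟨?_, ?_, ?_, ?_⟩ <;> linarith

/-- Outside the trivial regime the total error is small compared with `ρ`; the factor `96 = 3 · 32`
lets the entropy `3 θ η` fit into one budget of `ρ / 32`. -/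
theorem bounds_of_mul_le_one {E θ κ ρ : ℝ} (hE : 0 ≤ E) (hθ : 1 ≤ θ) (hκ : 1 ≤ κ) (hρ : 0 < ρ)
    (hκρ : 1 / ρ ≤ κ) (h : 96 * θ * κ * E ≤ 1) :
    96 * (θ * E) ≤ ρ ∧ E ≤ θ * E ∧ E ≤ 1 := by
  have h1 : E ≤ θ * E := le_mul_of_one_le_left hE hθ
  have h2 : θ * E ≤ κ * (θ * E) := le_mul_of_one_le_left (by linarith) hκ
  refine ⟨?_, h1, by linarith⟩
  have h3 : 1 / ρ * (96 * (θ * E)) ≤ 1 :=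
    (mul_le_mul_of_nonneg_right hκρ (by linarith)).trans (by linarith)
  rwa [one_div, inv_mul_le_iff₀ hρ, mul_one] at h3

end Numeric

/-! ### The bound for fixed smoothing parameter and mesh -/

section SmoothingBound

variable {n p d k r : ℕ} {q : Fin 4 → ℝ} {Ω Ω' : Type*} [MeasurableSpace Ω] [MeasurableSpace Ω']
  {P : Measure Ω} {P' : Measure Ω'} [IsProbabilityMeasure P] [IsProbabilityMeasure P']
  {X : Fin n → Ω → Fin p → ℝ} {G : Fin n → Ω' → Fin p → ℝ} {μ ν : Measure (Fin p → ℝ)}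
  {B : Fin k → Finset (Fin p)} {Sig : Matrix (Fin p) (Fin p) ℝ} {K : ℝ}

/-- The constant of the comparison of Gibbs free energies. -/
noncomputable def lindebergConst (q : Fin 4 → ℝ) (M K θ : ℝ) : ℝ :=
  48 * 6 ^ bigQ q * 2 ^ qBar q * rowConst q M K θ

/-- The constant of the discretization error. -/
noncomputable def netConst (q : Fin 4 → ℝ) (K θ : ℝ) : ℝ :=
  4 * 6 ^ q 1 * (1 + K * θ ^ (qBar q + 1))

theorem IidRows.integral_softRisk_le (hX : IidRows P X μ) (hG : IidRows P' G ν)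
    (hq : ∀ k, 0 ≤ q k) (hμ : RowLaw B Sig n r K μ) (hν : RowLaw B Sig n r K ν) (hK : 1 ≤ K)
    (hB : ∀ a b, a ≠ b → Disjoint (B a) (B b)) (hd : 1 ≤ d) (hBd : ∀ a, (B a).card ≤ d)
    (hr : qBar q + 3 ≤ r) (hn : 0 < n) {θ : ℝ} (hθ : 1 ≤ θ) (hp : (p : ℝ) ≤ θ * n)
    {M : ℝ} (hM : 0 ≤ M) {L : ℝ} (hL : 1 ≤ L)
    (hSig : ∀ v : Fin p → ℝ, ∑ i, ∑ j, Sig i j * (v i * v j) ≤ M * ∑ i, v i ^ 2)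
    {ℓ : Fin n → ℝ → ℝ} {D : ℝ} {Λ : Fin n → ℝ} (hℓ : ∀ i, SmoothLoss q D (Λ i) (ℓ i))
    {κ : ℝ} {φ : ℝ → ℝ} (hφ : SmoothTest κ φ) (hD : 1 ≤ D) (hΛ : ∀ i, 1 ≤ Λ i)
    (R : (Fin p → ℝ) → ℝ) {s : ℝ} (hs : 0 < s)
    {N : Finset (Fin p → ℝ)} (hN : N.Nonempty) (hNL : ∀ u ∈ N, ‖u‖ ≤ L) :
    ∫ ω, φ (softRisk N ℓ R s (designMatrix X ω)) ∂P ≤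
      ∫ ω, φ (softRisk N ℓ R s (designMatrix G ω)) ∂P' + lindebergConst q M K θ * κ *
        (D ^ 3 * ((1 + s) ^ 2 * (avgL q Λ * L ^ (qBar q + 3) * sigmaRate n p d q))) := by
  have : IsProbabilityMeasure μ := by
    rw [← hX.law ⟨0, hn⟩]
    exact Measure.isProbabilityMeasure_map (hX.measurable _).aemeasurable
  have : IsProbabilityMeasure ν := by
    rw [← hG.law ⟨0, hn⟩]
    exact Measure.isProbabilityMeasure_map (hG.measurable _).aemeasurable
  have hcont := continuous_softRisk hN (fun i => (hℓ i).contDiff.continuous) R s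
  have hm : Measurable fun A : Fin n → Fin p → ℝ => φ (softRisk N ℓ R s (Matrix.of A)) :=
    (hφ.contDiff.continuous.comp hcont).measurable
  have h := (abs_le.1 (abs_integral_softRisk_sub_le (R := R) hq hμ hν hK hB hd hBd hr hn hθ hp hM hL
    hSig hℓ hφ hD hΛ hs hN hNL)).2
  have eX := hX.integral_eq hm
  have eG := hG.integral_eq hm
  rw [← eX, ← eG] at h
  unfold lindebergConst
  unfold designMatrix
  linarith

theorem IidRows.measureReal_lipBound_le (hX : IidRows P X μ) (hq : ∀ k, 0 ≤ q k)
    (hμ : RowLaw B Sig n r K μ) (hr : qBar q + 3 ≤ r) (hK : 1 ≤ K) (hn : 0 < n) {θ : ℝ}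
    (hθ : 1 ≤ θ) (hp : (p : ℝ) ≤ θ * n) {D L δ e : ℝ} (hD : 1 ≤ D) (hL : 1 ≤ L) {Λ : Fin n → ℝ}
    (hΛ : ∀ i, 1 ≤ Λ i) (hσ : 0 ≤ sigmaRate n p d q) (hδ : δ ∈ Ioo 0 (omegaRate n p d q))
    (he : 0 < e) :
    P.real {ω | e ≤ δ * lipBound q D L Λ fun i => X i ω} ≤
      netConst q K θ * (D * (avgL q Λ * L ^ (qBar q + 3) * sigmaRate n p d q)) / e := by
  obtain ⟨hi, hle⟩ := hX.integral_lipBound_le hμ (by omega) hK hn hp (D := D) (L := L) (q := q)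
    (by linarith) (by linarith) hΛ
  have hA := (avgL_pos (q := q) hn hΛ).le
  have hL0 : 0 ≤ L := by linarith
  have hD0 : 0 ≤ D := by linarith
  refine markov_real (hi.const_mul δ) (fun ω => mul_nonneg hδ.1.le ?_) he ?_
  · unfold lipBound lipConst
    refine mul_nonneg (by positivity) (mul_nonneg (by positivity) (Finset.sum_nonneg fun i _ => ?_))
    have := hΛ i
    exact mul_nonneg (Real.rpow_nonneg (by linarith) _) (by positivity)
  · rw [integral_const_mul]
    have h1 := mul_lipConst_le hq hn hD0 hL hσ hδ.2
    have h2 : 0 ≤ (1 + K * θ ^ (qBar q + 1)) * avgL q Λ := by positivity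
    calc _ ≤ δ * (lipConst q n D L * ((1 + K * θ ^ (qBar q + 1)) * avgL q Λ)) := by
          gcongr
          exact hδ.1.le
      _ = δ * lipConst q n D L * ((1 + K * θ ^ (qBar q + 1)) * avgL q Λ) := by ring
      _ ≤ 4 * 6 ^ q 1 * D * (L ^ (qBar q + 3) * sigmaRate n p d q) *
          ((1 + K * θ ^ (qBar q + 1)) * avgL q Λ) := by gcongr
      _ = _ := by unfold netConst; ring

/-- The final constant; `C` bounds the first three derivatives of the test function. -/
noncomputable def universalityConst (q : Fin 4 → ℝ) (M K θ C : ℝ) : ℝ :=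
  96 * θ + 512 * lindebergConst q M K θ * C + 64 * netConst q K θ

theorem measureReal_mem_le_of_smoothLoss (hX : IidRows P X μ) (hG : IidRows P' G ν)
    (hq : ∀ k, 0 ≤ q k) (hμ : RowLaw B Sig n r K μ) (hν : RowLaw B Sig n r K ν) (hK : 1 ≤ K)
    (hB : ∀ a b, a ≠ b → Disjoint (B a) (B b)) (hd : 1 ≤ d) (hBd : ∀ a, (B a).card ≤ d)
    (hr : qBar q + 3 ≤ r) (hn : 0 < n) (hp0 : 0 < p) {θ : ℝ} (hθ : 1 ≤ θ) (hp : (p : ℝ) ≤ θ * n)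
    {M : ℝ} (hM : 0 ≤ M) {L : ℝ} (hL : 1 ≤ L)
    (hSig : ∀ v : Fin p → ℝ, ∑ i, ∑ j, Sig i j * (v i * v j) ≤ M * ∑ i, v i ^ 2)
    {C : ℝ} (hC1 : 1 ≤ C)
    (hC : ∀ k ∈ Finset.Icc 1 3, ∀ x, |iteratedDeriv k Real.smoothTransition x| ≤ C)
    {ℓ ℓs : Fin n → ℝ → ℝ} {D mℓ : ℝ} {Λ : Fin n → ℝ} (hℓ : ∀ i, SmoothLoss q D (Λ i) (ℓs i))
    (hmℓ : 0 ≤ mℓ) (hclose : ∀ i x, |ℓs i x - ℓ i x| ≤ mℓ) (hD : 1 ≤ D) (hΛ : ∀ i, 1 ≤ Λ i)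
    {R : (Fin p → ℝ) → ℝ} (hR : ConvexOn ℝ univ R) {δ : ℝ} (hδ : δ ∈ Ioo 0 (omegaRate n p d q))
    {wX : Ω → Fin p → ℝ} {wG : Ω' → Fin p → ℝ}
    (hwX : ∀ᵐ ω ∂P, IsRiskMinimizer ℓ R (designMatrix X ω) (wX ω))
    (hwG : ∀ᵐ ω ∂P', IsRiskMinimizer ℓ R (designMatrix G ω) (wG ω))
    {S : Set (Fin p → ℝ)} {z ρ₀ ε : ℝ} (hρ₀ : 0 < ρ₀) (hε : 0 ≤ ε)
    (hεG : P'.real {ω | L < ‖wG ω‖} ≤ ε) (hεX : P.real {ω | L < ‖wX ω‖} ≤ ε)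
    (hmin : P'.real {ω | ((z + ρ₀ : ℝ) : EReal) ≤ minRisk ℓ R univ (designMatrix G ω)} ≤ ε)
    (hminS : P'.real {ω | minRisk ℓ R S (designMatrix G ω) ≤ ((z + 2 * ρ₀ : ℝ) : EReal)} ≤ ε) :
    P.real {ω | wX ω ∈ S} ≤ 4 * ε + universalityConst q M K θ C * max 1 (ρ₀ ^ (-3 : ℤ)) *
      (mℓ + D ^ 3 * (regModulus R L δ + avgL q Λ ^ ((1 : ℝ) / 3) * L ^ (((qBar q : ℝ) + 3) / 3) *
        logPlus (L / δ) ^ ((2 : ℝ) / 3) * sigmaRate n p d q ^ ((1 : ℝ) / 3))) := by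
  have hn0 : (0 : ℝ) < n := by exact_mod_cast hn
  have hL0 : 0 < L := by linarith
  have hA := avgL_pos (q := q) hn hΛ
  have hσ := sigmaRate_pos q hn hp0 hd
  have hlg := one_le_logPlus (L / δ)
  have hmR := regModulus_nonneg R L δ
  have hκ1 : 1 ≤ max 1 (ρ₀ ^ (-3 : ℤ)) := le_max_left _ _
  have hκρ := one_div_le_max_one_zpow ρ₀
  have hpow := fun k hk => pow_four_div_le hρ₀ (k := k) hk
  set κ₀ := max 1 (ρ₀ ^ (-3 : ℤ)) with hκ₀
  set lg := logPlus (L / δ) with hlgdef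
  set mR := regModulus R L δ with hmRdef
  set σ := sigmaRate n p d q with hσdef
  set B₀ := avgL q Λ * L ^ (qBar q + 3) * σ with hB₀
  set η := avgL q Λ ^ ((1 : ℝ) / 3) * L ^ (((qBar q : ℝ) + 3) / 3) * lg ^ ((2 : ℝ) / 3) *
    σ ^ ((1 : ℝ) / 3) with hηdef
  have hlg0 : 0 < lg := by linarith
  have hη : 0 < η := by positivity
  have hB₀p : 0 < B₀ := by positivity
  have hη3 : η ^ 3 = B₀ * lg ^ 2 := by
    rw [hηdef, mul_pow, mul_pow, mul_pow, rpow_third_pow_three hA.le, rpow_third_pow_three hL0.le,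
      rpow_third_pow_three hlg0.le, rpow_third_pow_three hσ.le, Real.rpow_one, Real.rpow_one,
      show ((qBar q : ℝ) + 3) = ((qBar q + 3 : ℕ) : ℝ) by push_cast; ring, Real.rpow_natCast,
      Real.rpow_two, hB₀]
    ring
  have hlinc : 0 ≤ lindebergConst q M K θ := by
    have := rowConst_nonneg (q := q) hM (by linarith : 0 ≤ K) (by linarith : 0 ≤ θ)
    unfold lindebergConst; positivity
  have hnetc : 0 ≤ netConst q K θ := by unfold netConst; positivity
  have hD3' : D ≤ D ^ 3 := le_self_pow₀ hD (by norm_num)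
  obtain ⟨hEl, hEm, hEη', hEη⟩ := le_add_pow_three_mul hmℓ hmR hη.le hD
  set E := mℓ + D ^ 3 * (mR + η) with hE
  have hE0 : 0 ≤ E := hmℓ.trans hEl
  have hCge : 96 * θ ≤ universalityConst q M K θ C := by
    have h1 : 0 ≤ 512 * lindebergConst q M K θ * C := by positivity
    unfold universalityConst
    linarith
  -- If the error is not small, the right-hand side already exceeds one.
  rcases le_total 1 (96 * θ * κ₀ * E) with hbig | hsmall
  · have h1 : P.real {ω | wX ω ∈ S} ≤ 1 := measureReal_le_one
    have h2 : 96 * θ * κ₀ * E ≤ universalityConst q M K θ C * κ₀ * E := by gcongr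
    linarith
  obtain ⟨hEρ, hθE, hE1⟩ := bounds_of_mul_le_one hE0 hθ hκ1 hρ₀ hκρ hsmall
  have hη1 : η ≤ 1 := hEη'.trans hE1
  obtain ⟨hs1, hs2⟩ := sq_one_add_div_mul_le hη hη1 hlg hη3
  -- This balances the entropy, proportional to `lg / s`, against the comparison error, proportional
  -- to `s² B₀`.
  set s := lg / η with hsdef
  have hs : 0 < s := by positivity
  have hlin0 : 0 ≤ lindebergConst q M K θ * (64 * κ₀ * C) * (D ^ 3 * ((1 + s) ^ 2 * B₀)) := by
    positivity
  have hmk0 : 0 ≤ netConst q K θ * (D * B₀) / (ρ₀ / 32) := by positivity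
  have main := measureReal_mem_le_of_comparison (z := z) (κ := 64 * κ₀ * C)
    (lin := lindebergConst q M K θ * (64 * κ₀ * C) * (D ^ 3 * ((1 + s) ^ 2 * B₀)))
    (mk := netConst q K θ * (D * B₀) / (ρ₀ / 32)) (S := S) (lip := lipBound q D L Λ)
    hn hL hδ.1 hs hρ₀ hX.measurable (fun i => (hℓ i).contDiff.continuous) hclose
    (fun w w' hw hw' h A => abs_risk_sub_le hq hR hℓ hD hΛ hL hn hw hw' h A)
    (by linarith) (by rw [← hmRdef]; linarith) ?_
    (fun a b hb => smoothTest_smoothTransition hC fun k hk => by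
      rw [hb]
      exact mul_le_mul_of_nonneg_right (hpow k hk) (by linarith))
    (fun N hN hNL φ hφ => hX.integral_softRisk_le hG hq hμ hν hK hB hd hBd hr hn hθ hp hM hL hSig
      hℓ hφ hD hΛ R hs hN hNL)
    (hX.measureReal_lipBound_le hq hμ hr hK hn hθ hp hD hL hΛ hσ.le hδ (by positivity))
    (hG.measureReal_lipBound_le hq hν hr hK hn hθ hp hD hL hΛ hσ.le hδ (by positivity))
    hwX hwG hεG hεX hmin hminS hlin0 hmk0 hε
  -- Each error enters twice: `2 · 64 · 4 = 512` and `2 · 32 = 64` are the coefficients in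
  -- `universalityConst`.
  · refine main.trans ?_
    have b1 : lindebergConst q M K θ * (64 * κ₀ * C) * (D ^ 3 * ((1 + s) ^ 2 * B₀)) ≤
        lindebergConst q M K θ * (64 * κ₀ * C) * (4 * E) := by
      refine mul_le_mul_of_nonneg_left ?_ (by positivity)
      calc D ^ 3 * ((1 + s) ^ 2 * B₀) ≤ D ^ 3 * (4 * η) := by gcongr
        _ ≤ 4 * E := by linarith
    have b2 : netConst q K θ * (D * B₀) / (ρ₀ / 32) ≤ netConst q K θ * E * (32 * κ₀) := by
      calc _ = netConst q K θ * (D * B₀) * (32 * (1 / ρ₀)) := by field_simp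
        _ ≤ netConst q K θ * E * (32 * κ₀) := by
          gcongr
          calc D * B₀ ≤ D ^ 3 * η := by gcongr
            _ ≤ E := hEη
    have b3 : 0 ≤ 96 * θ * κ₀ * E := by positivity
    unfold universalityConst
    linarith
  · have h1 : 3 * (p : ℝ) * lg / (n * s) ≤ 3 * (θ * n) * lg / (n * s) := by gcongr
    have h2 : 3 * (θ * n) * lg / (n * s) = 3 * θ * η := by
      rw [hsdef]; field_simp
    have h3 : θ * η ≤ θ * E := by gcongr
    linarith

end SmoothingBound

end BlockUniversality

/-! ### Assembly: uniform constant and infima in the rate -/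

theorem theorem2 (τ : ℝ) (hτ : τ ∈ Set.Ioo (0 : ℝ) 1) (q : Fin 4 → ℝ)
    (hq : ∀ k, 0 ≤ q k) (M : ℝ) :
    ∃ C₀ : ℝ, 0 < C₀ ∧
      ∀ (n p d : ℕ), 0 < n → τ ≤ (p : ℝ) / n → (p : ℝ) / n ≤ 1 / τ →
      ∀ (ℓ : Fin n → ℝ → ℝ) (R : (Fin p → ℝ) → ℝ),
        (∀ i, ConvexOn ℝ Set.univ (ℓ i)) → ConvexOn ℝ Set.univ R →
      ∀ (ρbar : ℝ) (Lℓ : Fin n → ℝ) (Dℓ Mℓ : ℝ → ℝ),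
        BlockUniversality.LossAssumption q ρbar Lℓ Dℓ Mℓ ℓ →
      ∀ (Sig : Matrix (Fin p) (Fin p) ℝ)
        (Ω : Type*) [MeasurableSpace Ω] (P : Measure Ω) [IsProbabilityMeasure P]
        (X : Fin n → Ω → Fin p → ℝ),
        BlockUniversality.CovariateAssumption P X Sig q M d →
      ∀ (Ω' : Type*) [MeasurableSpace Ω'] (P' : Measure Ω') [IsProbabilityMeasure P']
        (G : Fin n → Ω' → Fin p → ℝ),
        BlockUniversality.IsGaussianDesign P' G Sig →
      ∀ (wX : Ω → Fin p → ℝ) (wG : Ω' → Fin p → ℝ),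
        AEMeasurable wX P → AEMeasurable wG P' →
        (∀ᵐ ω ∂P, BlockUniversality.IsRiskMinimizer ℓ R
          (BlockUniversality.designMatrix X ω) (wX ω)) →
        (∀ᵐ ω ∂P', BlockUniversality.IsRiskMinimizer ℓ R
          (BlockUniversality.designMatrix G ω) (wG ω)) →
      ∀ S : Set (Fin p → ℝ), MeasurableSet S →
      ∀ z ρ₀ L ε : ℝ, 0 < ρ₀ → 1 ≤ L → ε ∈ Set.Ico (0 : ℝ) (1 / 4) →
        max (P'.real {ω | L < ‖wG ω‖}) (P.real {ω | L < ‖wX ω‖}) ≤ ε →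
        max
          (P'.real {ω | ((z + ρ₀ : ℝ) : EReal) ≤ BlockUniversality.minRisk ℓ R Set.univ
            (BlockUniversality.designMatrix G ω)})
          (P'.real {ω | BlockUniversality.minRisk ℓ R S
            (BlockUniversality.designMatrix G ω) ≤ ((z + 2 * ρ₀ : ℝ) : EReal)}) ≤ ε →
        P.real {ω | wX ω ∈ S} ≤
          4 * ε + C₀ * max 1 (ρ₀ ^ (-3 : ℤ)) *
            BlockUniversality.rate d q ρbar Lℓ Dℓ Mℓ R L := by
  obtain ⟨C, hC1, hC⟩ := BlockUniversality.exists_bound_iteratedDeriv_smoothTransition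
  set θ := 1 / τ with hθdef
  set K := BlockUniversality.covConst q M +
    BlockUniversality.gaussConst (BlockUniversality.qStar q) |M| with hKdef
  have hθ : 1 ≤ θ := by
    rw [hθdef, le_div_iff₀ hτ.1]; linarith [hτ.2]
  have hK : 1 ≤ K := BlockUniversality.one_le_covConst_add_gaussConst _ _ _
  have hC₀ : 0 < BlockUniversality.universalityConst q |M| K θ C := by
    have h1 := BlockUniversality.rowConst_nonneg (q := q) (abs_nonneg M)
      (by linarith : 0 ≤ K) (by linarith : 0 ≤ θ)
    unfold BlockUniversality.universalityConst BlockUniversality.lindebergConst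
      BlockUniversality.netConst
    positivity
  refine ⟨_, hC₀, ?_⟩
  intro n p d hn hpn hpn' ℓ R _ hR ρbar Lℓ Dℓ Mℓ hℓ Sig Ω _ P _ X hX Ω' _ P' _ G hG wX wG _ _ hwX hwG
    S _ z ρ₀ L ε hρ₀ hL hε hw hmin
  have hn0 : (0 : ℝ) < n := by exact_mod_cast hn
  have hp0 : 0 < p := by
    have h : (0 : ℝ) < p / n := hτ.1.trans_le hpn
    have : (0 : ℝ) < p := by
      by_contra hcon
      exact absurd h (not_lt.2 (div_nonpos_of_nonpos_of_nonneg (not_lt.1 hcon) hn0.le))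
    exact_mod_cast this
  have hp : (p : ℝ) ≤ θ * n := by rwa [div_le_iff₀ hn0] at hpn'
  -- The partition of a single row suffices, since all rows have the same law.
  obtain ⟨k, -, B, hB, hcov, hBd, hind⟩ := hX.blockDependent ⟨0, hn⟩
  have hd : 1 ≤ d := by
    obtain ⟨a, ha⟩ := hcov ⟨0, hp0⟩
    exact (Finset.card_pos.2 ⟨_, ha⟩).trans_le (hBd a)
  have hSig : ∀ v : Fin p → ℝ, ∑ i, ∑ j, Sig i j * (v i * v j) ≤ |M| * ∑ i, v i ^ 2 := fun v =>
    BlockUniversality.quadratic_le_of_lambdaMax_le hX.posDef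
      (hX.lambdaMax_le.trans (le_abs_self M)) v
  have hgc : 0 ≤ BlockUniversality.gaussConst (BlockUniversality.qStar q) |M| :=
    mul_nonneg (by positivity) (add_nonneg zero_le_one (integral_nonneg fun y => by positivity))
  have hcc : 0 ≤ BlockUniversality.covConst q M := by
    unfold BlockUniversality.covConst; positivity
  have hμ := (hX.rowLaw hn ⟨0, hn⟩ hB hcov hind).mono (by linarith : _ ≤ K)
  have hν := (hG.rowLaw (r := BlockUniversality.qStar q) hX.posDef hn
    (BlockUniversality.diag_le_of_quadratic_le hSig) ⟨0, hn⟩ hB hcov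
    (fun a b hab j hj l hl => hX.sig_eq_zero hn ⟨0, hn⟩ hind hab hj hl)).mono (by linarith : _ ≤ K)
  set C₀ := BlockUniversality.universalityConst q |M| K θ C * max 1 (ρ₀ ^ (-3 : ℤ)) with hC₀def
  have hC₀' : 0 < C₀ := mul_pos hC₀ (lt_max_of_lt_left one_pos)
  have hω : 0 < BlockUniversality.omegaRate n p d q :=
    mul_pos (Real.rpow_pos_of_pos hn0 _) (BlockUniversality.sigmaRate_pos q hn hp0 hd)
  -- Nonempty index sets keep the real infima in the rate from being default values. The estimate
  -- for each pair `(ρ, δ)` then passes to both infima after division by positive factors.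
  have : Nonempty (Ioo 0 ρbar) := (nonempty_Ioo.2 hℓ.rhoBar_mem.1).to_subtype
  have : Nonempty (Ioo 0 (BlockUniversality.omegaRate n p d q)) := (nonempty_Ioo.2 hω).to_subtype
  suffices h : (P.real {ω | wX ω ∈ S} - 4 * ε) / C₀ ≤
      BlockUniversality.rate d q ρbar Lℓ Dℓ Mℓ R L by
    rw [div_le_iff₀ hC₀'] at h
    linarith
  refine le_ciInf fun ρ => ?_
  have hD : 0 < Dℓ ρ ^ 3 := pow_pos (by linarith [hℓ.one_le_D ρ ρ.2]) 3
  rw [← sub_le_iff_le_add', ← div_le_iff₀' hD]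
  refine le_ciInf fun δ => ?_
  rw [div_le_iff₀' hD, sub_le_iff_le_add', div_le_iff₀' hC₀', sub_le_iff_le_add']
  obtain ⟨ℓs, hℓs, hclose⟩ := hℓ.exists_smoothLoss ρ.2
  exact BlockUniversality.measureReal_mem_le_of_smoothLoss (hX.iidRows ⟨0, hn⟩)
    (hG.iidRows ⟨0, hn⟩) hq hμ hν hK hB hd hBd (BlockUniversality.qBar_add_three_le_qStar q)
    hn hp0 hθ hp (abs_nonneg M) hL hSig hC1 hC hℓs (hℓ.M_mem ρ ρ.2).1 hclose
    (hℓ.one_le_D ρ ρ.2) hℓ.one_le_L hR δ.2 hwX hwG hρ₀ hε.1 ((le_max_left _ _).trans hw)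
    ((le_max_right _ _).trans hw) ((le_max_left _ _).trans hmin) ((le_max_right _ _).trans hmin)
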